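/- Let $R$ be a commutative noetherian domain of Krull dimension one and let $M$ be a finitely generated torsion-free $R$-module with endomorphism ring $S=\operatorname{End}_R(M)$. Notation. For a ring $A$ and a right $A$-module $N$, $\operatorname{add}(N)$ (resp. $\operatorname{Add}(N)$) is the class of modules isomorphic to direct summands of finite (resp. arbitrary) direct sums of copies of $N$; $V(N)$ is the monoid of isomorphism classes of modules in $\operatorname{add}(N)$ and $V^*(N)$ is the monoid of isomorphism classes of countably generated modules in $\operatorname{Add}(N)$, both with $[X]+[Y]=[X\oplus Y]$. For a ring $A$, $V(A)=V(A_A)$ and $V^*(A)=V^*(A_A)$. Let $\mathcal T(S)$ be the set of two-sided ideals of $S$ of the form $\operatorname{Tr}_S(P)=\sum_{f\in\operatorname{Hom}_S(P,S)}f(P)$ with $P$ a countably generated projective right $S$-module. A countably generated projective right $S$-module $P$ is $I$-big if every countably generated projective right $S$-module $Q$ with $QI=Q$ is a homomorphic image of $P$. For $I\in\mathcal T(S)$, $\iota_I\colon V(S/I)\to V^*(S)$ sends $[P']$ to $[P]$, where $P$ is the (unique up to isomorphism) $I$-big countably generated projective right $S$-module with $P/PI\cong P'$. Put $B(S)=\bigcup_{0\ne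 I\in\mathcal T(S)}\iota_I(V(S/I))\subseteq V^*(S)$, and let $B(M)\subseteq V^*(M)$ be the set of classes $[X]$ with $[\operatorname{Hom}_R(M,X)]\in B(S)$. The analogous notation is used for the $R_\Sigma$-module $M_\Sigma$. Then: (i) $B(M)=V^*(M)\setminus V(M)$. Moreover, no module in $\operatorname{Add}(M)$ that is not finitely generated is indecomposable. (ii) If $X$ and $Y$ are countably generated modules in $\operatorname{Add}(M)$ that are not finitely generated, then $X\cong Y$ if and only if $X_{\mathfrak m}\cong Y_{\mathfrak m}$ as $R_{\mathfrak m}$-modules for every maximal ideal $\mathfrak m$ of $R$. (iii) $\mathcal T(S)$ is the set of idempotent two-sided ideals of $S$, it is finite, and for every nonzero $I\in\mathcal T(S)$ the ring $S/I$ is left and right artinian. (iv) There is a finite nonempty set $\mathcal F$ of maximal ideals of $R$ such that, for $\Sigma=R\setminus\bigcup\mathcal F$, localization $[X]\mapsto[X_\Sigma]$ induces an isomorphism of semigroups from $B(M)$ onto $B(M_\Sigma)$. (v) $[X]\mapsto[\operatorname{Hom}_R(M,X)]$ induces an isomorphism of semigroups from $B(M)$ onto $B(S)$. For every nonzero $I\in\mathcal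 T(S)$ the map $\iota_I$ is a well-defined injective semigroup homomorphism $V(S/I)\to V^*(S)$, and $B(S)$ is the disjoint union of the images $\iota_I(V(S/I))$, $0\neq I\in\mathcal T(S)$. For each such $I$, $V(S/I)$ is a finitely generated free commutative monoid, and $B(M)$ is a finitely generated semigroup. -/

import Mathlib

/-! Left modules over a ring `A` are `Module A`; right modules over a ring `S` are `Module Sᵐᵒᵖ`. -/

universe u v w w'

noncomputable section

namespace DirectSumDecomp

open MulOpposite

/-! ### The classes `add(M)` and `Add(M)` -/

section Basic

variable (A : Type u) [Ring A]

/-- `X` is countably generated. -/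
def CountablyGenerated (X : Type v) [AddCommGroup X] [Module A X] : Prop :=
  ∃ s : Set X, s.Countable ∧ Submodule.span A s = ⊤

/-- `X ∣ Y`: `X` is isomorphic to a direct summand of `Y`. -/
def IsSummand (X : Type v) [AddCommGroup X] [Module A X]
    (Y : Type w) [AddCommGroup Y] [Module A Y] : Prop :=
  ∃ (i : X →ₗ[A] Y) (p : Y →ₗ[A] X), p ∘ₗ i = LinearMap.id

/-- `X` is in `Add(M)`: a direct summand of a direct sum of copies of `M` over an index set `Λ`
(living in the universe `w'`). -/
def InAddInf (M : Type v) [AddCommGroup M] [Module A M]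
    (X : Type w) [AddCommGroup X] [Module A X] : Prop :=
  ∃ Λ : Type w', IsSummand A X (Λ →₀ M)

/-- `X` is in `add(M)`: a direct summand of a finite direct sum of copies of `M`. -/
def InAddFin (M : Type v) [AddCommGroup M] [Module A M]
    (X : Type w) [AddCommGroup X] [Module A X] : Prop :=
  ∃ n : ℕ, IsSummand A X (Fin n →₀ M)

/-- A module is indecomposable if it is nonzero and in every decomposition into an internal direct
sum of two submodules one of the two is zero. -/
def IsIndecomposable (X : Type v) [AddCommGroup X] [Module A X] : Prop :=
  Nontrivial X ∧ ∀ N N' : Submodule A X, IsCompl N N' → N = ⊥ ∨ N' = ⊥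

/-! ### The monoid of isomorphism classes of modules -/

instance isoSetoid : Setoid (ModuleCat.{v} A) where
  r X Y := Nonempty (X ≃ₗ[A] Y)
  iseqv := ⟨fun X => ⟨LinearEquiv.refl A X⟩, fun ⟨e⟩ => ⟨e.symm⟩, fun ⟨e⟩ ⟨f⟩ => ⟨e.trans f⟩⟩

/-- Isomorphism classes of `A`-modules. -/
def IsoClass : Type (max u (v + 1)) := Quotient (isoSetoid.{u, v} A)

variable {A} in
/-- The isomorphism class `[X]`. -/
def cls (X : ModuleCat.{v} A) : IsoClass.{u, v} A := Quotient.mk _ X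

variable {A} in
theorem cls_eq_iff {X Y : ModuleCat.{v} A} : cls X = cls Y ↔ Nonempty (X ≃ₗ[A] Y) :=
  Quotient.eq (r := isoSetoid A)

variable {A} in
theorem cls_surj (x : IsoClass.{u, v} A) : ∃ X, cls X = x := Quotient.exists_rep x

/-- `[X] + [Y] = [X ⊕ Y]`. -/
instance : Add (IsoClass.{u, v} A) where
  add := Quotient.map₂ (fun X Y => ModuleCat.of A (X × Y))
    (fun _ _ ⟨e⟩ _ _ ⟨f⟩ => ⟨LinearEquiv.prodCongr e f⟩)

instance : Zero (IsoClass.{u, v} A) := ⟨cls (ModuleCat.of A PUnit.{v + 1})⟩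

variable {A} in
theorem cls_add (X Y : ModuleCat.{v} A) : cls X + cls Y = cls (ModuleCat.of A (X × Y)) := rfl

theorem cls_zero : (0 : IsoClass.{u, v} A) = cls (ModuleCat.of A PUnit.{v + 1}) := rfl

instance : AddCommMonoid (IsoClass.{u, v} A) where
  add_assoc x y z := by
    obtain ⟨X, rfl⟩ := cls_surj x
    obtain ⟨Y, rfl⟩ := cls_surj y
    obtain ⟨Z, rfl⟩ := cls_surj z
    exact cls_eq_iff.2 ⟨LinearEquiv.prodAssoc A X Y Z⟩
  zero_add x := by
    obtain ⟨X, rfl⟩ := cls_surj x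
    exact cls_eq_iff.2 ⟨LinearEquiv.uniqueProd⟩
  add_zero x := by
    obtain ⟨X, rfl⟩ := cls_surj x
    exact cls_eq_iff.2 ⟨LinearEquiv.prodUnique⟩
  add_comm x y := by
    obtain ⟨X, rfl⟩ := cls_surj x
    obtain ⟨Y, rfl⟩ := cls_surj y
    exact cls_eq_iff.2 ⟨LinearEquiv.prodComm A X Y⟩
  nsmul := nsmulRec

end Basic

section Closure

variable {A : Type u} [Ring A]

theorem IsSummand.of_equiv {X X' : Type v} [AddCommGroup X] [Module A X] [AddCommGroup X']
    [Module A X'] {Y : Type w} [AddCommGroup Y] [Module A Y] (e : X ≃ₗ[A] X')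
    (h : IsSummand A X Y) : IsSummand A X' Y := by
  obtain ⟨i, p, hip⟩ := h
  refine ⟨i ∘ₗ e.symm.toLinearMap, e.toLinearMap ∘ₗ p, ?_⟩
  ext x
  have := LinearMap.congr_fun hip (e.symm x)
  simp at this
  simp [this]

theorem IsSummand.prod {X X' : Type v} [AddCommGroup X] [Module A X] [AddCommGroup X']
    [Module A X'] {Y Y' Z : Type*} [AddCommGroup Y] [Module A Y] [AddCommGroup Y'] [Module A Y']
    [AddCommGroup Z] [Module A Z] (e : (Y × Y') ≃ₗ[A] Z)
    (h : IsSummand A X Y) (h' : IsSummand A X' Y') : IsSummand A (X × X') Z := by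
  obtain ⟨i, p, hip⟩ := h
  obtain ⟨j, q, hjq⟩ := h'
  refine ⟨e.toLinearMap ∘ₗ i.prodMap j, p.prodMap q ∘ₗ e.symm.toLinearMap, ?_⟩
  refine LinearMap.ext fun x => ?_
  have h1 := LinearMap.congr_fun hip x.1
  have h2 := LinearMap.congr_fun hjq x.2
  simp at h1 h2
  simp [h1, h2]

theorem CountablyGenerated.of_surjective {X X' : Type v} [AddCommGroup X] [Module A X]
    [AddCommGroup X'] [Module A X'] (f : X →ₗ[A] X') (hf : Function.Surjective f)
    (h : CountablyGenerated A X) : CountablyGenerated A X' := by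
  obtain ⟨s, hs, hs'⟩ := h
  refine ⟨f '' s, hs.image f, ?_⟩
  rw [Submodule.span_image, hs', Submodule.map_top, LinearMap.range_eq_top.2 hf]

theorem CountablyGenerated.prod {X X' : Type v} [AddCommGroup X] [Module A X]
    [AddCommGroup X'] [Module A X']
    (h : CountablyGenerated A X) (h' : CountablyGenerated A X') :
    CountablyGenerated A (X × X') := by
  obtain ⟨s, hs, hs'⟩ := h
  obtain ⟨t, ht, ht'⟩ := h'
  refine ⟨LinearMap.inl A X X' '' s ∪ LinearMap.inr A X X' '' t, (hs.image _).union (ht.image _), ?_⟩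
  rw [LinearMap.span_inl_union_inr, hs', ht', Submodule.prod_top]

end Closure

section Monoids

variable (A : Type u) [Ring A] (M : Type v) [AddCommGroup M] [Module A M]

/-- `V(M)`: the monoid of isomorphism classes of modules in `add(M)`. -/
def V : AddSubmonoid (IsoClass.{u, v} A) where
  carrier := {x | ∃ X : ModuleCat.{v} A, cls X = x ∧ InAddFin A M X}
  zero_mem' := ⟨_, (cls_zero A).symm, 0, 0, 0, Subsingleton.elim _ _⟩
  add_mem' := by
    rintro _ _ ⟨X, rfl, n, hX⟩ ⟨Y, rfl, m, hY⟩
    exact ⟨_, (cls_add X Y).symm, n + m, hX.prod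
      ((Finsupp.sumFinsuppLEquivProdFinsupp A).symm.trans
        (Finsupp.domLCongr finSumFinEquiv)) hY⟩

/-- `V*(M)`: the monoid of isomorphism classes of countably generated modules in `Add(M)`. -/
def VStar : AddSubmonoid (IsoClass.{u, v} A) where
  carrier := {x | ∃ X : ModuleCat.{v} A, cls X = x ∧ CountablyGenerated A X ∧
    InAddInf.{u, v, v, v} A M X}
  zero_mem' := ⟨_, (cls_zero A).symm, ⟨∅, Set.countable_empty, Subsingleton.elim _ _⟩,
    PEmpty, 0, 0, Subsingleton.elim _ _⟩
  add_mem' := by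
    rintro _ _ ⟨X, rfl, hX, Λ, hX'⟩ ⟨Y, rfl, hY, Λ', hY'⟩
    exact ⟨_, (cls_add X Y).symm, hX.prod hY, Λ ⊕ Λ',
      hX'.prod (Finsupp.sumFinsuppLEquivProdFinsupp A).symm hY'⟩

end Monoids

/-! ### Trace ideals and relatively big projective right modules -/

section Right

variable (S : Type v) [Ring S]

/-- The trace `Tr_S(P) = ∑_{f ∈ Hom_S(P, S)} f(P)` of a right `S`-module `P`. -/
def traceIdeal (P : Type v) [AddCommGroup P] [Module Sᵐᵒᵖ P] : Ideal S :=
  Submodule.span S {s | ∃ (f : P →ₗ[Sᵐᵒᵖ] S) (p : P), f p = s}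

instance traceIdeal_isTwoSided (P : Type v) [AddCommGroup P] [Module Sᵐᵒᵖ P] :
    (traceIdeal S P).IsTwoSided where
  mul_mem_of_left {a} b ha := by
    refine Submodule.span_induction (p := fun x _ => x * b ∈ traceIdeal S P) ?_ ?_ ?_ ?_ ha
    · rintro _ ⟨f, p, rfl⟩
      exact Submodule.subset_span ⟨f, op b • p, by simp⟩
    · simp
    · intro x y _ _ hx hy
      rw [add_mul]
      exact add_mem hx hy
    · intro c x _ hx
      rw [smul_eq_mul, mul_assoc]
      exact Ideal.mul_mem_left _ c hx

/-- The set `𝒯(S)` of the two-sided ideals of `S` that are traces of countably generated projective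
right `S`-modules. -/
def traceIdeals : Set (Ideal S) :=
  {I | ∃ P : ModuleCat.{v} Sᵐᵒᵖ, CountablyGenerated Sᵐᵒᵖ P ∧ Module.Projective Sᵐᵒᵖ P ∧
    traceIdeal S P = I}

/-- The nonzero elements of `𝒯(S)`. -/
def NonzeroTraceIdeal : Type v := {I : Ideal S // I ∈ traceIdeals S ∧ I ≠ ⊥}

variable {S}

/-- The underlying ideal. -/
def NonzeroTraceIdeal.ideal (I : NonzeroTraceIdeal S) : Ideal S := I.1

instance (I : NonzeroTraceIdeal S) : I.ideal.IsTwoSided := by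
  obtain ⟨_, ⟨P, _, _, rfl⟩, _⟩ := I
  exact traceIdeal_isTwoSided S P

/-- The submodule `P I` of a right module `P`. -/
def mulIdeal (P : Type v) [AddCommGroup P] [Module Sᵐᵒᵖ P] (I : Ideal S) : Submodule Sᵐᵒᵖ P :=
  Submodule.span Sᵐᵒᵖ {x | ∃ s ∈ I, ∃ p : P, op s • p = x}

/-- `P` is `I`-big: every countably generated projective right `S`-module `Q` with `Q I = Q` is a
homomorphic image of `P`. -/
def IsBig (I : Ideal S) (P : Type v) [AddCommGroup P] [Module Sᵐᵒᵖ P] : Prop :=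
  ∀ Q : ModuleCat.{v} Sᵐᵒᵖ, CountablyGenerated Sᵐᵒᵖ Q → Module.Projective Sᵐᵒᵖ Q →
    mulIdeal Q I = ⊤ → ∃ f : P →ₗ[Sᵐᵒᵖ] Q, Function.Surjective f

/-- `P / P I ≅ P'` as right `S / I`-modules, expressed by the corresponding projection `P → P'`,
which is semilinear along `S → S / I`. -/
def QuotientIso (I : Ideal S) [I.IsTwoSided] (P : Type v) [AddCommGroup P] [Module Sᵐᵒᵖ P]
    (P' : Type v) [AddCommGroup P'] [Module (S ⧸ I)ᵐᵒᵖ P'] : Prop :=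
  ∃ π : P →ₛₗ[RingHom.op (Ideal.Quotient.mk I)] P',
    Function.Surjective π ∧ LinearMap.ker π = mulIdeal P I

/-- The graph of `ι_I : V(S / I) → V*(S)`: the class of a finitely generated projective right
`S / I`-module `P'` is sent to the class of the countably generated projective right `S`-module `P`
which is `I`-big and satisfies `P / P I ≅ P'`. -/
def IotaGraph (I : Ideal S) [I.IsTwoSided] (y : IsoClass.{v, v} (S ⧸ I)ᵐᵒᵖ)
    (x : IsoClass.{v, v} Sᵐᵒᵖ) : Prop :=
  y ∈ V (S ⧸ I)ᵐᵒᵖ (S ⧸ I) ∧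
  ∃ (P' : ModuleCat.{v} (S ⧸ I)ᵐᵒᵖ) (P : ModuleCat.{v} Sᵐᵒᵖ), cls P' = y ∧ cls P = x ∧
    CountablyGenerated Sᵐᵒᵖ P ∧ Module.Projective Sᵐᵒᵖ P ∧ IsBig I P ∧ QuotientIso I P P'

variable (S) in
/-- `B(S)`, the union of the images `ι_I(V(S / I))` over the nonzero `I ∈ 𝒯(S)`. -/
def BRing : Set (IsoClass.{v, v} Sᵐᵒᵖ) :=
  {x | ∃ (I : NonzeroTraceIdeal S) (y : IsoClass.{v, v} (S ⧸ I.ideal)ᵐᵒᵖ), IotaGraph I.ideal y x}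

end Right

/-! ### The functor `Hom(M, -)` and the semigroup `B(M)` -/

section HomFunctor

variable (A : Type u) [Ring A] (M : Type v) [AddCommGroup M] [Module A M]

/-- `Hom_A(M, X)`, regarded as a right module over `End_A(M)` through composition. -/
def HomRight (X : Type w) [AddCommGroup X] [Module A X] : Type max v w := M →ₗ[A] X

instance (X : Type w) [AddCommGroup X] [Module A X] : AddCommGroup (HomRight A M X) :=
  inferInstanceAs (AddCommGroup (M →ₗ[A] X))

instance (X : Type w) [AddCommGroup X] [Module A X] :
    Module (Module.End A M)ᵐᵒᵖ (HomRight A M X) where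
  smul s f := LinearMap.comp (f : M →ₗ[A] X) (unop s : M →ₗ[A] M)
  one_smul f := LinearMap.comp_id (f : M →ₗ[A] X)
  mul_smul s t f :=
    (LinearMap.comp_assoc (unop s : M →ₗ[A] M) (unop t : M →ₗ[A] M) (f : M →ₗ[A] X)).symm
  smul_zero s := LinearMap.zero_comp (unop s : M →ₗ[A] M)
  smul_add s f g := LinearMap.add_comp (unop s : M →ₗ[A] M) (g : M →ₗ[A] X) (f : M →ₗ[A] X)
  add_smul s t f := LinearMap.comp_add (unop s : M →ₗ[A] M) (unop t : M →ₗ[A] M) (f : M →ₗ[A] X)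
  zero_smul f := LinearMap.comp_zero (f : M →ₗ[A] X)

/-- `Hom(M, -)` on isomorphisms. -/
def HomRight.congr {X : Type w} [AddCommGroup X] [Module A X] {Y : Type w'} [AddCommGroup Y]
    [Module A Y] (e : X ≃ₗ[A] Y) : HomRight A M X ≃ₗ[(Module.End A M)ᵐᵒᵖ] HomRight A M Y where
  toFun f := e.toLinearMap ∘ₗ (f : M →ₗ[A] X)
  invFun f := e.symm.toLinearMap ∘ₗ (f : M →ₗ[A] Y)
  map_add' f g := LinearMap.comp_add (f : M →ₗ[A] X) (g : M →ₗ[A] X) e.toLinearMap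
  map_smul' s f := (LinearMap.comp_assoc (unop s : M →ₗ[A] M) (f : M →ₗ[A] X) e.toLinearMap).symm
  left_inv _ := LinearMap.ext fun _ => e.symm_apply_apply _
  right_inv _ := LinearMap.ext fun _ => e.apply_symm_apply _

/-- `Hom(M, X × Y) ≅ Hom(M, X) × Hom(M, Y)`. -/
def HomRight.prodEquiv (X : Type w) [AddCommGroup X] [Module A X] (Y : Type w') [AddCommGroup Y]
    [Module A Y] :
    HomRight A M (X × Y) ≃ₗ[(Module.End A M)ᵐᵒᵖ] HomRight A M X × HomRight A M Y where
  toFun f := (LinearMap.fst A X Y ∘ₗ (f : M →ₗ[A] X × Y), LinearMap.snd A X Y ∘ₗ (f : M →ₗ[A] X × Y))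
  invFun f := LinearMap.prod (f.1 : M →ₗ[A] X) (f.2 : M →ₗ[A] Y)
  map_add' _ _ := rfl
  map_smul' _ _ := rfl
  left_inv _ := rfl
  right_inv _ := rfl

/-- The additive map `[X] ↦ [Hom_A(M, X)]` induced by the functor `Hom_A(M, -)`. -/
def homClass : IsoClass.{u, v} A →+ IsoClass.{v, v} (Module.End A M)ᵐᵒᵖ where
  toFun := Quotient.map (fun X => ModuleCat.of (Module.End A M)ᵐᵒᵖ (HomRight A M X))
    (fun _ _ ⟨e⟩ => ⟨HomRight.congr A M e⟩)
  map_zero' := by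
    refine (cls_eq_iff (X := ModuleCat.of (Module.End A M)ᵐᵒᵖ (HomRight A M PUnit.{v + 1}))).2 ?_
    have : Subsingleton (HomRight A M PUnit.{v + 1}) :=
      inferInstanceAs (Subsingleton (M →ₗ[A] PUnit.{v + 1}))
    exact ⟨⟨0, 0, fun _ => Subsingleton.elim _ _, fun _ => rfl⟩⟩
  map_add' x y := by
    obtain ⟨X, rfl⟩ := cls_surj x
    obtain ⟨Y, rfl⟩ := cls_surj y
    exact cls_eq_iff.2 ⟨HomRight.prodEquiv A M X Y⟩

/-- `B(M)`: the classes in `V*(M)` that correspond to the elements of `B(S)`, `S = End_A(M)`,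
under `V*(M) → V*(S)`, `[X] ↦ [Hom_A(M, X)]`. -/
def BModule : Set (IsoClass.{u, v} A) :=
  {x | x ∈ VStar A M ∧ homClass A M x ∈ BRing (Module.End A M)}

end HomFunctor

/-! ### Localization -/

section Loc

variable {R : Type u} [CommRing R]

/-- The multiplicative set `R \ ⋃ ℱ` for a set `ℱ` of maximal ideals. -/
def complUnion (F : Set (MaximalSpectrum R)) : Submonoid R where
  carrier := {r | ∀ m ∈ F, r ∉ m.asIdeal}
  one_mem' m _ := (Ideal.ne_top_iff_one _).1 m.isMaximal.ne_top
  mul_mem' ha hb m hm h := (m.isMaximal.isPrime.mem_or_mem h).elim (ha m hm) (hb m hm)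

/-- Localization of isomorphisms. -/
def locCongr (T : Submonoid R) {X : Type v} [AddCommGroup X] [Module R X] {Y : Type w}
    [AddCommGroup Y] [Module R Y] (e : X ≃ₗ[R] Y) :
    LocalizedModule T X ≃ₗ[Localization T] LocalizedModule T Y :=
  IsLocalizedModule.mapEquiv T (LocalizedModule.mkLinearMap T X) (LocalizedModule.mkLinearMap T Y)
    (Localization T) e

/-- Localization commutes with binary direct sums. -/
def locProd (T : Submonoid R) (X : Type v) [AddCommGroup X] [Module R X] (Y : Type w)
    [AddCommGroup Y] [Module R Y] :
    LocalizedModule T (X × Y) ≃ₗ[Localization T] LocalizedModule T X × LocalizedModule T Y :=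
  LinearEquiv.extendScalarsOfIsLocalization T (Localization T)
    (IsLocalizedModule.iso T
      ((LocalizedModule.mkLinearMap T X).prodMap (LocalizedModule.mkLinearMap T Y)))

/-- The additive map `[X] ↦ [X_T]` induced by localization at the multiplicative set `T`. -/
def locClass (T : Submonoid R) :
    IsoClass.{u, v} R →+ IsoClass.{u, max u v} (Localization T) where
  toFun := Quotient.map (fun X => ModuleCat.of (Localization T) (LocalizedModule T X))
    (fun _ _ ⟨e⟩ => ⟨locCongr T e⟩)
  map_zero' := by
    refine (cls_eq_iff
      (X := ModuleCat.of (Localization T) (LocalizedModule T PUnit.{v + 1}))).2 ?_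
    exact ⟨⟨0, 0, fun _ => Subsingleton.elim _ _, fun _ => rfl⟩⟩
  map_add' x y := by
    obtain ⟨X, rfl⟩ := cls_surj x
    obtain ⟨Y, rfl⟩ := cls_surj y
    exact cls_eq_iff.2 ⟨locProd T X Y⟩

end Loc

end DirectSumDecomp

end

noncomputable section

namespace DirectSumDecomp

open MulOpposite

/-! ### Countably generated projective modules as summands of free modules -/

section Countable

variable {T : Type u} [Ring T]

/-! Since `M` is finitely generated, `Hom_R(M, -)` is full and faithful on `Add(M)` and identifies
it with the projective right modules over `S = End_R(M)`, preserving and reflecting finite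
generation. So the theorem is about countably generated projective right `S`-modules. What is needed
of `S` is collected in `IsOrderLike`: it is noetherian on both sides and has a central element `z`
such that nonzero idempotent ideals contain a power of `z`, while quotients by two-sided ideals
containing a power of `z` are artinian. Here `z` is multiplication by a common denominator `f` for a
dual basis of `M`, and the statement about powers of `z` is a determinant trick
(`AlmostDualBasis.pow_mem`).

Let `P` be a countably generated projective that is not finitely generated, written as a summand of
a free module of countable rank. The two-sided ideals generated by the coordinates of index at least
`n` decrease with `n`, and a multiplicative relation between them (`exists_tailIdeal_le_mul`) makes
them stationary (`IsOrderLike.chain`). The limit `I` is idempotent and nonzero, and `P / PI` is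
finitely generated. By noetherianity `P` contains elements that start arbitrarily late and whose
coordinates still generate a right ideal containing `I`; sending such elements, with disjoint
supports, to generators of a module `Q = QI` shows that `P` is `I`-big
(`exists_surjective_of_le_tailIdeal`).

Conversely, an `I`-big projective absorbs the projectives `X = XI` by a swindle, hence is determined
by `P / PI` (`IsBigLeft.nonempty_equiv`). Every finitely generated projective `S / I`-module occurs
as a reduction: `exists_projective_lift` builds a lift as a direct limit of free modules. Lifting
the zero module gives Whitehead's theorem that idempotent ideals are traces. Thus non-finitely
generated projectives correspond to pairs of a nonzero idempotent `I` and a class in `V(S / I)`,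
which is free by Krull–Schmidt. There are finitely many `I`, because a nonzero one is determined by
its image in a semisimple quotient of `S`. Absorption also rules out indecomposability.

A pair `(I, P / PI)` only involves modules killed by a power of `f`, so it is visible in
localizations covering the maximal ideals that contain `f` (`exists_surjective_of_isFractionMap`).
This gives the local-global statement and the injectivity of localization. Surjectivity follows by
contracting an idempotent ideal of the localized ring to `S` and lifting there
(`exists_localization_equiv`). -/

theorem countablyGenerated_iff_exists_seq {P : Type v} [AddCommGroup P] [Module T P] :
    CountablyGenerated T P ↔ ∃ y : ℕ → P, Submodule.span T (Set.range y) = ⊤ := by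
  constructor
  · rintro ⟨s, hs, hs'⟩
    rcases s.eq_empty_or_nonempty with rfl | hne
    · refine ⟨fun _ => 0, ?_⟩
      rw [Submodule.span_empty] at hs'
      exact le_antisymm le_top (hs'.ge.trans bot_le)
    · obtain ⟨y, rfl⟩ := hs.exists_eq_range hne
      exact ⟨y, hs'⟩
  · rintro ⟨y, hy⟩
    exact ⟨_, Set.countable_range y, hy⟩

theorem countablyGenerated_finsupp {ι : Type w} [Countable ι] {P : Type v} [AddCommGroup P]
    [Module T P] (h : CountablyGenerated T P) : CountablyGenerated T (ι →₀ P) := by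
  obtain ⟨y, hy⟩ := countablyGenerated_iff_exists_seq.1 h
  refine ⟨Set.range fun a : ι × ℕ => Finsupp.single a.1 (y a.2), Set.countable_range _, ?_⟩
  rw [eq_top_iff]
  rintro x -
  induction x using Finsupp.induction_linear with
  | zero => exact zero_mem _
  | add f g hf hg => exact add_mem hf hg
  | single a p =>
    have : p ∈ Submodule.span T (Set.range y) := hy ▸ Submodule.mem_top
    have h2 := Submodule.mem_map_of_mem (f := Finsupp.lsingle (R := T) a) this
    rw [Submodule.map_span] at h2
    refine Submodule.span_mono ?_ h2
    rintro _ ⟨_, ⟨n, rfl⟩, rfl⟩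
    exact ⟨(a, n), rfl⟩

theorem countablyGenerated_self : CountablyGenerated T T :=
  ⟨{1}, Set.countable_singleton _, Ideal.span_singleton_one⟩

theorem CountablyGenerated.of_isSummand {P : Type v} [AddCommGroup P] [Module T P] {Q : Type w}
    [AddCommGroup Q] [Module T Q] (h : IsSummand T P Q) (hQ : CountablyGenerated T Q) :
    CountablyGenerated T P := by
  obtain ⟨i, p, hip⟩ := h
  obtain ⟨s, hs, hs'⟩ := hQ
  refine ⟨p '' s, hs.image p, ?_⟩
  rw [Submodule.span_image, hs', Submodule.map_top, LinearMap.range_eq_top]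
  exact fun x => ⟨i x, LinearMap.congr_fun hip x⟩

theorem IsSummand.trans {P : Type v} [AddCommGroup P] [Module T P] {Q : Type w}
    [AddCommGroup Q] [Module T Q] {N : Type w'} [AddCommGroup N] [Module T N]
    (h : IsSummand T P Q) (h' : IsSummand T Q N) : IsSummand T P N := by
  obtain ⟨i, p, hip⟩ := h
  obtain ⟨j, q, hjq⟩ := h'
  refine ⟨j ∘ₗ i, p ∘ₗ q, LinearMap.ext fun x => ?_⟩
  have h1 := LinearMap.congr_fun hjq (i x)
  have h2 := LinearMap.congr_fun hip x
  simp at h1 h2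
  simp [h1, h2]

theorem isSummand_of_equiv {P : Type v} [AddCommGroup P] [Module T P] {Q : Type w}
    [AddCommGroup Q] [Module T Q] (e : P ≃ₗ[T] Q) : IsSummand T P Q :=
  ⟨e, e.symm, LinearMap.ext fun x => e.symm_apply_apply x⟩

theorem IsSummand.projective {P : Type v} [AddCommGroup P] [Module T P] {Q : Type w}
    [AddCommGroup Q] [Module T Q] (h : IsSummand T P Q) [Module.Projective T Q] :
    Module.Projective T P := by
  obtain ⟨i, p, hip⟩ := h
  exact Module.Projective.of_split i p hip

/-- A countably generated projective module is a summand of a free module of countable rank. -/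
theorem isSummand_nat_of_projective {P : Type v} [AddCommGroup P] [Module T P]
    (hc : CountablyGenerated T P) (hP : Module.Projective T P) : IsSummand T P (ℕ →₀ T) := by
  obtain ⟨y, hy⟩ := countablyGenerated_iff_exists_seq.1 hc
  have hs : Function.Surjective (Finsupp.linearCombination T y) := by
    rw [← LinearMap.range_eq_top, Finsupp.range_linearCombination, hy]
  obtain ⟨i, hi⟩ := Module.projective_lifting_property _ LinearMap.id hs
  exact ⟨i, _, hi⟩

theorem isSummand_nat_iff {P : Type v} [AddCommGroup P] [Module T P] :
    IsSummand T P (ℕ →₀ T) ↔ CountablyGenerated T P ∧ Module.Projective T P :=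
  ⟨fun h => ⟨.of_isSummand h (countablyGenerated_finsupp countablyGenerated_self), h.projective⟩,
    fun h => isSummand_nat_of_projective h.1 h.2⟩

end Countable

/-! ### Tail ideals of a summand of a free module -/

section Tail

variable {T : Type u} [Ring T] {P : Type v} [AddCommGroup P] [Module T P]

/-- The two-sided ideal generated by the coordinates of index `≥ n` of the elements of `P`. -/
def tailIdeal (i : P →ₗ[T] (ℕ →₀ T)) (n : ℕ) : Ideal T :=
  Ideal.span {t | ∃ j ≥ n, ∃ (x : P) (s : T), t = i x j * s}

theorem coord_mem_tailIdeal (i : P →ₗ[T] (ℕ →₀ T)) {n j : ℕ} (h : n ≤ j) (x : P) :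
    i x j ∈ tailIdeal i n :=
  Ideal.subset_span ⟨j, h, x, 1, (mul_one _).symm⟩

instance (i : P →ₗ[T] (ℕ →₀ T)) (n : ℕ) : (tailIdeal i n).IsTwoSided where
  mul_mem_of_left {a} b ha := by
    refine Submodule.span_induction (p := fun x _ => x * b ∈ tailIdeal i n) ?_ ?_ ?_ ?_ ha
    · rintro _ ⟨j, hj, x, s, rfl⟩
      exact Ideal.subset_span ⟨j, hj, x, s * b, by rw [mul_assoc]⟩
    · simp
    · intro x y _ _ hx hy
      rw [add_mul]
      exact add_mem hx hy
    · intro c x _ hx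
      rw [smul_eq_mul, mul_assoc]
      exact Ideal.mul_mem_left _ c hx

theorem tailIdeal_antitone (i : P →ₗ[T] (ℕ →₀ T)) : Antitone (tailIdeal i) := by
  intro m n hmn
  exact Ideal.span_mono fun t ⟨j, hj, h⟩ => ⟨j, hmn.trans hj, h⟩

theorem tailIdeal_le_iff (i : P →ₗ[T] (ℕ →₀ T)) (n : ℕ) (J : Ideal T) [J.IsTwoSided] :
    tailIdeal i n ≤ J ↔ ∀ j ≥ n, ∀ x, i x j ∈ J := by
  refine ⟨fun h j hj x => h (coord_mem_tailIdeal i hj x), fun h => Ideal.span_le.2 ?_⟩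
  rintro _ ⟨j, hj, x, s, rfl⟩
  exact Ideal.mul_mem_right _ _ (h j hj x)

/-- A finitely generated submodule involves only finitely many coordinates. -/
theorem exists_coord_eq_zero (i : P →ₗ[T] (ℕ →₀ T)) {N : Submodule T P} (hN : N.FG) :
    ∃ m, ∀ x ∈ N, ∀ j ≥ m, i x j = 0 := by
  obtain ⟨s, rfl⟩ := hN
  refine ⟨(s.sup fun x => (i x).support.sup id) + 1, fun x hx j hj => ?_⟩
  refine Submodule.span_induction (p := fun x _ => i x j = 0) ?_ ?_ ?_ ?_ hx
  · intro x hx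
    by_contra hne
    have h1 : j ≤ (i x).support.sup id := Finset.le_sup (f := id) (Finsupp.mem_support_iff.2 hne)
    have h2 : (i x).support.sup id ≤ s.sup fun x => (i x).support.sup id :=
      Finset.le_sup (f := fun x => (i x).support.sup id) hx
    omega
  · simp
  · intro x y _ _ hx hy
    simp [hx, hy]
  · intro c x _ hx
    simp [hx]

/-- Expanding `x = p (i x)` in the images of the basis vectors writes the `j`-th coordinate of `x`
as a sum of products of its `l`-th coordinate with the `j`-th coordinate of `p e_l`. For large `j`
the terms with `l < n` vanish, and each remaining product lies in the product of ideals. -/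
theorem exists_tailIdeal_le_mul {i : P →ₗ[T] (ℕ →₀ T)} {p : (ℕ →₀ T) →ₗ[T] P}
    (hip : p ∘ₗ i = LinearMap.id) (n : ℕ) :
    ∃ m, ∀ m' ≥ m, tailIdeal i m' ≤ tailIdeal i n * tailIdeal i m' := by
  obtain ⟨m, hm⟩ := exists_coord_eq_zero i
    (Submodule.fg_span (Set.finite_range fun l : Fin n => p (Finsupp.single l.1 1)))
  refine ⟨m, fun m' hm' => (tailIdeal_le_iff i m' _).2 fun j hj x => ?_⟩
  have hx : i x j = (i x).sum fun l a => a * i (p (Finsupp.single l 1)) j := by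
    have h1 : p (i x) = x := LinearMap.congr_fun hip x
    have h2 : i x = (i x).sum fun l a => a • i (p (Finsupp.single l 1)) := by
      conv_lhs => rw [← h1, ← Finsupp.sum_single (i x)]
      rw [map_finsuppSum, map_finsuppSum]
      refine Finsupp.sum_congr fun l _ => ?_
      rw [← map_smul, ← map_smul, Finsupp.smul_single_one]
    conv_lhs => rw [h2]
    rw [Finsupp.sum, Finset.sum_apply' j]
    rfl
  rw [hx]
  refine Submodule.sum_mem _ fun l _ => ?_
  dsimp only
  rcases lt_or_ge l n with hl | hl
  · rw [hm _ (Submodule.subset_span ⟨⟨l, hl⟩, rfl⟩) j (hm'.trans hj), mul_zero]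
    exact zero_mem _
  · exact Ideal.mul_mem_mul (coord_mem_tailIdeal i hl x) (coord_mem_tailIdeal i hj _)

/-- The right ideal generated by the coordinates of an element. -/
def content (x : ℕ →₀ T) : Submodule Tᵐᵒᵖ T := Submodule.span Tᵐᵒᵖ (Set.range x)

/-- The projection of `P` to the first `n` coordinates has finitely generated image because `T` is
noetherian; `N` is spanned by preimages of generators. -/
theorem exists_fg_sup_ker [IsNoetherianRing T] (i : P →ₗ[T] (ℕ →₀ T)) (n : ℕ) :
    ∃ N : Submodule T P, N.FG ∧ ∀ x, ∃ g ∈ N, ∀ j < n, i (x - g) j = 0 := by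
  let ρ : P →ₗ[T] (Fin n → T) := LinearMap.pi fun k => Finsupp.lapply k.1 ∘ₗ i
  obtain ⟨s, hs⟩ := IsNoetherian.noetherian (LinearMap.range ρ)
  have hs' : ∀ y : s, ∃ x, ρ x = y.1 := fun y => by
    have : y.1 ∈ LinearMap.range ρ := hs ▸ Submodule.subset_span y.2
    exact this
  choose g hg using hs'
  refine ⟨Submodule.span T (Set.range g), Submodule.fg_span (Set.finite_range g), fun x => ?_⟩
  have hx : ρ x ∈ Submodule.map ρ (Submodule.span T (Set.range g)) := by
    rw [Submodule.map_span, ← Set.range_comp]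
    have : Set.range (ρ ∘ g) = s := by
      ext y
      constructor
      · rintro ⟨z, rfl⟩
        simp [hg]
      · exact fun hy => ⟨⟨y, hy⟩, hg _⟩
    rw [this, hs]
    exact ⟨x, rfl⟩
  obtain ⟨y, hy, hyx⟩ := hx
  refine ⟨y, hy, fun j hj => ?_⟩
  have := congr_fun hyx ⟨j, hj⟩
  simp only [ρ, LinearMap.pi_apply, LinearMap.comp_apply, Finsupp.lapply_apply] at this
  simp [this]

/-- Among the elements starting at index `n`, take `x` with maximal content. An element `x'`
starting beyond the support of `x` has content inside that of `x`, because `x + x'` has both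
contents. All sufficiently late coordinates of elements of `P` arise from such `x'`. -/
theorem exists_content_eq [IsNoetherianRing T] [IsNoetherian Tᵐᵒᵖ T] (i : P →ₗ[T] (ℕ →₀ T))
    {J : Ideal T} (hJ : ∀ n, J ≤ tailIdeal i n) (n : ℕ) :
    ∃ x : P, (∀ j < n, i x j = 0) ∧ ∀ a ∈ J, a ∈ content (i x) := by
  obtain ⟨_, ⟨x, hx, rfl⟩, hmax⟩ := WellFounded.has_min
    (wellFounded_gt (α := Submodule Tᵐᵒᵖ T))
    ((fun x : P => content (i x)) '' {x | ∀ j < n, i x j = 0}) ⟨_, 0, by simp, rfl⟩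
  refine ⟨x, hx, ?_⟩
  obtain ⟨b, hb⟩ := exists_coord_eq_zero i (Submodule.fg_span (Set.finite_singleton x))
  replace hb : ∀ j ≥ b, i x j = 0 := hb x (Submodule.mem_span_singleton_self x)
  have key : ∀ x' : P, (∀ j < max n b, i x' j = 0) → content (i x') ≤ content (i x) := by
    intro x' hx'
    have hle : content (i x) ⊔ content (i x') ≤ content (i (x + x')) := by
      refine sup_le (Submodule.span_le.2 ?_) (Submodule.span_le.2 ?_)
      · rintro _ ⟨j, rfl⟩
        rcases lt_or_ge j b with hj | hj
        · refine Submodule.subset_span ⟨j, ?_⟩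
          simp [hx' j (lt_max_of_lt_right hj)]
        · rw [hb j hj]
          exact zero_mem _
      · rintro _ ⟨j, rfl⟩
        rcases lt_or_ge j (max n b) with hj | hj
        · rw [hx' j hj]
          exact zero_mem _
        · refine Submodule.subset_span ⟨j, ?_⟩
          simp [hb j ((le_max_right _ _).trans hj)]
    have hnot := hmax (content (i (x + x'))) ⟨x + x', fun j hj => by
      simp [hx j hj, hx' j (lt_max_of_lt_left hj)], rfl⟩
    have h1 := le_sup_left.trans hle
    have h2 : content (i (x + x')) = content (i x) := by
      by_contra hne
      exact hnot (lt_of_le_of_ne h1 (Ne.symm hne))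
    exact h2 ▸ le_sup_right.trans hle
  obtain ⟨N, hN, hN'⟩ := exists_fg_sup_ker i (max n b)
  -- From index `m` on, `t • y` and its correction `t • y - g` have the same coordinates, and the
  -- latter starts after the support of `x`. Carrying the left factor `t` along is needed because
  -- the content is only a right ideal.
  obtain ⟨m, hm⟩ := exists_coord_eq_zero i hN
  intro a ha
  replace ha := hJ m ha
  suffices h : ∀ t : T, t * a ∈ content (i x) by simpa using h 1
  refine Submodule.span_induction (p := fun a _ => ∀ t : T, t * a ∈ content (i x)) ?_ ?_ ?_ ?_ ha
  · rintro _ ⟨j, hj, y, s, rfl⟩ t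
    obtain ⟨g, hg, hyg⟩ := hN' (t • y)
    have h1 : t * (i y j * s) = op s • i (t • y - g) j := by
      simp [hm g hg j hj, mul_assoc]
    rw [h1]
    exact Submodule.smul_mem _ _ (key _ hyg (Submodule.subset_span ⟨j, rfl⟩))
  · simp
  · intro a b _ _ ha hb t
    rw [mul_add]
    exact add_mem (ha t) (hb t)
  · intro c a _ ha t
    rw [smul_eq_mul, ← mul_assoc]
    exact ha _

/-- An element `a = ∑ x_j s_j` of the content acts by `a • q = ∑ x_j • (s_j • q)`. -/
theorem exists_sum_of_mem_smul_top {x : ℕ →₀ T} {J : Ideal T} (hx : ∀ a ∈ J, a ∈ content x)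
    {Q : Type w} [AddCommGroup Q] [Module T Q] {y : Q} (hy : y ∈ J • (⊤ : Submodule T Q)) :
    ∃ c : ℕ → Q, y = x.sum fun j a => a • c j := by
  induction hy using Submodule.smul_induction_on' with
  | smul a ha q _ =>
    have := hx a ha
    suffices h : ∀ q : Q, ∃ c : ℕ → Q, a • q = x.sum fun j a => a • c j from h q
    refine Submodule.span_induction
      (p := fun a _ => ∀ q : Q, ∃ c : ℕ → Q, a • q = x.sum fun j a => a • c j) ?_ ?_ ?_ ?_ this
    · rintro _ ⟨j, rfl⟩ q
      refine ⟨Pi.single j q, ?_⟩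
      rw [Finsupp.sum, Finset.sum_eq_single j]
      · simp
      · intro k _ hk
        simp [hk]
      · intro hj
        simp [Finsupp.notMem_support_iff.1 hj]
    · intro q
      exact ⟨0, by simp⟩
    · intro a b _ _ ha hb q
      obtain ⟨c, hc⟩ := ha q
      obtain ⟨d, hd⟩ := hb q
      exact ⟨c + d, by simp [add_smul, hc, hd, Finsupp.sum_add]⟩
    · intro s a _ ha q
      obtain ⟨c, hc⟩ := ha (unop s • q)
      refine ⟨c, ?_⟩
      rw [← hc, ← mul_smul]
      rfl
  | add y _ z _ hy hz =>
    obtain ⟨c, hc⟩ := hy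
    obtain ⟨d, hd⟩ := hz
    exact ⟨c + d, by simp [hc, hd, Finsupp.sum_add]⟩

/-- If all the tail ideals of `P` contain `J`, then every countably generated module `Q` with
`J Q = Q` is an image of `P`. -/
theorem exists_surjective_of_le_tailIdeal [IsNoetherianRing T] [IsNoetherian Tᵐᵒᵖ T]
    (i : P →ₗ[T] (ℕ →₀ T)) {J : Ideal T} (hJ : ∀ n, J ≤ tailIdeal i n)
    {Q : Type w} [AddCommGroup Q] [Module T Q] (hQ : CountablyGenerated T Q)
    (hJQ : J • (⊤ : Submodule T Q) = ⊤) : ∃ f : P →ₗ[T] Q, Function.Surjective f := by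
  obtain ⟨y, hy⟩ := countablyGenerated_iff_exists_seq.1 hQ
  choose x hx hxJ using exists_content_eq i hJ
  have hb : ∀ n, ∃ b > n, ∀ j ≥ b, i (x n) j = 0 := fun n => by
    obtain ⟨b, hb⟩ := exists_coord_eq_zero i (Submodule.fg_span (Set.finite_singleton (x n)))
    exact ⟨max b (n + 1), by simp,
      fun j hj => hb _ (Submodule.mem_span_singleton_self _) j ((le_max_left _ _).trans hj)⟩
  choose b hbn hb using hb
  -- The element `x (N k)` is supported in `[N k, N (k + 1))`. These blocks are disjoint, so the
  -- images `q j` of the basis vectors can be chosen block by block to send `x (N k)` to `y k`.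
  let N : ℕ → ℕ := fun k => Nat.rec (motive := fun _ => ℕ) 0 (fun _ n => b n) k
  have hN : StrictMono N := strictMono_nat_of_lt_succ fun k => hbn (N k)
  have hc : ∀ k, ∃ c : ℕ → Q, y k = (i (x (N k))).sum fun j a => a • c j := fun k =>
    exists_sum_of_mem_smul_top (hxJ (N k)) (by rw [hJQ]; exact Submodule.mem_top)
  choose c hc using hc
  let q : ℕ → Q := fun j => ∑ k ∈ Finset.range (j + 1), (if N k ≤ j ∧ j < N (k + 1) then c k j else 0 : Q)
  have hq : ∀ k j, N k ≤ j → j < N (k + 1) → q j = c k j := by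
    intro k j h1 h2
    have hk : k ∈ Finset.range (j + 1) := by
      have := hN.le_apply (x := k)
      simp
      omega
    refine (Finset.sum_eq_single_of_mem k hk fun l _ hl => if_neg ?_).trans (if_pos ⟨h1, h2⟩)
    rintro ⟨h3, h4⟩
    rcases lt_or_gt_of_ne hl with h | h
    · have := hN.monotone (show l + 1 ≤ k from h)
      omega
    · have := hN.monotone (show k + 1 ≤ l from h)
      omega
  refine ⟨Finsupp.linearCombination T q ∘ₗ i, ?_⟩
  rw [← LinearMap.range_eq_top, eq_top_iff, ← hy, Submodule.span_le]
  rintro _ ⟨k, rfl⟩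
  refine ⟨x (N k), ?_⟩
  rw [LinearMap.comp_apply, Finsupp.linearCombination_apply, hc k]
  refine Finsupp.sum_congr fun j hj => ?_
  rw [Finsupp.mem_support_iff] at hj
  rw [hq k j]
  · by_contra h
    exact hj (hx _ _ (not_le.1 h))
  · by_contra h
    exact hj (hb _ _ (not_lt.1 h))

end Tail

/-! ### Relatively big projective modules: absorption and uniqueness -/

section Big

variable {T : Type u} [Ring T]

theorem map_mem_smul_top {J : Ideal T} {P : Type v} [AddCommGroup P] [Module T P] {Q : Type w}
    [AddCommGroup Q] [Module T Q] (f : P →ₗ[T] Q) {x : P} (hx : x ∈ J • (⊤ : Submodule T P)) :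
    f x ∈ J • (⊤ : Submodule T Q) := by
  have h := Submodule.mem_map_of_mem (f := f) hx
  rw [Submodule.map_smul''] at h
  exact Submodule.smul_mono le_rfl le_top h

theorem finsupp_smul_top_eq_top {J : Ideal T} {ι : Type w'} {P : Type v} [AddCommGroup P]
    [Module T P] (h : J • (⊤ : Submodule T P) = ⊤) : J • (⊤ : Submodule T (ι →₀ P)) = ⊤ := by
  rw [eq_top_iff]
  rintro y -
  induction y using Finsupp.induction_linear with
  | zero => exact zero_mem _
  | add f g hf hg => exact add_mem hf hg
  | single a p =>
    exact map_mem_smul_top (Finsupp.lsingle (R := T) a) (by rw [h]; exact Submodule.mem_top)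

theorem projective_finsupp (ι : Type w') {P : Type v} [AddCommGroup P] [Module T P]
    (h : Module.Projective T P) : Module.Projective T (ι →₀ P) := by
  classical
  exact Module.Projective.of_equiv (finsuppLequivDFinsupp (ι := ι) (M := P) T).symm

/-- A split surjection gives a direct sum decomposition. -/
def kerProdEquiv {P : Type v} [AddCommGroup P] [Module T P] {Q : Type w}
    [AddCommGroup Q] [Module T Q] (f : P →ₗ[T] Q) (s : Q →ₗ[T] P) (h : f ∘ₗ s = LinearMap.id) :
    P ≃ₗ[T] LinearMap.ker f × Q :=
  have h' : ∀ q, f (s q) = q := LinearMap.congr_fun h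
  { toFun := fun x => (⟨x - s (f x), by simp [h']⟩, f x)
    invFun := fun y => y.1 + s y.2
    map_add' := fun x y => by ext <;> simp; abel
    map_smul' := fun c x => by ext <;> simp [smul_sub]
    left_inv := fun x => by simp
    right_inv := fun y => by
      have := y.1.2
      rw [LinearMap.mem_ker] at this
      ext <;> simp [h', this] }

/-- `X ⊕ X^(ℕ) ≅ X^(ℕ)`. -/
def prodFinsuppNatEquiv (X : Type v) [AddCommGroup X] [Module T X] :
    (X × (ℕ →₀ X)) ≃ₗ[T] (ℕ →₀ X) :=
  ((Finsupp.uniqueLinearEquiv T X ()).symm.prodCongr (LinearEquiv.refl T _)).trans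
    ((Finsupp.sumFinsuppLEquivProdFinsupp T).symm.trans
      (Finsupp.domLCongr ((Equiv.sumComm _ _).trans Equiv.natSumPUnitEquivNat)))

/-- The sum of the images of all homomorphisms `W → Q`. -/
def traceIn (T : Type u) [Ring T] (W : Type v) [AddCommGroup W] [Module T W] (Q : Type w)
    [AddCommGroup Q] [Module T Q] : Submodule T Q :=
  ⨆ φ : W →ₗ[T] Q, LinearMap.range φ

theorem apply_mem_traceIn {W : Type v} [AddCommGroup W] [Module T W] {Q : Type w}
    [AddCommGroup Q] [Module T Q] (φ : W →ₗ[T] Q) (x : W) : φ x ∈ traceIn T W Q :=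
  Submodule.mem_iSup_of_mem φ ⟨x, rfl⟩

theorem map_mem_traceIn {W : Type v} [AddCommGroup W] [Module T W] {Q : Type w}
    [AddCommGroup Q] [Module T Q] {Q' : Type w'} [AddCommGroup Q'] [Module T Q'] (f : Q →ₗ[T] Q')
    {x : Q} (hx : x ∈ traceIn T W Q) : f x ∈ traceIn T W Q' := by
  refine Submodule.iSup_induction (motive := fun x => f x ∈ traceIn T W Q') _ hx ?_ ?_ ?_
  · rintro φ _ ⟨y, rfl⟩
    exact apply_mem_traceIn (f ∘ₗ φ) y
  · simp
  · intro x y hx hy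
    rw [map_add]
    exact add_mem hx hy

theorem smul_top_le_traceIn {J : Ideal T} {W : Type v} [AddCommGroup W] [Module T W] {Q : Type w}
    [AddCommGroup Q] [Module T Q] (hJ : J ≤ traceIn T W T) :
    J • (⊤ : Submodule T Q) ≤ traceIn T W Q :=
  Submodule.smul_le.2 fun _ ha q _ => map_mem_traceIn (LinearMap.toSpanSingleton T Q q) (hJ ha)

/-- Each `y n` involves finitely many homomorphisms, so countably many suffice for all of them;
adding `0` makes the set nonempty, so that it can be enumerated. -/
theorem exists_finsupp_map_of_mem_traceIn {W : Type v} [AddCommGroup W] [Module T W] {Q : Type w}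
    [AddCommGroup Q] [Module T Q] (y : ℕ → Q) (hy : ∀ n, y n ∈ traceIn T W Q) :
    ∃ g : (ℕ →₀ W) →ₗ[T] Q, ∀ n, y n ∈ LinearMap.range g := by
  have h : ∀ n, ∃ s : Finset (W →ₗ[T] Q), y n ∈ ⨆ φ ∈ s, LinearMap.range φ := fun n =>
    Submodule.mem_iSup_iff_exists_finset.1 (hy n)
  choose s hs using h
  have hC : ((⋃ n, (s n : Set (W →ₗ[T] Q))) ∪ {0}).Countable :=
    (Set.countable_iUnion fun n => (s n).countable_toSet).union (Set.countable_singleton _)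
  obtain ⟨φ, hφ⟩ := hC.exists_eq_range ⟨0, Or.inr rfl⟩
  refine ⟨Finsupp.lsum ℕ φ, fun n => ?_⟩
  refine (iSup₂_le fun ψ hψ => ?_ : ⨆ φ ∈ s n, LinearMap.range φ ≤ _) (hs n)
  have : ψ ∈ Set.range φ := hφ ▸ Or.inl (Set.mem_iUnion.2 ⟨n, hψ⟩)
  obtain ⟨k, rfl⟩ := this
  rintro _ ⟨x, rfl⟩
  exact ⟨Finsupp.single k x, by simp⟩

end Big

section Unique

variable {T : Type v} [Ring T]

/-- Relative bigness with respect to an ideal of the ring `T` acting on the left. -/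
def IsBigLeft (J : Ideal T) (P : Type v) [AddCommGroup P] [Module T P] : Prop :=
  ∀ Q : ModuleCat.{v} T, CountablyGenerated T Q → Module.Projective T Q →
    J • (⊤ : Submodule T Q) = ⊤ → ∃ f : P →ₗ[T] Q, Function.Surjective f

variable {J : Ideal T} {P Q W : Type v} [AddCommGroup P] [Module T P] [AddCommGroup Q] [Module T Q]
  [AddCommGroup W] [Module T W]

/-- A `J`-big module absorbs the projective modules `X` with `J X = X`. -/
theorem IsBigLeft.absorb (hP : IsBigLeft J P) {X : Type v} [AddCommGroup X] [Module T X]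
    (hX : CountablyGenerated T X) (hX' : Module.Projective T X)
    (hJX : J • (⊤ : Submodule T X) = ⊤) : Nonempty (P ≃ₗ[T] P × X) := by
  -- Mapping onto `X^(ℕ)` instead of `X` splits off `X^(ℕ)`, which swallows one more copy of `X`.
  obtain ⟨f, hf⟩ := hP (ModuleCat.of T (ℕ →₀ X)) (countablyGenerated_finsupp hX)
    (projective_finsupp ℕ hX') (finsupp_smul_top_eq_top hJX)
  change P →ₗ[T] (ℕ →₀ X) at f
  have := projective_finsupp ℕ hX'
  obtain ⟨s, hs⟩ := Module.projective_lifting_property f LinearMap.id hf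
  let e := kerProdEquiv f s hs
  exact ⟨e.trans (((LinearEquiv.refl T _).prodCongr
    ((prodFinsuppNatEquiv X).symm.trans (LinearEquiv.prodComm T _ _))).trans
    ((LinearEquiv.prodAssoc T _ _ _).symm.trans (e.symm.prodCongr (LinearEquiv.refl T _))))⟩

/-- A `J`-big projective module is determined by its reduction modulo `J`. -/
theorem IsBigLeft.nonempty_equiv (hP : IsBigLeft J P) (hQ : IsBigLeft J Q)
    (hPc : CountablyGenerated T P) (hPp : Module.Projective T P)
    (hQc : CountablyGenerated T Q) (hQp : Module.Projective T Q)
    (hWc : CountablyGenerated T W) (hWp : Module.Projective T W)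
    (hJW : J • (⊤ : Submodule T W) = ⊤) (hW : J ≤ traceIn T W T)
    (f : P →ₗ[T] Q) (hf : ∀ q, ∃ p, q - f p ∈ J • (⊤ : Submodule T Q))
    (hf' : ∀ p, f p ∈ J • (⊤ : Submodule T Q) → p ∈ J • (⊤ : Submodule T P)) :
    Nonempty (P ≃ₗ[T] Q) := by
  obtain ⟨y, hy⟩ := countablyGenerated_iff_exists_seq.1 hQc
  choose x hx using fun n => hf (y n)
  obtain ⟨g, hg⟩ := exists_finsupp_map_of_mem_traceIn (W := W) (fun n => y n - f (x n))
    (fun n => smul_top_le_traceIn hW (hx n))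
  have hJg : ∀ w, g w ∈ J • (⊤ : Submodule T Q) := fun w =>
    map_mem_smul_top g (by rw [finsupp_smul_top_eq_top hJW]; exact Submodule.mem_top)
  -- The copies of `W` repair the failure of surjectivity of `f`. The split surjection `h` has a
  -- kernel `Z` with `J Z = Z`, since `f` reflects membership in the submodules `J P` and `J Q`.
  -- Absorbing `W^(ℕ)` on one side and `Z` on the other gives `P ≅ P ⊕ W^(ℕ) ≅ Z ⊕ Q ≅ Q`.
  let h : (P × (ℕ →₀ W)) →ₗ[T] Q := f.coprod g
  have hh : Function.Surjective h := by
    rw [← LinearMap.range_eq_top, eq_top_iff, ← hy, Submodule.span_le]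
    rintro _ ⟨n, rfl⟩
    obtain ⟨w, hw⟩ := hg n
    exact ⟨(x n, w), by simp [h, hw]⟩
  obtain ⟨s, hs⟩ := Module.projective_lifting_property h LinearMap.id hh
  let e := kerProdEquiv h s hs
  have hWp' := projective_finsupp ℕ hWp
  have hWc' : CountablyGenerated T (ℕ →₀ W) := countablyGenerated_finsupp hWc
  have hZ : IsSummand T (LinearMap.ker h) (P × (ℕ →₀ W)) :=
    ⟨e.symm.toLinearMap ∘ₗ LinearMap.inl T _ _, LinearMap.fst T _ _ ∘ₗ e.toLinearMap,
      LinearMap.ext fun z => by simp⟩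
  have hJZ : J • (⊤ : Submodule T (LinearMap.ker h)) = ⊤ := by
    rw [eq_top_iff]
    rintro ⟨⟨p, w⟩, hz⟩ -
    have h1 : f p = - g w := by
      rw [LinearMap.mem_ker] at hz
      exact eq_neg_of_add_eq_zero_left hz
    have h2 : p ∈ J • (⊤ : Submodule T P) := hf' p (h1 ▸ neg_mem (hJg w))
    have h3 : (p, w) ∈ J • (⊤ : Submodule T (P × (ℕ →₀ W))) := by
      have : (p, w) = LinearMap.inl T P (ℕ →₀ W) p + LinearMap.inr T P (ℕ →₀ W) w := by simp
      rw [this]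
      exact add_mem (map_mem_smul_top _ h2)
        (map_mem_smul_top _ (by rw [finsupp_smul_top_eq_top hJW]; exact Submodule.mem_top))
    have h4 := map_mem_smul_top (LinearMap.fst T _ _ ∘ₗ e.toLinearMap) h3
    have h5 : (LinearMap.fst T _ _ ∘ₗ e.toLinearMap) (p, w) = ⟨(p, w), hz⟩ := by
      ext1
      have : h (p, w) = 0 := hz
      simp [e, kerProdEquiv, this]
    rwa [h5] at h4
  obtain ⟨e₁⟩ := hP.absorb hWc' hWp' (finsupp_smul_top_eq_top hJW)
  have hZp : Module.Projective T (LinearMap.ker h) := hZ.projective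
  obtain ⟨e₂⟩ := hQ.absorb (.of_isSummand hZ (hPc.prod hWc')) hZp hJZ
  exact ⟨e₁.trans (e.trans ((LinearEquiv.prodComm T _ _).trans e₂.symm))⟩

/-- A `J`-big module which is finitely generated modulo `J'` forces `J ≤ J'`. -/
theorem IsBigLeft.le_of_fg (hP : IsBigLeft J P) (hWc : CountablyGenerated T W)
    (hWp : Module.Projective T W)
    (hJW : J • (⊤ : Submodule T W) = ⊤) (hW : J ≤ traceIn T W T) {J' : Ideal T} [J'.IsTwoSided]
    {N : Submodule T P} (hN : N.FG) (hNP : N ⊔ J' • ⊤ = ⊤) : J ≤ J' := by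
  obtain ⟨f, hf⟩ := hP (ModuleCat.of T (ℕ →₀ W)) (countablyGenerated_finsupp hWc)
    (projective_finsupp ℕ hWp) (finsupp_smul_top_eq_top hJW)
  change P →ₗ[T] (ℕ →₀ W) at f
  change Function.Surjective f at hf
  obtain ⟨s, rfl⟩ := hN
  -- The `m`-th coordinate of `f` vanishes on `N`, so it already maps `J' P` onto `W`. Hence `W = J'
  -- W`, and the trace of `W` in `T` lies in `J'`.
  let m := (s.sup fun x => (f x).support.sup id) + 1
  have hm : ∀ x ∈ Submodule.span T (s : Set P), f x m = 0 := by
    intro x hx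
    refine Submodule.span_induction (p := fun x _ => f x m = 0) ?_ ?_ ?_ ?_ hx
    · intro x hx
      by_contra hne
      have h1 : m ≤ (f x).support.sup id := Finset.le_sup (f := id) (Finsupp.mem_support_iff.2 hne)
      have h2 : (f x).support.sup id ≤ s.sup fun x => (f x).support.sup id :=
        Finset.le_sup (f := fun x => (f x).support.sup id) hx
      omega
    · simp
    · intro x y _ _ hx hy
      simp [hx, hy]
    · intro c x _ hx
      simp [hx]
  have hJ'W : ∀ x : W, x ∈ J' • (⊤ : Submodule T W) := by
    intro x
    obtain ⟨p, hp⟩ := hf (Finsupp.single m x)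
    obtain ⟨y, hy, z, hz, rfl⟩ := Submodule.mem_sup.1 (hNP ▸ Submodule.mem_top : p ∈ _)
    have h1 : f z m = x := by
      have := congr_arg (fun g : ℕ →₀ W => g m) hp
      simpa [hm y hy] using this
    rw [← h1]
    exact map_mem_smul_top (Finsupp.lapply m ∘ₗ f) hz
  refine hW.trans (iSup_le fun φ => ?_)
  rintro _ ⟨x, rfl⟩
  have := map_mem_smul_top φ (hJ'W x)
  refine (Submodule.smul_le.2 fun a ha b _ => ?_ : J' • (⊤ : Submodule T T) ≤ J') this
  exact Ideal.mul_mem_right _ _ ha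

end Unique

/-! ### Lifting projective modules modulo an idempotent ideal by direct limits -/

section Telescope

variable {T : Type u} [Ring T] {F : Type v} [AddCommGroup F] [Module T F]

/-- The maps `F → F^(ℕ)` used to split the canonical map from `F^(ℕ)` onto the direct limit of
`F → F → ⋯` with transition map `A`, where `D A A = A`. -/
def splitAux (A D : F →ₗ[T] F) : ℕ → (F →ₗ[T] (ℕ →₀ F))
  | 0 => Finsupp.lsingle 1
  | k + 1 => Finsupp.lsingle (k + 2) + splitAux A D k ∘ₗ D - Finsupp.lsingle (k + 2) ∘ₗ A ∘ₗ D

variable {A D : F →ₗ[T] F} (h : ∀ x, D (A (A x)) = A x)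

-- The two terms at position `k + 2` cancel because `D A A = A`. This says that the maps `splitAux A
-- D k ∘ A` are compatible with the transition map `A`, so they induce a map from the direct limit
-- to `F^(ℕ)`.
include h in
theorem splitAux_succ_apply (k : ℕ) (x : F) :
    splitAux A D (k + 1) (A (A x)) = splitAux A D k (A x) := by
  simp [splitAux, h]

/-- The idempotent endomorphism of `F^(ℕ)` whose image is the direct limit of `F → F → ⋯`. -/
def limitProj (A D : F →ₗ[T] F) : (ℕ →₀ F) →ₗ[T] (ℕ →₀ F) :=
  Finsupp.lsum ℕ fun k => splitAux A D k ∘ₗ A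

theorem limitProj_single (A D : F →ₗ[T] F) (k : ℕ) (x : F) :
    limitProj A D (Finsupp.single k x) = splitAux A D k (A x) := by
  simp [limitProj]

include h in
theorem limitProj_splitAux (k : ℕ) (x : F) :
    limitProj A D (splitAux A D k x) = splitAux A D (k + 1) (A x) := by
  induction k generalizing x with
  | zero => simp [splitAux, limitProj_single]
  | succ k ih =>
    rw [splitAux]
    simp only [LinearMap.sub_apply, LinearMap.add_apply, LinearMap.comp_apply, map_add, map_sub, ih,
      Finsupp.lsingle_apply, limitProj_single]
    rw [splitAux_succ_apply h (k + 1) (D x)]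
    abel

include h in
theorem limitProj_idem (y : ℕ →₀ F) : limitProj A D (limitProj A D y) = limitProj A D y := by
  induction y using Finsupp.induction_linear with
  | zero => simp
  | add f g hf hg => simp [hf, hg]
  | single k x => rw [limitProj_single, limitProj_splitAux h, splitAux_succ_apply h]

include h in
/-- The direct limit of `F → F → ⋯` with transition map `A` is a direct summand of `F^(ℕ)` if `A`
can be recovered from `A A`. -/
theorem exists_limit_summand :
    ∃ (P : Submodule T (ℕ →₀ F)) (s : ℕ → F →ₗ[T] P), IsSummand T P (ℕ →₀ F) ∧
      (∀ k x, s (k + 1) (A x) = s k x) ∧ (∀ y, ∃ k x, s k x = y) ∧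
      (∀ x, (s 0 x : ℕ →₀ F) = Finsupp.single 1 (A x)) ∧
      ∀ (N : Type w) [AddCommGroup N] [Module T N] (θ : F →ₗ[T] N), (∀ x, θ (A x) = θ x) →
        ∃ Θ : P →ₗ[T] N, ∀ k x, Θ (s k x) = θ x := by
  let E := (limitProj A D).rangeRestrict
  have hE : ∀ y : LinearMap.range (limitProj A D), E y = y := by
    rintro ⟨_, y, rfl⟩
    exact Subtype.ext (limitProj_idem h y)
  have hs : ∀ k x, E (Finsupp.single (k + 1) (A x)) = E (Finsupp.single k x) := fun k x => by
    ext1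
    change limitProj A D _ = limitProj A D _
    rw [limitProj_single, limitProj_single, splitAux_succ_apply h]
  refine ⟨LinearMap.range (limitProj A D), fun k => E ∘ₗ Finsupp.lsingle k,
    ⟨Submodule.subtype _, E, LinearMap.ext hE⟩, hs, ?_, ?_, ?_⟩
  · rintro ⟨_, y, rfl⟩
    change ∃ k x, E (Finsupp.single k x) = E y
    induction y using Finsupp.induction_linear with
    | zero => exact ⟨0, 0, by simp⟩
    | add f g hf hg =>
      obtain ⟨k, x, hx⟩ := hf
      obtain ⟨l, y, hy⟩ := hg
      -- Two elements coming from stages `k` and `l` are both pushed to stage `k + l`, where they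
      -- can be added.
      have shift : ∀ (m k : ℕ) (x : F), E (Finsupp.single (k + m) ((A ^ m) x)) =
          E (Finsupp.single k x) := by
        intro m
        induction m with
        | zero => simp
        | succ m ih =>
          intro k x
          rw [← add_assoc, pow_succ', Module.End.mul_apply, hs, ih]
      refine ⟨k + l, (A ^ l) x + (A ^ k) y, ?_⟩
      rw [Finsupp.single_add, map_add, map_add, shift, add_comm k l, shift, hx, hy]
    | single k x => exact ⟨k, x, rfl⟩
  · intro x
    change limitProj A D (Finsupp.single 0 x) = _
    rw [limitProj_single]
    rfl
  · intro N _ _ θ hθ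
    let Θ : (ℕ →₀ F) →ₗ[T] N := Finsupp.lsum ℕ fun _ => θ
    refine ⟨Θ ∘ₗ Submodule.subtype _, fun k x => ?_⟩
    change Θ (limitProj A D (Finsupp.single k x)) = θ x
    rw [limitProj_single, ← hθ x]
    generalize A x = y
    induction k generalizing y with
    | zero => simp [Θ, splitAux]
    | succ k ih =>
      rw [splitAux]
      simp only [LinearMap.sub_apply, LinearMap.add_apply, LinearMap.comp_apply, map_add, map_sub,
        ih]
      simp [Θ, hθ]

end Telescope

section Lift

variable {T : Type u} [Ring T]

variable {r n : ℕ}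

/-- `e_{(w, i)} ↦ ∑_j a_j e_{(j w, i)}`. -/
def wordShift (a : Fin r → T) (n : ℕ) :
    (List (Fin r) × Fin n →₀ T) →ₗ[T] (List (Fin r) × Fin n →₀ T) :=
  Finsupp.linearCombination T fun b => ∑ j, a j • Finsupp.single (j :: b.1, b.2) 1

/-- The `k`-th coordinate of `x e`, where `x` is restricted to the empty word. -/
def matrixCoord (r : ℕ) (e : Fin n → Fin n → T) (k : Fin n) :
    (List (Fin r) × Fin n →₀ T) →ₗ[T] T :=
  Finsupp.linearCombination T fun b => if b.1 = [] then e b.2 k else 0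

/-- The transition map of the direct system lifting the matrix `e`. -/
def liftTransition (a : Fin r → T) (e : Fin n → Fin n → T) :
    (List (Fin r) × Fin n →₀ T) →ₗ[T] (List (Fin r) × Fin n →₀ T) :=
  wordShift a n + ∑ k, (matrixCoord r e k).smulRight (Finsupp.single ([], k) 1)

/-- The values of `liftRecover`. -/
def liftRecoverFun (c : Fin r → Fin r → Fin r → T) (d : Fin n → Fin n → Fin r → Fin r → T) :
    List (Fin r) × Fin n → (List (Fin r) × Fin n →₀ T)
  | ([], k) => Finsupp.single ([], k) 1
  | ([_], _) => 0
  | (l :: j :: w, i) => ∑ m, c m j l • Finsupp.single (m :: w, i) 1 +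
      if w = [] then ∑ k, d i k j l • Finsupp.single ([], k) 1 else 0

/-- The map recovering `liftTransition` from its square. -/
def liftRecover (c : Fin r → Fin r → Fin r → T) (d : Fin n → Fin n → Fin r → Fin r → T) :
    (List (Fin r) × Fin n →₀ T) →ₗ[T] (List (Fin r) × Fin n →₀ T) :=
  Finsupp.linearCombination T (liftRecoverFun c d)

theorem liftTransition_single (a : Fin r → T) (e : Fin n → Fin n → T) (w : List (Fin r))
    (i : Fin n) : liftTransition a e (Finsupp.single (w, i) 1) =
      ∑ j, a j • Finsupp.single (j :: w, i) (1 : T) +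
        if w = [] then ∑ k, e i k • Finsupp.single ([], k) (1 : T) else 0 := by
  split_ifs with h <;> simp [liftTransition, wordShift, matrixCoord, h]

/-- Applying the transition map twice to a nonempty word prefixes two letters with coefficient `a j
* a l`; contracting these with `c` returns one letter with coefficient `a m`, by `hc`. On the empty
word there is in addition the square of the matrix `e`, and `d` restores the difference between `e`
and its square. The mixed terms are words of length one, which the recovery map kills. -/
theorem liftRecover_liftTransition {a : Fin r → T} {e : Fin n → Fin n → T}
    {c : Fin r → Fin r → Fin r → T} {d : Fin n → Fin n → Fin r → Fin r → T}
    (hc : ∀ m, a m = ∑ j, ∑ l, a j * a l * c m j l)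
    (hd : ∀ i k, e i k - ∑ m, e i m * e m k = ∑ j, ∑ l, a j * a l * d i k j l)
    (x : List (Fin r) × Fin n →₀ T) :
    liftRecover c d (liftTransition a e (liftTransition a e x)) = liftTransition a e x := by
  suffices h : liftRecover c d ∘ₗ liftTransition a e ∘ₗ liftTransition a e = liftTransition a e from
    LinearMap.congr_fun h x
  refine Finsupp.lhom_ext' fun ⟨w, i⟩ => LinearMap.ext_ring ?_
  have hD : ∀ b, liftRecover c d (Finsupp.single b 1) = liftRecoverFun c d b := fun b => by
    simp [liftRecover]
  simp only [LinearMap.comp_apply, Finsupp.lsingle_apply]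
  have h1 : ∀ (w : List (Fin r)) , ∑ j, ∑ l, (a j * a l) • ∑ m, c m j l •
      Finsupp.single (m :: w, i) (1 : T) = ∑ m, a m • Finsupp.single (m :: w, i) 1 := by
    intro w
    simp_rw [Finset.smul_sum, smul_smul]
    rw [Finset.sum_congr rfl fun j _ => Finset.sum_comm, Finset.sum_comm]
    refine Finset.sum_congr rfl fun m _ => ?_
    simp_rw [← Finset.sum_smul]
    rw [← hc m]
  rcases w with _ | ⟨m, w⟩
  · have h2 : ∑ j, ∑ l, (a j * a l) • ∑ k, d i k j l • Finsupp.single (([] : List (Fin r)), k) (1 : T)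
        = ∑ k, (e i k - ∑ m, e i m * e m k) • Finsupp.single ([], k) 1 := by
      simp_rw [Finset.smul_sum, smul_smul]
      rw [Finset.sum_congr rfl fun j _ => Finset.sum_comm, Finset.sum_comm]
      refine Finset.sum_congr rfl fun m _ => ?_
      simp_rw [← Finset.sum_smul]
      rw [← hd i m]
    have h3 : ∑ k, e i k • ∑ m, e k m • Finsupp.single (([] : List (Fin r)), m) (1 : T) =
        ∑ k, (∑ m, e i m * e m k) • Finsupp.single ([], k) 1 := by
      simp_rw [Finset.smul_sum, smul_smul]
      rw [Finset.sum_comm]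
      simp_rw [Finset.sum_smul]
    simp only [liftTransition_single, map_add, map_sum, map_smul, hD, liftRecoverFun, if_true,
      smul_add, smul_zero, Finset.sum_const_zero, zero_add, reduceCtorEq, if_false, add_zero,
      Finset.smul_sum, smul_smul, Finset.sum_add_distrib] at h1 h2 h3 ⊢
    rw [h1, h2, h3, add_assoc, ← Finset.sum_add_distrib]
    simp
  · simp only [liftTransition_single, map_sum, map_smul, hD, liftRecoverFun, reduceCtorEq, if_false,
      add_zero, Finset.smul_sum, smul_smul] at h1 ⊢
    exact h1 _

end Lift

section Lift2

variable {T : Type v} [Ring T] {T' : Type w} [Ring T'] {r n : ℕ}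

/-- Finitely generated projective modules lift modulo an idempotent ideal which is finitely
generated on the right. -/
theorem exists_projective_lift (σ : T →+* T') (hσ : Function.Surjective σ)
    (a : Fin r → T) (ha : ∀ j, σ (a j) = 0)
    (hJ : ∀ x, σ x = 0 → ∃ c : Fin r → Fin r → T, x = ∑ j, ∑ l, a j * a l * c j l)
    {P' : Type w'} [AddCommGroup P'] [Module T' P'] (x : Fin n → P') (φ : Fin n → P' →ₗ[T'] T')
    (hφ : ∀ y, ∑ k, φ k y • x k = y) (i₀ : Fin n) :
    ∃ P : ModuleCat.{v} T, CountablyGenerated T P ∧ Module.Projective T P ∧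
      (∃ π : P →ₛₗ[σ] P', Function.Surjective π ∧
        LinearMap.ker π = RingHom.ker σ • (⊤ : Submodule T P)) ∧
      ∀ j, a j ∈ traceIn T P T := by
  choose e he using fun i k => hσ (φ k (x i))
  have hc := fun m => hJ (a m) (ha m)
  choose c hc using hc
  -- The matrix `φ k (x i)` of a dual basis is idempotent, so its lift `e` is idempotent modulo the
  -- kernel of `σ`.
  have hd : ∀ i k, ∃ c : Fin r → Fin r → T,
      e i k - ∑ m, e i m * e m k = ∑ j, ∑ l, a j * a l * c j l := fun i k => hJ _ (by
    have h1 := congr_arg (φ k) (hφ (x i))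
    simp only [map_sum, map_smul, smul_eq_mul] at h1
    simp [he, h1])
  choose d hd using hd
  obtain ⟨P, s, hPs, hs, hsurj, hs0, huniv⟩ :=
    exists_limit_summand.{v, v, w'} (liftRecover_liftTransition hc hd)
  let _ : Module T P' := Module.compHom P' σ
  have hsm : ∀ (t : T) (y : P'), t • y = σ t • y := fun _ _ => rfl
  let θ : (List (Fin r) × Fin n →₀ T) →ₗ[T] P' :=
    Finsupp.linearCombination T fun b => if b.1 = [] then x b.2 else 0
  have hθA : ∀ z, θ (liftTransition a e z) = θ z := by
    intro z
    suffices h : θ ∘ₗ liftTransition a e = θ from LinearMap.congr_fun h z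
    refine Finsupp.lhom_ext' fun ⟨w, i⟩ => LinearMap.ext_ring ?_
    simp only [LinearMap.comp_apply, Finsupp.lsingle_apply, liftTransition_single, map_add, map_sum,
      map_smul]
    split_ifs with h
    · subst h
      simp [θ, hsm, he, hφ]
    · simp [θ, h]
  obtain ⟨Θ, hΘ⟩ := huniv P' θ hθA
  -- This identifies the kernel of the reduction: if `θ z = 0`, the matrix part of the transition
  -- map sends `z` to coefficients killed by `σ`, and the word part has coefficients `a j`. Hence
  -- the next stage represents the same element inside `ker σ • ⊤`.
  have hcoord : ∀ k z, σ (matrixCoord r e k z) = φ k (θ z) := by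
    intro k z
    induction z using Finsupp.induction_linear with
    | zero => simp
    | add f g hf hg => simp [hf, hg]
    | single b t =>
      by_cases h : b.1 = [] <;> simp [matrixCoord, θ, h, hsm, he]
  have hP := isSummand_nat_iff.1
    (hPs.trans (isSummand_nat_of_projective (countablyGenerated_finsupp
      (countablyGenerated_finsupp countablyGenerated_self)) (projective_finsupp ℕ inferInstance)))
  refine ⟨ModuleCat.of T P, hP.1, hP.2, ⟨⟨⟨Θ, Θ.map_add⟩, Θ.map_smul⟩, ?_, ?_⟩, fun j => ?_⟩
  · intro y
    choose t ht using fun k => hσ (φ k y)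
    refine ⟨s 0 (∑ k, t k • Finsupp.single ([], k) 1), ?_⟩
    refine (hΘ 0 _).trans ?_
    simp [θ, hsm, ht, hφ]
  · refine le_antisymm ?_ (Submodule.smul_le.2 fun t ht y _ => ?_)
    · intro y hy
      obtain ⟨k, z, rfl⟩ := hsurj y
      have hz : θ z = 0 := (hΘ k z).symm.trans hy
      rw [← hs]
      refine map_mem_smul_top _ ?_
      rw [liftTransition, LinearMap.add_apply]
      refine add_mem ?_ ?_
      · rw [wordShift, Finsupp.linearCombination_apply]
        refine Submodule.sum_mem _ fun b _ => Submodule.smul_mem _ _ (Submodule.sum_mem _ fun j _ =>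
          Submodule.smul_mem_smul (ha j) Submodule.mem_top)
      · rw [LinearMap.sum_apply]
        refine Submodule.sum_mem _ fun k _ => ?_
        rw [LinearMap.smulRight_apply]
        refine Submodule.smul_mem_smul ?_ Submodule.mem_top
        rw [RingHom.mem_ker, hcoord, hz, map_zero]
    · change Θ (t • y) = 0
      rw [map_smul, hsm, (RingHom.mem_ker).1 ht, zero_smul]
  -- The stage-zero image of the basis vector of the empty word and the index `i₀` has the
  -- coordinate `a j` at the one-letter word `[j]`. The index `i₀` is what requires a nonempty dual
  -- basis, even for the zero module.
  · have h1 := apply_mem_traceIn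
      (Finsupp.lapply ([j], i₀) ∘ₗ Finsupp.lapply 1 ∘ₗ Submodule.subtype P)
      (s 0 (Finsupp.single ([], i₀) 1))
    have h2 : (Finsupp.lapply ([j], i₀) ∘ₗ Finsupp.lapply 1 ∘ₗ Submodule.subtype P)
      (s 0 (Finsupp.single ([], i₀) 1)) = a j := by
      simp only [LinearMap.comp_apply, Submodule.subtype_apply, hs0, Finsupp.lapply_apply,
        Finsupp.single_eq_same, liftTransition_single]
      simp [Finsupp.single_apply]
    rwa [h2] at h1

/-- The reduction of `P` modulo an ideal containing a tail ideal is finitely generated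
projective. -/
theorem exists_quotient_of_tailIdeal_le {P : Type v} [AddCommGroup P] [Module T P]
    {i : P →ₗ[T] (ℕ →₀ T)} {p : (ℕ →₀ T) →ₗ[T] P} (hip : p ∘ₗ i = LinearMap.id)
    (σ : T →+* T') (hσ : Function.Surjective σ) (hn : tailIdeal i n ≤ RingHom.ker σ) :
    ∃ (P' : Submodule T' (ℕ →₀ T')) (π : P →ₛₗ[σ] P'), Function.Surjective π ∧
      LinearMap.ker π = RingHom.ker σ • (⊤ : Submodule T P) ∧ IsSummand T' P' (Fin n →₀ T') := by
  have : RingHomSurjective σ := ⟨hσ⟩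
  let σF : (ℕ →₀ T) →ₛₗ[σ] (ℕ →₀ T') :=
    { toFun := Finsupp.mapRange σ (map_zero σ)
      map_add' := fun x y => Finsupp.mapRange_add (map_add σ) x y
      map_smul' := fun t x => by ext; simp }
  let π₀ : P →ₛₗ[σ] (ℕ →₀ T') := σF.comp i
  have hπ₀ : ∀ x j, π₀ x j = σ (i x j) := fun x j =>
    Finsupp.mapRange_apply (hf := map_zero σ)
  have hexp : ∀ x, x = (i x).sum fun l a => a • p (Finsupp.single l 1) := fun x => by
    have h1 : p (i x) = x := LinearMap.congr_fun hip x
    conv_lhs => rw [← h1, ← Finsupp.sum_single (i x)]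
    rw [map_finsuppSum]
    refine Finsupp.sum_congr fun l _ => ?_
    rw [← map_smul, Finsupp.smul_single_one]
  -- Coordinates of index at least `n` die under `σ`, so the first `n` coordinates determine an
  -- element of the range and the images of `p e_0, …, p e_(n-1)` split `ρ`.
  let ρ : LinearMap.range π₀ →ₗ[T'] (Fin n →₀ T') :=
    (Finsupp.linearEquivFunOnFinite T' T' (Fin n)).symm.toLinearMap ∘ₗ
      LinearMap.pi fun k : Fin n => Finsupp.lapply k.1 ∘ₗ Submodule.subtype _
  let π := π₀.rangeRestrict
  refine ⟨LinearMap.range π₀, π, π₀.surjective_rangeRestrict, ?_,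
    ρ, Finsupp.linearCombination T' fun k : Fin n => π (p (Finsupp.single k.1 1)), ?_⟩
  · refine le_antisymm (fun x hx => ?_) (Submodule.smul_le.2 fun t ht y _ => ?_)
    · rw [hexp x]
      refine Submodule.sum_mem _ fun l _ => Submodule.smul_mem_smul ?_ Submodule.mem_top
      have : π₀ x = 0 := congr_arg Subtype.val (show π x = 0 from hx)
      rw [RingHom.mem_ker, ← hπ₀, this]
      rfl
    · rw [LinearMap.mem_ker, map_smulₛₗ, (RingHom.mem_ker).1 ht, zero_smul]
  · refine LinearMap.ext fun y => ?_
    obtain ⟨x, rfl⟩ : ∃ x, π x = y := π₀.surjective_rangeRestrict y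
    rw [LinearMap.comp_apply, Finsupp.linearCombination_apply,
      Finsupp.sum_fintype _ _ (by simp)]
    have h1 : ∀ k : Fin n, ρ (π x) k = σ (i x k) := fun k => hπ₀ x k
    have h2 : π x = ∑ l ∈ (i x).support ∪ Finset.range n,
        σ (i x l) • π (p (Finsupp.single l 1)) := by
      conv_lhs => rw [hexp x]
      rw [Finsupp.sum, map_sum]
      simp_rw [map_smulₛₗ]
      refine Finset.sum_subset Finset.subset_union_left fun l _ hl => ?_
      rw [Finsupp.notMem_support_iff.1 hl]
      simp
    have h3 : ∑ l ∈ (i x).support ∪ Finset.range n, σ (i x l) • π (p (Finsupp.single l 1)) =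
        ∑ l ∈ Finset.range n, σ (i x l) • π (p (Finsupp.single l 1)) := by
      refine (Finset.sum_subset Finset.subset_union_right fun l _ hl => ?_).symm
      have : i x l ∈ RingHom.ker σ :=
        hn (coord_mem_tailIdeal i (by simpa using hl) x)
      rw [(RingHom.mem_ker).1 this, zero_smul]
    refine Eq.trans ?_ ((h2.trans h3).trans (Fin.sum_univ_eq_sum_range
      (fun l => σ (i x l) • π (p (Finsupp.single l 1))) n).symm).symm
    exact Finset.sum_congr rfl fun k _ => by rw [h1]

end Lift2

/-! ### Two-sided ideals of a ring and of its opposite -/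

section Op

variable {S : Type v} [Ring S]

/-- The ideal of the opposite ring corresponding to a two-sided ideal. -/
def opIdeal (I : Ideal S) [I.IsTwoSided] : Ideal Sᵐᵒᵖ :=
  RingHom.ker (RingHom.op (Ideal.Quotient.mk I))

theorem mem_opIdeal {I : Ideal S} [I.IsTwoSided] {t : Sᵐᵒᵖ} : t ∈ opIdeal I ↔ unop t ∈ I := by
  rw [opIdeal, RingHom.mem_ker, ← Ideal.Quotient.eq_zero_iff_mem]
  exact ⟨fun h => op_injective h, fun h => congr_arg op h⟩

instance (I : Ideal S) [I.IsTwoSided] : (opIdeal I).IsTwoSided :=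
  inferInstanceAs (RingHom.ker _).IsTwoSided

theorem op_mk_surjective (I : Ideal S) [I.IsTwoSided] :
    Function.Surjective (RingHom.op (Ideal.Quotient.mk I)) := fun x => by
  obtain ⟨s, hs⟩ := Ideal.Quotient.mk_surjective (unop x)
  exact ⟨op s, congr_arg op hs⟩

/-- The two-sided ideal corresponding to a two-sided ideal of the opposite ring. -/
def unopIdeal (J : Ideal Sᵐᵒᵖ) [J.IsTwoSided] : Ideal S where
  carrier := {s | op s ∈ J}
  zero_mem' := J.zero_mem
  add_mem' ha hb := J.add_mem ha hb
  smul_mem' c _ hs := J.mul_mem_right (op c) hs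

theorem mem_unopIdeal {J : Ideal Sᵐᵒᵖ} [J.IsTwoSided] {s : S} : s ∈ unopIdeal J ↔ op s ∈ J :=
  Iff.rfl

instance (J : Ideal Sᵐᵒᵖ) [J.IsTwoSided] : (unopIdeal J).IsTwoSided where
  mul_mem_of_left b ha := J.mul_mem_left (op b) ha

theorem opIdeal_unopIdeal (J : Ideal Sᵐᵒᵖ) [J.IsTwoSided] : opIdeal (unopIdeal J) = J := by
  ext t
  rw [mem_opIdeal, mem_unopIdeal, op_unop]

theorem unopIdeal_le_mul {J J' : Ideal Sᵐᵒᵖ} [J.IsTwoSided] [J'.IsTwoSided] (h : J ≤ J' * J) :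
    unopIdeal J ≤ unopIdeal J * unopIdeal J' := by
  intro s hs
  have h1 : op s ∈ J' * J := h hs
  suffices h2 : ∀ t ∈ J' * J, unop t ∈ unopIdeal J * unopIdeal J' from h2 _ h1
  intro t ht
  refine Submodule.smul_induction_on ht (fun a ha b hb => ?_) fun a b ha hb => ?_
  · exact Ideal.mul_mem_mul (I := unopIdeal J) (J := unopIdeal J') (r := unop b) (s := unop a) hb ha
  · exact add_mem ha hb

theorem opIdeal_le_mul {I : Ideal S} [I.IsTwoSided] (h : I ≤ I * I) :
    opIdeal I ≤ opIdeal I * opIdeal I := by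
  intro t ht
  have h1 := h (mem_opIdeal.1 ht)
  suffices h2 : ∀ s ∈ I * I, op s ∈ opIdeal I * opIdeal I from h2 _ h1
  intro s hs
  refine Submodule.smul_induction_on hs (fun a ha b hb => ?_) fun a b ha hb => ?_
  · exact Ideal.mul_mem_mul (I := opIdeal I) (J := opIdeal I) (r := op b) (s := op a)
      (mem_opIdeal.2 hb) (mem_opIdeal.2 ha)
  · exact add_mem ha hb

theorem mulIdeal_eq (P : Type v) [AddCommGroup P] [Module Sᵐᵒᵖ P] (I : Ideal S) [I.IsTwoSided] :
    mulIdeal P I = opIdeal I • (⊤ : Submodule Sᵐᵒᵖ P) := by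
  refine le_antisymm (Submodule.span_le.2 ?_) (Submodule.smul_le.2 fun t ht p _ => ?_)
  · rintro _ ⟨s, hs, p, rfl⟩
    exact Submodule.smul_mem_smul (mem_opIdeal.2 hs) Submodule.mem_top
  · exact Submodule.subset_span ⟨unop t, mem_opIdeal.1 ht, p, by rw [op_unop]⟩

theorem isBig_iff (P : Type v) [AddCommGroup P] [Module Sᵐᵒᵖ P] (I : Ideal S) [I.IsTwoSided] :
    IsBig I P ↔ IsBigLeft (opIdeal I) P := by
  simp only [IsBig, IsBigLeft, mulIdeal_eq]

end Op

/-- An idempotent ideal, finitely generated on the right, is generated by the products of its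
generators. -/
theorem exists_generators_mul {T : Type u} [Ring T] [IsNoetherian Tᵐᵒᵖ T] {J : Ideal T}
    [J.IsTwoSided] (hJ : J ≤ J * J) :
    ∃ (r : ℕ) (a : Fin r → T), (∀ j, a j ∈ J) ∧
      ∀ x ∈ J, ∃ c : Fin r → Fin r → T, x = ∑ j, ∑ l, a j * a l * c j l := by
  let Jr : Submodule Tᵐᵒᵖ T :=
    { carrier := J
      zero_mem' := J.zero_mem
      add_mem' := J.add_mem
      smul_mem' := fun c x hx => J.mul_mem_right (unop c) hx }
  obtain ⟨r, a, ha⟩ := Submodule.fg_iff_exists_fin_generating_family.1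
    (IsNoetherian.noetherian Jr)
  have haJ : ∀ j, a j ∈ J := fun j => by
    have : a j ∈ Jr := ha ▸ Submodule.subset_span ⟨j, rfl⟩
    exact this
  have hgen : ∀ x ∈ J, ∃ c : Fin r → T, x = ∑ j, a j * c j := fun x hx => by
    have : x ∈ Jr := hx
    rw [← ha, Submodule.mem_span_range_iff_exists_fun] at this
    obtain ⟨c, hc⟩ := this
    exact ⟨fun j => unop (c j), hc.symm⟩
  refine ⟨r, a, haJ, fun x hx => ?_⟩
  refine Submodule.smul_induction_on (hJ hx) (fun y hy z hz => ?_) fun y z hy hz => ?_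
  · obtain ⟨c, rfl⟩ := hgen y hy
    choose d hd using fun j => hgen (c j * z) (J.mul_mem_left _ hz)
    refine ⟨d, ?_⟩
    rw [smul_eq_mul, Finset.sum_mul]
    refine Finset.sum_congr rfl fun j _ => ?_
    rw [mul_assoc, hd, Finset.mul_sum]
    simp_rw [mul_assoc]
  · obtain ⟨c, rfl⟩ := hy
    obtain ⟨d, rfl⟩ := hz
    exact ⟨c + d, by simp [mul_add, Finset.sum_add_distrib]⟩

/-! ### Order-like rings and their idempotent ideals -/

/-- A noetherian ring `S` with a central element `z` such that the ideals of interest contain a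
power of `z`, and the quotients by ideals containing a power of `z` are artinian. -/
structure IsOrderLike (S : Type v) [Ring S] (z : S) : Prop where
  noetherian_op : IsNoetherianRing Sᵐᵒᵖ
  noetherian_op_op : IsNoetherian Sᵐᵒᵖᵐᵒᵖ Sᵐᵒᵖ
  comm : ∀ s, z * s = s * z
  pow_mem : ∀ I I' : Ideal S, I.IsTwoSided → I'.IsTwoSided → I ≠ ⊥ → I ≤ I * I' → ∃ k, z ^ k ∈ I'
  artinian : ∀ (I : Ideal S) [I.IsTwoSided], (∃ k, z ^ k ∈ I) →
    IsArtinianRing (S ⧸ I) ∧ IsArtinianRing (S ⧸ I)ᵐᵒᵖ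

section Order

variable {S : Type v} [Ring S] {z : S}

theorem IsOrderLike.mul_mem_span_pow (hS : IsOrderLike S z) {k l : ℕ} {x y : S}
    (hx : x ∈ Ideal.span {z ^ k}) (hy : y ∈ Ideal.span {z ^ l}) :
    x * y ∈ Ideal.span {z ^ (k + l)} := by
  obtain ⟨a, rfl⟩ := Ideal.mem_span_singleton'.1 hx
  obtain ⟨b, rfl⟩ := Ideal.mem_span_singleton'.1 hy
  have h : z ^ k * b = b * z ^ k := ((show Commute z b from hS.comm b).pow_left k).eq
  refine Ideal.mem_span_singleton'.2 ⟨a * b, ?_⟩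
  rw [pow_add, ← mul_assoc, mul_assoc a b, ← h]
  simp only [mul_assoc]

theorem IsOrderLike.isTwoSided_span (hS : IsOrderLike S z) : (Ideal.span {z}).IsTwoSided where
  mul_mem_of_left b ha := by
    obtain ⟨a, rfl⟩ := Ideal.mem_span_singleton'.1 ha
    exact Ideal.mem_span_singleton'.2 ⟨a * b, by rw [mul_assoc, mul_assoc, hS.comm]⟩

/-- A product of elements of `I' + K` and `I' + L` lies in `I' + K L`. -/
theorem mul_mem_sup {I' K L N : Ideal S} [I'.IsTwoSided]
    (h : ∀ x ∈ K, ∀ y ∈ L, x * y ∈ N) {x y : S} (hx : x ∈ I' ⊔ K) (hy : y ∈ I' ⊔ L) :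
    x * y ∈ I' ⊔ N := by
  obtain ⟨x₁, hx₁, x₂, hx₂, rfl⟩ := Submodule.mem_sup.1 hx
  obtain ⟨y₁, hy₁, y₂, hy₂, rfl⟩ := Submodule.mem_sup.1 hy
  rw [add_mul, mul_add x₂, ← add_assoc]
  exact add_mem (Ideal.mem_sup_left (add_mem (I'.mul_mem_right _ hx₁) (I'.mul_mem_left _ hy₁)))
    (Ideal.mem_sup_right (h _ hx₂ _ hy₂))

theorem le_sup_ker_of_map_le {S' : Type w} [Ring S'] (q : S →+* S') (hq : Function.Surjective q)
    {I I' : Ideal S} (h : I.map q ≤ I'.map q) : I ≤ I' ⊔ RingHom.ker q := by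
  intro x hx
  obtain ⟨y, hy, hxy⟩ := (Ideal.mem_map_iff_of_surjective q hq).1 (h (Ideal.mem_map_of_mem q hx))
  rw [← add_sub_cancel y x]
  exact add_mem (Ideal.mem_sup_left hy)
    (Ideal.mem_sup_right (by rw [RingHom.mem_ker, map_sub, hxy, sub_self]))

/-- Descending chains of ideals `I n` with `I m = I m * I n` for `m ≫ n` are stationary. -/
theorem IsOrderLike.chain (hS : IsOrderLike S z) (I : ℕ → Ideal S) (hI : ∀ n, (I n).IsTwoSided)
    (hanti : Antitone I) (hne : ∀ n, I n ≠ ⊥) (hmul : ∀ n, ∃ m, ∀ m' ≥ m, I m' ≤ I m' * I n) :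
    ∃ N, ∀ n, I N ≤ I n := by
  have := hS.isTwoSided_span
  have := (hS.artinian (Ideal.span {z}) ⟨1, by rw [pow_one]; exact Ideal.mem_span_singleton_self z⟩).1
  have hpow : ∀ n, ∃ k, z ^ k ∈ I n := fun n => by
    obtain ⟨m, hm⟩ := hmul n
    exact hS.pow_mem (I m) (I n) (hI m) (hI n) (hne m) (hm m le_rfl)
  let q := Ideal.Quotient.mk (Ideal.span {z})
  let f : ℕ →o (Submodule (S ⧸ Ideal.span {z}) (S ⧸ Ideal.span {z}))ᵒᵈ :=
    ⟨fun n => OrderDual.toDual ((I n).map q), fun m n h => Ideal.map_mono (hanti h)⟩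
  obtain ⟨N, hN⟩ := IsArtinian.monotone_stabilizes f
  -- The images of the chain in the artinian ring `S / zS` are stationary from `N` on.
  have hN' : ∀ m, I N ≤ I m ⊔ Ideal.span {z ^ 1} := by
    intro m
    have h1 : (I N).map q ≤ (I m).map q := by
      rcases le_total N m with h | h
      · exact (show (I N).map q = (I m).map q from hN m h).le
      · exact Ideal.map_mono (hanti h)
    have := le_sup_ker_of_map_le q Ideal.Quotient.mk_surjective h1
    rwa [Ideal.mk_ker, ← pow_one z] at this
  obtain ⟨M, hM⟩ := hmul N
  -- Since `I M ≤ I M * I N`, an inclusion of `I M` modulo `z ^ k` and the inclusion of `I N` modulo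
  -- `z` multiply to an inclusion modulo `z ^ (k + 1)`. The error term disappears once `z ^ k` lies
  -- in `I m`.
  have key : ∀ m k, I M ≤ I m ⊔ Ideal.span {z ^ k} := by
    intro m k
    have := hI m
    induction k with
    | zero => simp
    | succ k ih =>
      refine (hM M le_rfl).trans (Ideal.mul_le.2 fun x hx y hy => ?_)
      exact mul_mem_sup (fun _ ha _ hb => hS.mul_mem_span_pow ha hb) (ih hx) (hN' m hy)
  refine ⟨M, fun n => ?_⟩
  obtain ⟨k, hk⟩ := hpow n
  refine (key n k).trans (sup_le le_rfl ?_)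
  rwa [Ideal.span_le, Set.singleton_subset_iff]

/-- Two-sided ideals are the fully invariant left ideals, hence sums of isotypic components, of
which there are finitely many. -/
theorem finite_isTwoSided_of_isSemisimpleRing (C : Type w) [Ring C] [IsSemisimpleRing C] :
    {I : Ideal C | I.IsTwoSided}.Finite := by
  have hfin : (isotypicComponents C C).Finite := Set.toFinite _
  refine (hfin.powerset.image sSup).subset fun I hI => ?_
  obtain ⟨s, hs, rfl⟩ := isFullyInvariant_iff_sSup_isotypicComponents.1
    (isFullyInvariant_iff_isTwoSided.2 hI)
  exact ⟨s, hs, rfl⟩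

theorem isTwoSided_map {C : Type w} [Ring C] (q : S →+* C) (hq : Function.Surjective q)
    (I : Ideal S) [I.IsTwoSided] : (I.map q).IsTwoSided where
  mul_mem_of_left b ha := by
    obtain ⟨x, hx, rfl⟩ := (Ideal.mem_map_iff_of_surjective q hq).1 ha
    obtain ⟨y, rfl⟩ := hq b
    rw [← map_mul]
    exact Ideal.mem_map_of_mem q (I.mul_mem_right _ hx)

theorem map_pow_mem {C : Type w} [Ring C] (q : S →+* C) {N : Ideal S} {K : Ideal C}
    (h : ∀ x ∈ N, q x ∈ K) (k : ℕ) : ∀ x ∈ N ^ k, q x ∈ K ^ k := by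
  induction k with
  | zero => simp [Submodule.pow_zero, Ideal.one_eq_top]
  | succ k ih =>
    intro x hx
    rw [Submodule.pow_succ] at hx ⊢
    refine Submodule.smul_induction_on hx (fun a ha b hb => ?_) fun a b ha hb => ?_
    · rw [smul_eq_mul, map_mul]
      exact Ideal.mul_mem_mul (ih a ha) (h b hb)
    · rw [map_add]
      exact add_mem ha hb

/-- `S` has only finitely many idempotent two-sided ideals. -/
theorem IsOrderLike.finite_idempotent (hS : IsOrderLike S z) :
    {I : Ideal S | I.IsTwoSided ∧ IsIdempotentElem I}.Finite := by
  have := hS.isTwoSided_span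
  have := (hS.artinian (Ideal.span {z}) ⟨1, by rw [pow_one]; exact Ideal.mem_span_singleton_self z⟩).1
  let B := S ⧸ Ideal.span {z}
  let q₁ : S →+* B := Ideal.Quotient.mk (Ideal.span {z})
  let q₂ : B →+* B ⧸ Ring.jacobson B := Ideal.Quotient.mk _
  let q : S →+* B ⧸ Ring.jacobson B := q₂.comp q₁
  have hq : Function.Surjective q :=
    (Ideal.Quotient.mk_surjective).comp Ideal.Quotient.mk_surjective
  obtain ⟨s, hs⟩ := IsSemiprimaryRing.isNilpotent (R := B)
  have hN : ∀ x ∈ RingHom.ker q ^ s, x ∈ Ideal.span {z ^ 1} := by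
    intro x hx
    have h1 := map_pow_mem q₁ (N := RingHom.ker q) (K := Ring.jacobson B)
      (fun x hx => Ideal.Quotient.eq_zero_iff_mem.1 hx) s x hx
    rw [hs] at h1
    rw [pow_one]
    exact Ideal.Quotient.eq_zero_iff_mem.1 h1
  -- An inclusion in the semisimple quotient propagates by idempotence of `I` to every power of the
  -- kernel of `q`. Some power lies in `zS`, so the inclusion also holds modulo all powers of `z`,
  -- one of which is in `I'`.
  have key : ∀ I I' : Ideal S, I.IsTwoSided ∧ IsIdempotentElem I → I'.IsTwoSided ∧
      IsIdempotentElem I' → I' ≠ ⊥ → I.map q ≤ I'.map q → I ≤ I' := by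
    rintro I I' ⟨hI, hI2⟩ ⟨hI', hI2'⟩ hne hle
    have h1 := le_sup_ker_of_map_le q hq hle
    have h2 : ∀ k, I ≤ I' ⊔ RingHom.ker q ^ k := by
      intro k
      induction k with
      | zero => simp [Submodule.pow_zero, Ideal.one_eq_top]
      | succ k ih =>
        refine hI2.ge.trans (Ideal.mul_le.2 fun x hx y hy => ?_)
        refine mul_mem_sup (fun a ha b hb => ?_) (ih hx) (h1 hy)
        rw [Submodule.pow_succ]
        exact Ideal.mul_mem_mul ha hb
    have h3 : ∀ k, I ≤ I' ⊔ Ideal.span {z ^ k} := by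
      intro k
      induction k with
      | zero => simp
      | succ k ih =>
        refine hI2.ge.trans (Ideal.mul_le.2 fun x hx y hy => ?_)
        exact mul_mem_sup (fun _ ha _ hb => hS.mul_mem_span_pow ha hb) (ih hx)
          (sup_le_sup le_rfl (show RingHom.ker q ^ s ≤ Ideal.span {z ^ 1} from hN) (h2 s hy))
    obtain ⟨k, hk⟩ := hS.pow_mem I' I' hI' hI' hne hI2'.ge
    refine (h3 k).trans (sup_le le_rfl ?_)
    rwa [Ideal.span_le, Set.singleton_subset_iff]
  have hfin : {I : Ideal S | (I.IsTwoSided ∧ IsIdempotentElem I) ∧ I ≠ ⊥}.Finite := by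
    refine Set.Finite.of_finite_image (f := fun I => I.map q) ?_ ?_
    · refine (finite_isTwoSided_of_isSemisimpleRing (B ⧸ Ring.jacobson B)).subset ?_
      rintro _ ⟨I, ⟨⟨hI, -⟩, -⟩, rfl⟩
      exact isTwoSided_map q hq I
    · rintro I ⟨hI, hne⟩ I' ⟨hI', hne'⟩ h
      exact le_antisymm (key I I' hI hI' hne' (le_of_eq h)) (key I' I hI' hI hne (le_of_eq h.symm))
  refine (hfin.insert ⊥).subset fun I hI => ?_
  by_cases h : I = ⊥
  · exact Or.inl h
  · exact Or.inr ⟨hI, h⟩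

end Order

theorem mem_smul_top_prod_iff {T : Type u} [Ring T] {J : Ideal T} {P : Type v} [AddCommGroup P]
    [Module T P] {N : Type w} [AddCommGroup N] [Module T N]
    (hN : J • (⊤ : Submodule T N) = ⊤) (x : P × N) :
    x ∈ J • (⊤ : Submodule T (P × N)) ↔ x.1 ∈ J • (⊤ : Submodule T P) := by
  refine ⟨fun h => map_mem_smul_top (LinearMap.fst T P N) h, fun h => ?_⟩
  have : x = LinearMap.inl T P N x.1 + LinearMap.inr T P N x.2 := by simp
  rw [this]
  exact add_mem (map_mem_smul_top _ h)
    (map_mem_smul_top _ (by rw [hN]; exact Submodule.mem_top))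

/-- A summand of a free module of finite rank has a finite dual basis, whose size may be assumed
positive. -/
theorem IsSummand.exists_dualBasis {T : Type u} [Ring T] {P : Type v} [AddCommGroup P] [Module T P]
    {n : ℕ} (h : IsSummand T P (Fin n →₀ T)) :
    ∃ (x : Fin (n + 1) → P) (φ : Fin (n + 1) → P →ₗ[T] T), ∀ y, ∑ k, φ k y • x k = y := by
  obtain ⟨i, p, hip⟩ := h
  refine ⟨Fin.cons 0 fun k => p (Finsupp.single k 1), Fin.cons 0 fun k => Finsupp.lapply k ∘ₗ i,
    fun y => ?_⟩
  have h1 : p (i y) = y := LinearMap.congr_fun hip y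
  rw [Fin.sum_univ_succ]
  conv_rhs => rw [← h1, ← Finsupp.sum_single (i y), Finsupp.sum_fintype _ _ (by simp), map_sum]
  simp only [Fin.cons_zero, LinearMap.zero_apply, zero_smul, zero_add, Fin.cons_succ]
  refine Finset.sum_congr rfl fun k _ => ?_
  rw [← map_smul, Finsupp.smul_single_one]
  rfl

theorem IsSummand.finite {T : Type u} [Ring T] {P : Type v} [AddCommGroup P] [Module T P]
    {Q : Type w} [AddCommGroup Q] [Module T Q] (h : IsSummand T P Q) [Module.Finite T Q] :
    Module.Finite T P := by
  obtain ⟨i, p, hip⟩ := h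
  exact Module.Finite.of_surjective p fun x => ⟨i x, LinearMap.congr_fun hip x⟩

/-! ### Big projective modules over order-like rings -/

section Order

variable {S : Type v} [Ring S] {z : S}

/-- Whitehead: an idempotent two-sided ideal is the trace of a countably generated projective
module. -/
theorem IsOrderLike.exists_trace (hS : IsOrderLike S z) (I : Ideal S) [I.IsTwoSided]
    (hI : IsIdempotentElem I) :
    ∃ W : ModuleCat.{v} Sᵐᵒᵖ, CountablyGenerated Sᵐᵒᵖ W ∧ Module.Projective Sᵐᵒᵖ W ∧
      opIdeal I • (⊤ : Submodule Sᵐᵒᵖ W) = ⊤ ∧ opIdeal I ≤ traceIn Sᵐᵒᵖ W Sᵐᵒᵖ := by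
  have := hS.noetherian_op_op
  obtain ⟨r, a, ha, hgen⟩ := exists_generators_mul (opIdeal_le_mul hI.ge)
  -- Here the zero module is lifted, with a dual basis consisting of one zero vector. The reduction
  -- of `W` being zero means `W = WI`, while the generators `a j` of `I` are in the trace.
  obtain ⟨W, hWc, hWp, ⟨π, -, hπ⟩, hW⟩ := exists_projective_lift
    (RingHom.op (Ideal.Quotient.mk I)) (op_mk_surjective I) a ha hgen (P' := PUnit.{1}) (n := 1)
    (fun _ => 0) (fun _ => 0) (fun _ => rfl) 0
  refine ⟨W, hWc, hWp, ?_, fun x hx => ?_⟩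
  · rw [opIdeal, ← hπ, eq_top_iff]
    exact fun x _ => rfl
  · obtain ⟨c, rfl⟩ := hgen x hx
    refine Submodule.sum_mem _ fun j _ => Submodule.sum_mem _ fun l _ => ?_
    rw [mul_assoc]
    exact map_mem_traceIn (LinearMap.toSpanSingleton Sᵐᵒᵖ Sᵐᵒᵖ (a l * c j l)) (hW j)

/-- If `J Q = Q`, every element of `Q` lies in the sum of the images of `W`, so countably many
copies of `W` alone map onto `Q`. -/
theorem isBigLeft_prod_finsupp {T : Type v} [Ring T] {J : Ideal T} {P W : Type v} [AddCommGroup P]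
    [Module T P] [AddCommGroup W] [Module T W] (hW : J ≤ traceIn T W T) :
    IsBigLeft J (P × (ℕ →₀ W)) := by
  intro Q hQ _ hJQ
  obtain ⟨y, hy⟩ := countablyGenerated_iff_exists_seq.1 hQ
  obtain ⟨g, hg⟩ := exists_finsupp_map_of_mem_traceIn (W := W) y
    fun n => smul_top_le_traceIn hW (by rw [hJQ]; exact Submodule.mem_top)
  refine ⟨g ∘ₗ LinearMap.snd T _ _, ?_⟩
  rw [LinearMap.coe_comp]
  refine Function.Surjective.comp ?_ LinearMap.snd_surjective
  rw [← LinearMap.range_eq_top, eq_top_iff, ← hy, Submodule.span_le]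
  rintro _ ⟨n, rfl⟩
  exact hg n

/-- Existence of relatively big projective modules with prescribed reduction. -/
theorem IsOrderLike.exists_big (hS : IsOrderLike S z) (I : Ideal S) [I.IsTwoSided]
    (hI : IsIdempotentElem I) {T' : Type w} [Ring T'] (σ : Sᵐᵒᵖ →+* T')
    (hσ : Function.Surjective σ) (hker : RingHom.ker σ = opIdeal I)
    {P' : Type w'} [AddCommGroup P'] [Module T' P'] {n : ℕ} (hP' : IsSummand T' P' (Fin n →₀ T')) :
    ∃ P : ModuleCat.{v} Sᵐᵒᵖ, CountablyGenerated Sᵐᵒᵖ P ∧ Module.Projective Sᵐᵒᵖ P ∧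
      IsBigLeft (opIdeal I) P ∧ ∃ π : P →ₛₗ[σ] P', Function.Surjective π ∧
        LinearMap.ker π = opIdeal I • (⊤ : Submodule Sᵐᵒᵖ P) := by
  have := hS.noetherian_op_op
  obtain ⟨r, a, ha, hgen⟩ := exists_generators_mul (opIdeal_le_mul hI.ge)
  obtain ⟨x, φ, hφ⟩ := hP'.exists_dualBasis
  rw [← hker] at ha
  obtain ⟨P, hPc, hPp, ⟨π, hπ, hπ'⟩, -⟩ := exists_projective_lift σ hσ a ha
    (fun x hx => hgen x (hker ▸ hx)) x φ hφ 0
  obtain ⟨W, hWc, hWp, hJW, hW⟩ := hS.exists_trace I hI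
  -- The summand `W^(ℕ)` creates bigness and does not change the reduction, since `W = WI`.
  refine ⟨ModuleCat.of _ (P × (ℕ →₀ W)), hPc.prod (countablyGenerated_finsupp hWc),
    ?_, isBigLeft_prod_finsupp hW, π.comp (LinearMap.fst _ _ _), ?_, ?_⟩
  · have := projective_finsupp ℕ hWp
    exact inferInstanceAs (Module.Projective Sᵐᵒᵖ (P × (ℕ →₀ W)))
  · rw [LinearMap.coe_comp]
    exact hπ.comp LinearMap.fst_surjective
  · ext y
    rw [LinearMap.mem_ker]
    refine Iff.trans ?_ (mem_smul_top_prod_iff (finsupp_smul_top_eq_top hJW) y).symm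
    rw [← hker, ← hπ', LinearMap.mem_ker]
    rfl

/-- Uniqueness of relatively big projective modules with prescribed reduction. -/
theorem IsOrderLike.nonempty_equiv (hS : IsOrderLike S z) (I : Ideal S) [I.IsTwoSided]
    (hI : IsIdempotentElem I) {P Q : Type v} [AddCommGroup P] [Module Sᵐᵒᵖ P] [AddCommGroup Q]
    [Module Sᵐᵒᵖ Q] (hP : IsBigLeft (opIdeal I) P) (hQ : IsBigLeft (opIdeal I) Q)
    (hPc : CountablyGenerated Sᵐᵒᵖ P) (hPp : Module.Projective Sᵐᵒᵖ P)
    (hQc : CountablyGenerated Sᵐᵒᵖ Q) (hQp : Module.Projective Sᵐᵒᵖ Q)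
    {T' : Type w} [Ring T'] {σ : Sᵐᵒᵖ →+* T'} {P' : Type w'} [AddCommGroup P'] [Module T' P']
    (π : P →ₛₗ[σ] P') (π' : Q →ₛₗ[σ] P') (hπ : Function.Surjective π)
    (hπ' : Function.Surjective π') (hker : LinearMap.ker π = opIdeal I • (⊤ : Submodule Sᵐᵒᵖ P))
    (hker' : LinearMap.ker π' = opIdeal I • (⊤ : Submodule Sᵐᵒᵖ Q)) : Nonempty (P ≃ₗ[Sᵐᵒᵖ] Q) := by
  obtain ⟨W, hWc, hWp, hJW, hW⟩ := hS.exists_trace I hI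
  let _ : Module Sᵐᵒᵖ P' := Module.compHom P' σ
  let ρ : P →ₗ[Sᵐᵒᵖ] P' := ⟨⟨π, π.map_add⟩, π.map_smulₛₗ⟩
  let ρ' : Q →ₗ[Sᵐᵒᵖ] P' := ⟨⟨π', π'.map_add⟩, π'.map_smulₛₗ⟩
  -- Projectivity lifts the identity of the common reduction to a map `f : P → Q`, which need not be
  -- an isomorphism but is one modulo `I`.
  obtain ⟨f, hf⟩ := Module.projective_lifting_property ρ' ρ hπ'
  have hf' : ∀ p, π' (f p) = π p := LinearMap.congr_fun hf
  refine hP.nonempty_equiv hQ hPc hPp hQc hQp hWc hWp hJW hW f (fun q => ?_) fun p hp => ?_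
  · obtain ⟨p, hp⟩ := hπ (π' q)
    refine ⟨p, ?_⟩
    rw [← hker', LinearMap.mem_ker, map_sub, hf', hp, sub_self]
  · rw [← hker, LinearMap.mem_ker, ← hf', ← LinearMap.mem_ker, hker']
    exact hp

theorem IsOrderLike.le_of_isBigLeft (hS : IsOrderLike S z) (I I' : Ideal S) [I.IsTwoSided]
    [I'.IsTwoSided] (hI : IsIdempotentElem I) {P : Type v} [AddCommGroup P] [Module Sᵐᵒᵖ P]
    (hP : IsBigLeft (opIdeal I) P) {N : Submodule Sᵐᵒᵖ P} (hN : N.FG)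
    (hNP : N ⊔ opIdeal I' • ⊤ = ⊤) : I ≤ I' := by
  obtain ⟨W, hWc, hWp, hJW, hW⟩ := hS.exists_trace I hI
  have := hP.le_of_fg hWc hWp hJW hW hN hNP
  exact fun s hs => mem_opIdeal.1 (this (mem_opIdeal.2 (show unop (op s) ∈ I from hs)))

theorem opIdeal_bot : opIdeal (⊥ : Ideal S) = ⊥ := by
  ext t
  rw [mem_opIdeal, Ideal.mem_bot, Ideal.mem_bot, unop_eq_zero_iff]

/-- A finitely generated `P` is finitely generated modulo the zero ideal, and `I`-bigness would give
`I ≤ ⊥`. -/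
theorem IsOrderLike.not_finite_of_isBigLeft (hS : IsOrderLike S z) (I : Ideal S) [I.IsTwoSided]
    (hI : IsIdempotentElem I) (hne : I ≠ ⊥) {P : Type v} [AddCommGroup P] [Module Sᵐᵒᵖ P]
    (hP : IsBigLeft (opIdeal I) P) : ¬ Module.Finite Sᵐᵒᵖ P := fun h =>
  hne (le_bot_iff.1 (hS.le_of_isBigLeft I ⊥ hI hP h.fg_top (by rw [opIdeal_bot]; simp)))

theorem exists_fg_sup_eq_top {T : Type u} [Ring T] {T' : Type w} [Ring T'] {σ : T →+* T'}
    (hσ : Function.Surjective σ)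
    {P : Type v} [AddCommGroup P] [Module T P] {P' : Type w'} [AddCommGroup P'] [Module T' P']
    (π : P →ₛₗ[σ] P') (hπ : Function.Surjective π) (hP' : Module.Finite T' P') :
    ∃ N : Submodule T P, N.FG ∧ N ⊔ LinearMap.ker π = ⊤ := by
  have : RingHomSurjective σ := ⟨hσ⟩
  obtain ⟨s, hs⟩ := hP'.fg_top
  choose g hg using hπ
  refine ⟨Submodule.span T (g '' s), Submodule.fg_span (s.finite_toSet.image g), ?_⟩
  rw [eq_top_iff]
  rintro x -
  have h1 : π x ∈ (Submodule.span T (g '' s)).map π := by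
    rw [Submodule.map_span, ← Set.image_comp]
    have : π ∘ g = id := funext hg
    rw [this, Set.image_id, hs]
    exact Submodule.mem_top
  obtain ⟨y, hy, hyx⟩ := h1
  rw [← add_sub_cancel y x]
  exact add_mem (Submodule.mem_sup_left hy)
    (Submodule.mem_sup_right (by rw [LinearMap.mem_ker, map_sub, hyx, sub_self]))

/-- A countably generated projective module which is not finitely generated is big with respect to
a nonzero idempotent ideal modulo which it is finitely generated. -/
theorem IsOrderLike.exists_isBigLeft (hS : IsOrderLike S z) {P : Type v} [AddCommGroup P]
    [Module Sᵐᵒᵖ P] (hPc : CountablyGenerated Sᵐᵒᵖ P) (hPp : Module.Projective Sᵐᵒᵖ P)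
    (hfin : ¬ Module.Finite Sᵐᵒᵖ P) :
    ∃ (I : Ideal S) (_ : I.IsTwoSided), IsIdempotentElem I ∧ I ≠ ⊥ ∧ IsBigLeft (opIdeal I) P ∧
      ∃ (P' : ModuleCat.{v} (S ⧸ I)ᵐᵒᵖ) (π : P →ₛₗ[RingHom.op (Ideal.Quotient.mk I)] P') (n : ℕ),
        Function.Surjective π ∧ LinearMap.ker π = opIdeal I • (⊤ : Submodule Sᵐᵒᵖ P) ∧
          IsSummand (S ⧸ I)ᵐᵒᵖ P' (Fin n →₀ (S ⧸ I)ᵐᵒᵖ) := by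
  classical
  have := hS.noetherian_op
  have := hS.noetherian_op_op
  obtain ⟨i, p, hip⟩ := isSummand_nat_of_projective hPc hPp
  -- If the `n`-th tail ideal vanished, `P` would be generated by the images of the first `n` basis
  -- vectors.
  have hne : ∀ n, unopIdeal (tailIdeal i n) ≠ ⊥ := by
    intro n h
    apply hfin
    have h0 : ∀ x, ∀ j ≥ n, i x j = 0 := fun x j hj => by
      have h1 : unop (i x j) ∈ unopIdeal (tailIdeal i n) := coord_mem_tailIdeal i hj x
      rw [h, Ideal.mem_bot, unop_eq_zero_iff] at h1
      exact h1
    refine ⟨⟨(Finset.range n).image fun l => p (Finsupp.single l 1), eq_top_iff.2 fun x _ => ?_⟩⟩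
    have h1 : p (i x) = x := LinearMap.congr_fun hip x
    rw [← h1, ← Finsupp.sum_single (i x), map_finsuppSum]
    refine Submodule.sum_mem _ fun l hl => ?_
    dsimp only
    rw [← Finsupp.smul_single_one, map_smul]
    refine Submodule.smul_mem _ _ (Submodule.subset_span ?_)
    rw [Finset.coe_image]
    refine ⟨l, ?_, rfl⟩
    by_contra h2
    exact (Finsupp.mem_support_iff.1 hl) (h0 x l (by simpa using h2))
  have hmul : ∀ n, ∃ m, ∀ m' ≥ m,
      unopIdeal (tailIdeal i m') ≤ unopIdeal (tailIdeal i m') * unopIdeal (tailIdeal i n) := by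
    intro n
    obtain ⟨m, hm⟩ := exists_tailIdeal_le_mul hip n
    exact ⟨m, fun m' hm' => unopIdeal_le_mul (hm m' hm')⟩
  obtain ⟨N, hN⟩ := hS.chain (fun n => unopIdeal (tailIdeal i n)) (fun n => inferInstance)
    (fun m n h s hs => tailIdeal_antitone i h hs) hne hmul
  have hN' : ∀ n, tailIdeal i N ≤ tailIdeal i n := fun n t ht => hN n (show unop t ∈ _ from ht)
  obtain ⟨m, hm⟩ := hmul N
  -- The stable value lies in a later tail ideal, hence in the product of that ideal with the `N`-th
  -- one, hence in its own square.
  have hidem : IsIdempotentElem (unopIdeal (tailIdeal i N)) := by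
    refine le_antisymm Ideal.mul_le_left ?_
    refine (hN (max m N)).trans ((hm _ (le_max_left _ _)).trans ?_)
    exact Ideal.mul_mono_left fun s hs => tailIdeal_antitone i (le_max_right m N) hs
  obtain ⟨P', π, hπ, hker, hP'⟩ := exists_quotient_of_tailIdeal_le (n := N) hip
    (RingHom.op (Ideal.Quotient.mk (unopIdeal (tailIdeal i N)))) (op_mk_surjective _)
    (le_of_eq (opIdeal_unopIdeal (tailIdeal i N)).symm)
  refine ⟨unopIdeal (tailIdeal i N), inferInstance, hidem, hne N, ?_,
    ModuleCat.of _ P', π, N, hπ, hker, hP'⟩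
  rw [opIdeal_unopIdeal]
  intro Q hQc _ hJQ
  exact exists_surjective_of_le_tailIdeal i hN' hQc hJQ

end Order

/-! ### The endomorphism ring of `M` is order-like -/

section EndRing

variable {R : Type u} [CommRing R] {M : Type v} [AddCommGroup M] [Module R M]

/-- A dual basis of `M` up to the denominator `f`. -/
structure AlmostDualBasis (M : Type v) [AddCommGroup M] [Module R M] (f : R) (n : ℕ) where
  vec : Fin n → M
  coord : Fin n → M →ₗ[R] R
  sum_smul : ∀ x, ∑ i, coord i x • vec i = f • x

/-- In a finite generating family choose a maximal independent subfamily. A product `f` of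
denominators for the generators moves `M` into the free span of that subfamily, whose coordinate
functions are composed with multiplication by `f`. -/
theorem exists_almostDualBasis [IsDomain R] [Module.Finite R M] :
    ∃ f : R, f ≠ 0 ∧ ∃ n, Nonempty (AlmostDualBasis M f n) := by
  obtain ⟨k, v, hv⟩ := Module.Finite.exists_fin (R := R) (M := M)
  obtain ⟨s, hs, hs'⟩ := exists_maximal_linearIndepOn R v
  have h1 : ∀ i, ∃ a : R, a ≠ 0 ∧ a • v i ∈ Submodule.span R (v '' s) := by
    intro i
    by_cases hi : i ∈ s
    · exact ⟨1, one_ne_zero, by rw [one_smul]; exact Submodule.subset_span ⟨i, hi, rfl⟩⟩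
    · exact hs' i hi
  choose a ha ha' using h1
  classical
  let f := ∏ i, a i
  have hf : ∀ x, f • x ∈ Submodule.span R (v '' s) := by
    intro x
    have hx : x ∈ Submodule.span R (Set.range v) := hv ▸ Submodule.mem_top
    refine Submodule.span_induction (p := fun x _ => f • x ∈ Submodule.span R (v '' s))
      ?_ ?_ ?_ ?_ hx
    · rintro _ ⟨i, rfl⟩
      rw [show f = (∏ j ∈ Finset.univ.erase i, a j) * a i from
        (Finset.prod_erase_mul _ _ (Finset.mem_univ i)).symm, mul_smul]
      exact Submodule.smul_mem _ _ (ha' i)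
    · simp
    · intro x y _ _ hx hy
      rw [smul_add]
      exact add_mem hx hy
    · intro c x _ hx
      rw [smul_comm]
      exact Submodule.smul_mem _ _ hx
  have hs2 : LinearIndependent R fun i : s => v i := hs
  have hf' : ∀ x, f • x ∈ Submodule.span R (Set.range fun i : s => v i) := fun x => by
    rw [← Set.image_eq_range]
    exact hf x
  let L : M →ₗ[R] (s →₀ R) := hs2.repr ∘ₗ (LinearMap.lsmul R M f).codRestrict _ hf'
  let e : Fin (Fintype.card s) ≃ s := (Fintype.equivFin s).symm
  refine ⟨f, Finset.prod_ne_zero_iff.2 fun i _ => ha i, Fintype.card s,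
    ⟨⟨fun i => v (e i), fun i => Finsupp.lapply (e i) ∘ₗ L, fun x => ?_⟩⟩⟩
  have h2 := hs2.linearCombination_repr ⟨f • x, hf' x⟩
  rw [Finsupp.linearCombination_apply, Finsupp.sum_fintype _ _ (by simp)] at h2
  refine Eq.trans ?_ h2
  exact e.sum_comp fun i => L x i • v i

/-- The ideal generated by the matrix coefficients of the endomorphisms in `I`. -/
def coeffIdeal (I : Ideal (Module.End R M)) : Ideal R :=
  Ideal.span {c | ∃ s ∈ I, ∃ (φ : M →ₗ[R] R) (x : M), c = φ (s x)}

variable {f : R} {n : ℕ}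

/-- Inserting the dual basis between two factors gives `f φ(t t' x) = ∑ coord_i(t' x) φ(t vec_i)`, a
sum of products of coefficients of `t'` and of `t`. -/
theorem AlmostDualBasis.smul_coeffIdeal_le (b : AlmostDualBasis M f n)
    {I I' : Ideal (Module.End R M)} (h : I ≤ I * I') {c : R}
    (hc : c ∈ coeffIdeal I) : f * c ∈ coeffIdeal I' * coeffIdeal I := by
  refine Submodule.span_induction (p := fun c _ => f * c ∈ coeffIdeal I' * coeffIdeal I)
    ?_ ?_ ?_ ?_ hc
  · rintro _ ⟨s, hs, φ, x, rfl⟩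
    refine Submodule.smul_induction_on (p := fun s => f * φ (s x) ∈ coeffIdeal I' * coeffIdeal I)
      (h hs) (fun t ht t' ht' => ?_) fun t t' ht ht' => ?_
    · have : f * φ ((t • t') x) = ∑ i, b.coord i (t' x) * φ (t (b.vec i)) := by
        rw [smul_eq_mul, Module.End.mul_apply, ← smul_eq_mul, ← map_smul, ← map_smul,
          ← b.sum_smul (t' x)]
        simp
      rw [this]
      exact Submodule.sum_mem _ fun i _ => Ideal.mul_mem_mul
        (Ideal.subset_span ⟨t', ht', _, _, rfl⟩) (Ideal.subset_span ⟨t, ht, _, _, rfl⟩)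
    · rw [LinearMap.add_apply, map_add, mul_add]
      exact add_mem ht ht'
  · simp
  · intro x y _ _ hx hy
    rw [mul_add]
    exact add_mem hx hy
  · intro c x _ hx
    rw [smul_eq_mul, mul_left_comm]
    exact Ideal.mul_mem_left _ _ hx

/-- Multiplication by `f φ(s x)` is the sum over `i` of the composites of `coord_i(-) x`, then `s`,
then `φ(-) vec_i`, and each of these lies in the two-sided ideal. -/
theorem AlmostDualBasis.mul_mem_of_mem_coeffIdeal (b : AlmostDualBasis M f n)
    (I : Ideal (Module.End R M)) [I.IsTwoSided] {c : R}
    (hc : c ∈ coeffIdeal I) : algebraMap R (Module.End R M) (f * c) ∈ I := by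
  refine Submodule.span_induction (p := fun c _ => algebraMap R (Module.End R M) (f * c) ∈ I)
    ?_ ?_ ?_ ?_ hc
  · rintro _ ⟨s, hs, φ, x, rfl⟩
    have : algebraMap R (Module.End R M) (f * φ (s x)) =
        ∑ i, φ.smulRight (b.vec i) * s * (b.coord i).smulRight x := by
      refine LinearMap.ext fun y => ?_
      rw [Module.algebraMap_end_apply, mul_comm, mul_smul, ← b.sum_smul y, LinearMap.sum_apply,
        Finset.smul_sum]
      refine Finset.sum_congr rfl fun i _ => ?_
      simp [smul_smul, mul_comm]
    rw [this]
    exact Submodule.sum_mem _ fun i _ => I.mul_mem_right _ (I.mul_mem_left _ hs)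
  · simp
  · intro x y _ _ hx hy
    rw [mul_add, map_add]
    exact add_mem hx hy
  · intro c x _ hx
    rw [smul_eq_mul, mul_left_comm, map_mul]
    exact Ideal.mul_mem_left _ _ hx

/-- Multiplication by `f` maps the nonzero finitely generated ideal `coeffIdeal I` into `coeffIdeal
I' * coeffIdeal I`. Cayley–Hamilton yields a monic polynomial that vanishes at `f` and whose lower
coefficients lie in `coeffIdeal I'`, so that ideal contains a power of `f`. One more factor `f`
moves it into `I'`. -/
theorem AlmostDualBasis.pow_mem [IsDomain R] (b : AlmostDualBasis M f n) [IsNoetherianRing R] [Module.IsTorsionFree R M] (hf : f ≠ 0)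
    (I I' : Ideal (Module.End R M)) [I'.IsTwoSided] (hne : I ≠ ⊥) (h : I ≤ I * I') :
    ∃ k, algebraMap R (Module.End R M) f ^ k ∈ I' := by
  have h0 : coeffIdeal I ≠ ⊥ := by
    intro h0
    apply hne
    rw [eq_bot_iff]
    intro s hs
    rw [Ideal.mem_bot]
    refine LinearMap.ext fun x => ?_
    have h1 : f • s x = 0 := by
      rw [← b.sum_smul (s x)]
      refine Finset.sum_eq_zero fun i _ => ?_
      have : b.coord i (s x) ∈ coeffIdeal I := Ideal.subset_span ⟨s, hs, _, _, rfl⟩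
      rw [h0, Ideal.mem_bot] at this
      rw [this, zero_smul]
    exact (smul_eq_zero_iff_right hf).1 h1
  let g : Module.End R (coeffIdeal I) := LinearMap.lsmul R _ f
  have hg : LinearMap.range g ≤ coeffIdeal I' • ⊤ := by
    rintro _ ⟨c, rfl⟩
    rw [Submodule.mem_smul_top_iff]
    exact b.smul_coeffIdeal_le h c.2
  obtain ⟨p, hp, -, hcoeff, hp0⟩ :=
    LinearMap.exists_monic_and_natDegree_eq_and_coeff_mem_pow_and_aeval_eq_zero R g _ hg
  have hpf : p.eval f = 0 := by
    obtain ⟨c, hc, hc0⟩ := Submodule.exists_mem_ne_zero_of_ne_bot h0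
    have h1 : Polynomial.aeval g p = LinearMap.lsmul R _ (p.eval f) := by
      have : g = Algebra.ofId R (Module.End R (coeffIdeal I)) f := rfl
      rw [this, Polynomial.aeval_algHom_apply, Polynomial.coe_aeval_eq_eval]
      rfl
    have h2 := congr_arg Subtype.val (LinearMap.congr_fun (h1.symm.trans hp0) ⟨c, hc⟩)
    have h3 : p.eval f * c = 0 := h2
    exact (mul_eq_zero.1 h3).resolve_right hc0
  have hmem : f ^ p.natDegree ∈ coeffIdeal I' := by
    rw [Polynomial.eval_eq_sum_range, Finset.sum_range_succ, hp.coeff_natDegree, one_mul] at hpf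
    rw [← neg_eq_of_add_eq_zero_right hpf]
    refine neg_mem (Submodule.sum_mem _ fun k hk => Ideal.mul_mem_right _ _ ?_)
    refine Ideal.pow_le_self ?_ (hcoeff k)
    have := Finset.mem_range.1 hk
    omega
  refine ⟨p.natDegree + 1, ?_⟩
  rw [← map_pow, pow_succ']
  exact b.mul_mem_of_mem_coeffIdeal I' hmem

/-- A prime of the quotient pulls back to a prime containing `c ≠ 0`, which is maximal; a noetherian
ring of dimension zero is artinian. -/
theorem isArtinianRing_quotient_span [IsDomain R] [IsNoetherianRing R] [Ring.DimensionLEOne R] {c : R}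
    (hc : c ≠ 0) : IsArtinianRing (R ⧸ Ideal.span {c}) := by
  rw [isArtinianRing_iff_krullDimLE_zero]
  refine Ring.KrullDimLE.mk₀ fun P hP => ?_
  have h1 : (P.comap (Ideal.Quotient.mk (Ideal.span {c}))).IsMaximal := by
    refine Ring.DimensionLEOne.maximalOfPrime ?_ inferInstance
    intro h
    have : c ∈ P.comap (Ideal.Quotient.mk (Ideal.span {c})) := by
      rw [Ideal.mem_comap, Ideal.Quotient.eq_zero_iff_mem.2 (Ideal.mem_span_singleton_self c)]
      exact P.zero_mem
    rw [h] at this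
    exact hc this
  have h2 := Ideal.map_eq_top_or_isMaximal_of_surjective
    (Ideal.Quotient.mk (Ideal.span {c})) Ideal.Quotient.mk_surjective h1
  rw [Ideal.map_comap_of_surjective _ Ideal.Quotient.mk_surjective] at h2
  exact h2.resolve_left hP.ne_top

theorem isNoetherian_end [IsNoetherianRing R] [Module.Finite R M] :
    IsNoetherian R (Module.End R M) := by
  obtain ⟨k, v, hv⟩ := Module.Finite.exists_fin (R := R) (M := M)
  let ev : Module.End R M →ₗ[R] (Fin k → M) := LinearMap.pi fun i => LinearMap.applyₗ (v i)
  refine isNoetherian_of_injective ev fun s t hst => ?_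
  refine LinearMap.ext_on_range hv fun i => congr_fun hst i

/-- The quotient is a finite algebra over the artinian ring `R / (c)`, and so is its opposite. -/
theorem isArtinianRing_end_quotient [IsDomain R] [IsNoetherianRing R] [Ring.DimensionLEOne R]
    [Module.Finite R M] {c : R} (hc : c ≠ 0) (I : Ideal (Module.End R M)) [I.IsTwoSided]
    (hI : algebraMap R (Module.End R M) c ∈ I) :
    IsArtinianRing (Module.End R M ⧸ I) ∧ IsArtinianRing (Module.End R M ⧸ I)ᵐᵒᵖ := by
  have := isArtinianRing_quotient_span hc
  have := isNoetherian_end (R := R) (M := M)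
  let R₀ := R ⧸ Ideal.span {c}
  let g : R₀ →+* (Module.End R M ⧸ I) := Ideal.Quotient.lift (Ideal.span {c})
    ((Ideal.Quotient.mk I).comp (algebraMap R (Module.End R M))) (fun x hx => by
      obtain ⟨y, rfl⟩ := Ideal.mem_span_singleton'.1 hx
      rw [RingHom.comp_apply, map_mul, Ideal.Quotient.eq_zero_iff_mem]
      exact I.mul_mem_left _ hI)
  have hg : ∀ x, g (Ideal.Quotient.mk _ x) = Ideal.Quotient.mk I (algebraMap R _ x) := fun _ => rfl
  let _ : Algebra R₀ (Module.End R M ⧸ I) := g.toAlgebra' fun x y => by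
    obtain ⟨x, rfl⟩ := Ideal.Quotient.mk_surjective x
    obtain ⟨y, rfl⟩ := Ideal.Quotient.mk_surjective y
    rw [hg, ← map_mul, ← map_mul, Algebra.commutes]
  have : IsScalarTower R R₀ (Module.End R M ⧸ I) := .of_algebraMap_eq fun x => rfl
  have : Module.Finite R (Module.End R M ⧸ I) :=
    Module.Finite.of_surjective (Submodule.mkQ (I.restrictScalars R))
      (Submodule.mkQ_surjective _)
  have h1 : Module.Finite R₀ (Module.End R M ⧸ I) :=
    Module.Finite.of_restrictScalars_finite R R₀ _
  have h2 : Module.Finite R₀ (Module.End R M ⧸ I)ᵐᵒᵖ := Module.Finite.equiv (opLinearEquiv R₀)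
  exact ⟨isArtinian_of_tower R₀ (isArtinian_of_fg_of_artinian' ),
    isArtinian_of_tower R₀ (isArtinian_of_fg_of_artinian')⟩

theorem isOrderLike_end [IsDomain R] [IsNoetherianRing R] [Ring.DimensionLEOne R]
    [Module.Finite R M] [Module.IsTorsionFree R M] (hf : f ≠ 0) (b : AlmostDualBasis M f n) :
    IsOrderLike (Module.End R M) (algebraMap R (Module.End R M) f) where
  noetherian_op := by
    have := isNoetherian_end (R := R) (M := M)
    have : IsNoetherian R (Module.End R M)ᵐᵒᵖ := isNoetherian_of_linearEquiv (opLinearEquiv R)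
    exact isNoetherian_of_tower R this
  noetherian_op_op := by
    have := isNoetherian_end (R := R) (M := M)
    have : IsNoetherian R (Module.End R M)ᵐᵒᵖ := isNoetherian_of_linearEquiv (opLinearEquiv R)
    exact isNoetherian_of_tower R this
  comm s := Algebra.commutes f s
  pow_mem I I' _ hI' hne h := b.pow_mem hf I I' hne h
  artinian I hI := fun ⟨k, hk⟩ => isArtinianRing_end_quotient (pow_ne_zero k hf) I (by rwa [map_pow])

end EndRing

/-! ### Supports in direct sums and Kaplansky's theorem -/

section Support

variable {A : Type u} [Ring A] {M : Type v} [AddCommGroup M] [Module A M]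

theorem isSummand_finsupp_of_injective {α : Type*} {β : Type*} (g : α → β)
    (hg : Function.Injective g) : IsSummand A (α →₀ M) (β →₀ M) :=
  ⟨Finsupp.lmapDomain M A g, Finsupp.lcomapDomain g hg,
    LinearMap.ext fun x => Finsupp.comapDomain_mapDomain g hg x⟩

theorem isSummand_finsupp_subtype {Λ : Type w'} {X : Type w} [AddCommGroup X] [Module A X]
    {i : X →ₗ[A] (Λ →₀ M)} {p : (Λ →₀ M) →ₗ[A] X} (hip : p ∘ₗ i = LinearMap.id) (s : Set Λ)
    (hs : ∀ x, ((i x).support : Set Λ) ⊆ s) : IsSummand A X (s →₀ M) := by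
  refine ⟨Finsupp.lcomapDomain Subtype.val Subtype.val_injective ∘ₗ i,
    p ∘ₗ Finsupp.lmapDomain M A Subtype.val, LinearMap.ext fun x => ?_⟩
  have h := Finsupp.mapDomain_comapDomain (Subtype.val : s → Λ) Subtype.val_injective (i x)
    (by rw [Subtype.range_coe]; exact hs x)
  change p (Finsupp.mapDomain Subtype.val (Finsupp.comapDomain Subtype.val (i x) _)) = x
  rw [h]
  exact LinearMap.congr_fun hip x

theorem support_subset_of_span {Λ : Type w'} {X : Type w} [AddCommGroup X] [Module A X]
    (i : X →ₗ[A] (Λ →₀ M)) {t : Set X} (ht : Submodule.span A t = ⊤) (x : X) :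
    ((i x).support : Set Λ) ⊆ ⋃ y ∈ t, ((i y).support : Set Λ) := by
  have hx : x ∈ Submodule.span A t := ht ▸ Submodule.mem_top
  have hle : Submodule.span A t ≤
      (Finsupp.supported M A (⋃ y ∈ t, ((i y).support : Set Λ))).comap i := by
    refine Submodule.span_le.2 fun y hy => ?_
    exact (Finsupp.mem_supported A _).2 (Set.subset_biUnion_of_mem (u := fun y =>
      ((i y).support : Set Λ)) hy)
  exact (Finsupp.mem_supported A _).1 (hle hx)

theorem isSummand_nat_of_countablyGenerated {X : Type w} [AddCommGroup X] [Module A X]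
    (h : InAddInf.{u, v, w, w'} A M X) (hX : CountablyGenerated A X) :
    IsSummand A X (ℕ →₀ M) := by
  obtain ⟨Λ, i, p, hip⟩ := h
  obtain ⟨t, ht, ht'⟩ := hX
  have hc : (⋃ y ∈ t, ((i y).support : Set Λ)).Countable :=
    ht.biUnion fun y _ => (i y).support.countable_toSet
  have := hc.to_subtype
  obtain ⟨g, hg⟩ := exists_injective_nat (⋃ y ∈ t, ((i y).support : Set Λ))
  exact (isSummand_finsupp_subtype hip _ (support_subset_of_span i ht')).trans
    (isSummand_finsupp_of_injective g hg)

theorem inAddFin_of_finite {Λ : Type w'} {X : Type w} [AddCommGroup X] [Module A X]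
    (h : IsSummand A X (Λ →₀ M)) [hX : Module.Finite A X] : InAddFin A M X := by
  obtain ⟨i, p, hip⟩ := h
  obtain ⟨t, ht⟩ := hX.fg_top
  have hc : (⋃ y ∈ (t : Set X), ((i y).support : Set Λ)).Finite :=
    t.finite_toSet.biUnion fun y _ => (i y).support.finite_toSet
  have := hc.to_subtype
  obtain ⟨n, ⟨e⟩⟩ := Finite.exists_equiv_fin (⋃ y ∈ (t : Set X), ((i y).support : Set Λ))
  exact ⟨n, (isSummand_finsupp_subtype hip _ (support_subset_of_span i ht)).trans
    (isSummand_finsupp_of_injective e e.injective)⟩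

theorem countablyGenerated_of_finite {X : Type w} [AddCommGroup X] [Module A X]
    [hX : Module.Finite A X] : CountablyGenerated A X := by
  obtain ⟨t, ht⟩ := hX.fg_top
  exact ⟨t, t.countable_toSet, ht⟩

theorem exists_submodule_equiv {Λ : Type w'} {X : Type w} [AddCommGroup X] [Module A X]
    (h : IsSummand A X (Λ →₀ M)) : ∃ X' : Submodule A (Λ →₀ M), Nonempty (X ≃ₗ[A] X') := by
  obtain ⟨i, p, hip⟩ := h
  refine ⟨LinearMap.range i, ⟨LinearEquiv.ofInjective i ?_⟩⟩
  exact Function.LeftInverse.injective (g := p) fun x => LinearMap.congr_fun hip x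

/-- Kaplansky: an indecomposable summand of a direct sum of finitely generated modules is countably
generated. -/
theorem IsIndecomposable.countablyGenerated [Module.Finite A M] {X : Type w} [AddCommGroup X]
    [Module A X] (hX : IsIndecomposable A X) (h : InAddInf.{u, v, w, w'} A M X) :
    CountablyGenerated A X := by
  classical
  obtain ⟨Λ, i, p, hip⟩ := h
  have hip' : ∀ x, p (i x) = x := LinearMap.congr_fun hip
  obtain ⟨l₀, m₀, h₀⟩ : ∃ l m, p (Finsupp.single l m) ≠ 0 := by
    by_contra! hcon
    obtain ⟨x, hx⟩ := @exists_ne X hX.1 0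
    have : p = 0 := Finsupp.lhom_ext fun l m => hcon l m
    exact hx (by rw [← hip' x, this]; rfl)
  have hc : ∀ l, ∃ s : Finset Λ, ∀ m, ((i (p (Finsupp.single l m))).support : Set Λ) ⊆ s := by
    intro l
    obtain ⟨t, ht⟩ := (inferInstance : Module.Finite A M).fg_top
    refine ⟨t.biUnion fun y => (i (p (Finsupp.single l y))).support, fun m => ?_⟩
    refine (support_subset_of_span (i ∘ₗ p ∘ₗ Finsupp.lsingle l) ht m).trans ?_
    simp
  choose c hc using hc
  -- Closing `{l₀}` under `c` gives a countable set `L'` such that `i ∘ p` maps `M^(L')` into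
  -- itself. Restriction to `L'` then induces an idempotent endomorphism of `X`, nonzero by the
  -- choice of `l₀`, whose image is countably generated.
  let L : ℕ → Set Λ := fun n =>
    Nat.rec (motive := fun _ => Set Λ) {l₀} (fun _ s => ⋃ l ∈ s, (c l : Set Λ)) n
  have hL : ∀ n, (L n).Countable := by
    intro n
    induction n with
    | zero => exact Set.countable_singleton l₀
    | succ n ih => exact ih.biUnion fun l _ => (c l).countable_toSet
  let L' : Set Λ := ⋃ n, L n
  have hL' : L'.Countable := Set.countable_iUnion hL
  have hLc : ∀ l ∈ L', (c l : Set Λ) ⊆ L' := by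
    intro l hl
    obtain ⟨n, hn⟩ := Set.mem_iUnion.1 hl
    exact (Set.subset_biUnion_of_mem (u := fun l => (c l : Set Λ)) hn).trans
      (Set.subset_iUnion L (n + 1))
  have hl₀ : l₀ ∈ L' := Set.mem_iUnion.2 ⟨0, rfl⟩
  let q : (Λ →₀ M) →ₗ[A] (Λ →₀ M) :=
    Submodule.subtype _ ∘ₗ Finsupp.restrictDom M A L'
  have hq : ∀ y : Λ →₀ M, (y.support : Set Λ) ⊆ L' → q y = y := fun y hy =>
    (Finsupp.filter_eq_self_iff _ _).2 fun l hl => hy (Finsupp.mem_support_iff.2 hl)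
  have hqs : ∀ y, (((q y : Λ →₀ M)).support : Set Λ) ⊆ L' := fun y =>
    (Finsupp.mem_supported A _).1 (Finsupp.restrictDom M A L' y).2
  have hstable : ∀ y : Λ →₀ M, (y.support : Set Λ) ⊆ L' → ((i (p y)).support : Set Λ) ⊆ L' := by
    intro y hy
    rw [← Finsupp.mem_supported A, ← Finsupp.sum_single y, map_finsuppSum, map_finsuppSum]
    refine Submodule.sum_mem _ fun l hl => (Finsupp.mem_supported A _).2 ?_
    exact (hc l _).trans (hLc l (hy hl))
  let π : X →ₗ[A] X := p ∘ₗ q ∘ₗ i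
  have hπ : IsIdempotentElem π := by
    refine LinearMap.ext fun x => ?_
    change p (q (i (p (q (i x))))) = p (q (i x))
    rw [hq _ (hstable _ (hqs _)), hip']
  have hcompl := LinearMap.IsIdempotentElem.isCompl hπ
  rcases hX.2 _ _ hcompl with h | h
  · exfalso
    apply h₀
    have h1 : π (p (Finsupp.single l₀ m₀)) = p (Finsupp.single l₀ m₀) := by
      change p (q (i (p _))) = _
      rw [hq, hip']
      exact hstable _ ((Finset.coe_subset.2 Finsupp.support_single_subset).trans (by simpa using hl₀))
    have h2 : p (Finsupp.single l₀ m₀) ∈ LinearMap.range π := ⟨_, h1⟩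
    rw [h] at h2
    exact h2
  · have hsurj : LinearMap.range π = ⊤ := by
      have := hcompl.sup_eq_top
      rwa [h, sup_bot_eq] at this
    have := hL'.to_subtype
    obtain ⟨s, hs, hs'⟩ : CountablyGenerated A (L' →₀ M) :=
      countablyGenerated_finsupp countablyGenerated_of_finite
    refine ⟨(p ∘ₗ Finsupp.lmapDomain M A (Subtype.val : L' → Λ)) '' s, hs.image _, ?_⟩
    rw [Submodule.span_image, hs', Submodule.map_top, LinearMap.range_eq_top]
    intro x
    obtain ⟨y, rfl⟩ := LinearMap.range_eq_top.1 hsurj x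
    refine ⟨Finsupp.comapDomain Subtype.val (q (i y)) Subtype.val_injective.injOn, ?_⟩
    change p (Finsupp.mapDomain _ _) = p (q (i y))
    rw [Finsupp.mapDomain_comapDomain _ Subtype.val_injective]
    rw [Subtype.range_coe]
    exact hqs _

end Support

/-! ### The equivalence between `Add(M)` and projective modules over `End(M)` -/

section Hom

variable {A : Type u} [Ring A] {M : Type v} [AddCommGroup M] [Module A M]

/-- An element of `HomRight A M X` as a linear map. -/
def HomRight.hom {X : Type w} [AddCommGroup X] [Module A X] (α : HomRight A M X) : M →ₗ[A] X := α

/-- A linear map as an element of `HomRight A M X`. -/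
def HomRight.of {X : Type w} [AddCommGroup X] [Module A X] (α : M →ₗ[A] X) : HomRight A M X := α

theorem HomRight.ext {X : Type w} [AddCommGroup X] [Module A X] {α β : HomRight A M X}
    (h : ∀ m, α.hom m = β.hom m) : α = β :=
  LinearMap.ext h

theorem HomRight.hom_sum {X : Type w} [AddCommGroup X] [Module A X] {ι : Type*} (s : Finset ι)
    (α : ι → HomRight A M X) (m : M) : (∑ j ∈ s, α j).hom m = ∑ j ∈ s, (α j).hom m :=
  LinearMap.sum_apply s α m

/-- `Hom(M, -)` on homomorphisms. -/
def homMap (M : Type v) [AddCommGroup M] [Module A M] {X : Type w} [AddCommGroup X] [Module A X]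
    {Y : Type w'} [AddCommGroup Y]
    [Module A Y] (h : X →ₗ[A] Y) : HomRight A M X →ₗ[(Module.End A M)ᵐᵒᵖ] HomRight A M Y where
  toFun f := h ∘ₗ (f : M →ₗ[A] X)
  map_add' f g := LinearMap.comp_add (f : M →ₗ[A] X) (g : M →ₗ[A] X) h
  map_smul' s f := (LinearMap.comp_assoc (unop s : M →ₗ[A] M) (f : M →ₗ[A] X) h).symm

theorem homMap_comp {X : Type*} [AddCommGroup X] [Module A X] {Y : Type*} [AddCommGroup Y]
    [Module A Y] {Z : Type*} [AddCommGroup Z] [Module A Z] (g : Y →ₗ[A] Z) (h : X →ₗ[A] Y) :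
    homMap M (g ∘ₗ h) = homMap M g ∘ₗ homMap M h := rfl

theorem homMap_id {X : Type*} [AddCommGroup X] [Module A X] :
    homMap M (LinearMap.id : X →ₗ[A] X) = LinearMap.id := rfl

theorem homMap_hom {X : Type*} [AddCommGroup X] [Module A X] {Y : Type*} [AddCommGroup Y]
    [Module A Y] (h : X →ₗ[A] Y) (α : HomRight A M X) (m : M) :
    (homMap M h α).hom m = h (α.hom m) := rfl

/-- The canonical map `S^(Λ) → Hom(M, M^(Λ))`. -/
def homFinsuppMap (A : Type u) [Ring A] (M : Type v) [AddCommGroup M] [Module A M] (Λ : Type w) :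
    (Λ →₀ (Module.End A M)ᵐᵒᵖ) →ₗ[(Module.End A M)ᵐᵒᵖ] HomRight A M (Λ →₀ M) :=
  Finsupp.linearCombination _ fun l => HomRight.of (Finsupp.lsingle l)

theorem homFinsuppMap_single {Λ : Type w} (l : Λ) (s : (Module.End A M)ᵐᵒᵖ) (m : M) :
    (homFinsuppMap A M Λ (Finsupp.single l s)).hom m =
      Finsupp.single l ((unop s : M →ₗ[A] M) m) := by
  rw [homFinsuppMap, Finsupp.linearCombination_single]
  rfl

theorem homFinsuppMap_apply_apply {Λ : Type w} (c : Λ →₀ (Module.End A M)ᵐᵒᵖ) (m : M) (l : Λ) :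
    (homFinsuppMap A M Λ c).hom m l = (unop (c l) : Module.End A M) m := by
  classical
  induction c using Finsupp.induction_linear with
  | zero =>
    rw [map_zero]
    rfl
  | add f g hf hg =>
    rw [map_add, Finsupp.add_apply, unop_add, LinearMap.add_apply, ← hf, ← hg]
    rfl
  | single l' s =>
    rw [homFinsuppMap_single]
    by_cases h : l' = l
    · subst h
      simp
    · simp [h]

/-- Surjectivity uses that `M` is finitely generated: the values of a homomorphism from `M` are
supported in one finite subset of `Λ`. -/
theorem homFinsuppMap_bijective [Module.Finite A M] (Λ : Type w) :
    Function.Bijective (homFinsuppMap A M Λ) := by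
  classical
  constructor
  · intro c d hcd
    refine Finsupp.ext fun l => unop_injective (LinearMap.ext fun m => ?_)
    rw [← homFinsuppMap_apply_apply, hcd, homFinsuppMap_apply_apply]
  · intro α
    obtain ⟨t, ht⟩ := (inferInstance : Module.Finite A M).fg_top
    let s : Finset Λ := t.biUnion fun y => (α.hom y).support
    have hs : ∀ m, ∀ l ∉ s, α.hom m l = 0 := fun m l hl => by
      by_contra hne
      have := support_subset_of_span α.hom ht m (Finsupp.mem_support_iff.2 hne)
      exact hl (by simpa [s] using this)
    let c : Λ →₀ (Module.End A M)ᵐᵒᵖ := Finsupp.onFinset s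
      (fun l => op (Finsupp.lapply l ∘ₗ α.hom : M →ₗ[A] M)) fun l hl => by
        by_contra h
        exact hl (congr_arg op (LinearMap.ext fun m => hs m l h))
    refine ⟨c, HomRight.ext fun m => Finsupp.ext fun l => ?_⟩
    exact homFinsuppMap_apply_apply c m l

/-- `S^(Λ) ≅ Hom(M, M^(Λ))`. -/
def homFinsuppEquiv (A : Type u) [Ring A] (M : Type v) [AddCommGroup M] [Module A M]
    [Module.Finite A M] (Λ : Type w) :
    (Λ →₀ (Module.End A M)ᵐᵒᵖ) ≃ₗ[(Module.End A M)ᵐᵒᵖ] HomRight A M (Λ →₀ M) :=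
  LinearEquiv.ofBijective _ (homFinsuppMap_bijective Λ)

theorem IsSummand.homRight [Module.Finite A M] {Λ : Type w'} {X : Type w} [AddCommGroup X]
    [Module A X] (h : IsSummand A X (Λ →₀ M)) :
    IsSummand (Module.End A M)ᵐᵒᵖ (HomRight A M X) (Λ →₀ (Module.End A M)ᵐᵒᵖ) := by
  obtain ⟨i, p, hip⟩ := h
  refine IsSummand.trans ⟨homMap M i, homMap M p, ?_⟩
    (isSummand_of_equiv (homFinsuppEquiv A M Λ).symm)
  rw [← homMap_comp, hip, homMap_id]

/-- `Hom(M, -)` is full on `Add(M)`. -/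
theorem exists_homMap_eq [Module.Finite A M] {Λ : Type*} {X : Type*} [AddCommGroup X]
    [Module A X] (h : IsSummand A X (Λ →₀ M)) {Y : Type*} [AddCommGroup Y] [Module A Y]
    (g : HomRight A M X →ₗ[(Module.End A M)ᵐᵒᵖ] HomRight A M Y) :
    ∃ f : X →ₗ[A] Y, homMap M f = g := by
  obtain ⟨i, p, hip⟩ := h
  let g' := g ∘ₗ homMap M p
  let f : (Λ →₀ M) →ₗ[A] Y :=
    Finsupp.lsum ℕ fun l => (g' (HomRight.of (Finsupp.lsingle l))).hom
  have hf : homMap M f = g' := by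
    suffices h : homMap M f ∘ₗ homFinsuppMap A M Λ = g' ∘ₗ homFinsuppMap A M Λ from
      (LinearMap.cancel_right (homFinsuppMap_bijective Λ).surjective).1 h
    refine Finsupp.lhom_ext' fun l => LinearMap.ext_ring (HomRight.ext fun m => ?_)
    simp only [LinearMap.comp_apply, Finsupp.lsingle_apply]
    rw [homMap_hom, homFinsuppMap_single, homFinsuppMap, Finsupp.linearCombination_single, one_smul]
    simp [f]
  refine ⟨f ∘ₗ i, ?_⟩
  rw [homMap_comp, hf]
  change g ∘ₗ (homMap M p ∘ₗ homMap M i) = g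
  rw [← homMap_comp, hip, homMap_id, LinearMap.comp_id]

/-- `Hom(M, -)` is faithful on `Add(M)`. -/
theorem homMap_injective {Λ : Type*} {X : Type*} [AddCommGroup X]
    [Module A X] (h : IsSummand A X (Λ →₀ M)) {Y : Type*} [AddCommGroup Y] [Module A Y]
    {f g : X →ₗ[A] Y} (hfg : homMap M f = homMap M g) : f = g := by
  obtain ⟨i, p, hip⟩ := h
  have h1 : f ∘ₗ p = g ∘ₗ p := by
    refine Finsupp.lhom_ext' fun l => ?_
    exact LinearMap.congr_fun hfg (HomRight.of (p ∘ₗ Finsupp.lsingle l))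
  rw [← LinearMap.comp_id f, ← LinearMap.comp_id g, ← hip, ← LinearMap.comp_assoc, h1,
    LinearMap.comp_assoc]

theorem nonempty_equiv_of_homRight [Module.Finite A M] {Λ Λ' : Type*} {X : Type*} [AddCommGroup X]
    [Module A X] (hX : IsSummand A X (Λ →₀ M)) {Y : Type*} [AddCommGroup Y] [Module A Y]
    (hY : IsSummand A Y (Λ' →₀ M))
    (e : HomRight A M X ≃ₗ[(Module.End A M)ᵐᵒᵖ] HomRight A M Y) : Nonempty (X ≃ₗ[A] Y) := by
  obtain ⟨f, hf⟩ := exists_homMap_eq hX e.toLinearMap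
  obtain ⟨g, hg⟩ := exists_homMap_eq hY e.symm.toLinearMap
  refine ⟨LinearEquiv.ofLinearMap f g (homMap_injective hY ?_) (homMap_injective hX ?_)⟩
  · rw [homMap_comp, hf, hg, homMap_id]
    exact LinearMap.ext fun x => e.apply_symm_apply x
  · rw [homMap_comp, hf, hg, homMap_id]
    exact LinearMap.ext fun x => e.symm_apply_apply x

/-- Every summand of `S^(Λ)` is of the form `Hom(M, X)` with `X` a summand of `M^(Λ)`. -/
theorem exists_homRight_equiv [Module.Finite A M] {Λ : Type w'} {P : Type w} [AddCommGroup P]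
    [Module (Module.End A M)ᵐᵒᵖ P]
    (h : IsSummand (Module.End A M)ᵐᵒᵖ P (Λ →₀ (Module.End A M)ᵐᵒᵖ)) :
    ∃ X : Submodule A (Λ →₀ M), IsSummand A X (Λ →₀ M) ∧
      Nonempty (HomRight A M X ≃ₗ[(Module.End A M)ᵐᵒᵖ] P) := by
  obtain ⟨i, p, hip⟩ := h
  let Φ := homFinsuppEquiv A M Λ
  have hself : IsSummand A (Λ →₀ M) (Λ →₀ M) := ⟨LinearMap.id, LinearMap.id, rfl⟩
  -- Fullness turns the idempotent `i ∘ p` of the free module into an endomorphism `ε` of `M^(Λ)`,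
  -- and faithfulness makes `ε` idempotent. The module sought is the image of `ε`.
  obtain ⟨ε, hε⟩ := exists_homMap_eq hself (Φ.toLinearMap ∘ₗ i ∘ₗ p ∘ₗ Φ.symm.toLinearMap)
  have hip' : ∀ x, p (i x) = x := LinearMap.congr_fun hip
  have hε' : ∀ α, homMap M ε α = Φ (i (p (Φ.symm α))) := fun α => LinearMap.congr_fun hε α
  have hidem : ε ∘ₗ ε = ε := by
    refine homMap_injective hself (LinearMap.ext fun α => ?_)
    rw [homMap_comp, LinearMap.comp_apply, hε', hε']
    simp [hip']
  let ι := Submodule.subtype (LinearMap.range ε)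
  let ρ := ε.rangeRestrict
  have hιρ : ι ∘ₗ ρ = ε := rfl
  have hει : ε ∘ₗ ι = ι := by
    refine LinearMap.ext ?_
    rintro ⟨_, y, rfl⟩
    exact LinearMap.congr_fun hidem y
  have hρι : ρ ∘ₗ ι = LinearMap.id := LinearMap.ext fun x =>
    Subtype.ext (LinearMap.congr_fun hει x)
  refine ⟨LinearMap.range ε, ⟨ι, ρ, hρι⟩, ⟨LinearEquiv.ofLinearMap
    (p ∘ₗ Φ.symm.toLinearMap ∘ₗ homMap M ι) (homMap M ρ ∘ₗ Φ.toLinearMap ∘ₗ i) ?_ ?_⟩⟩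
  · refine LinearMap.ext fun x => ?_
    change p (Φ.symm (homMap M ι (homMap M ρ (Φ (i x))))) = x
    rw [← LinearMap.comp_apply, ← homMap_comp, hιρ, hε']
    simp [hip']
  · refine LinearMap.ext fun α => ?_
    change homMap M ρ (Φ (i (p (Φ.symm (homMap M ι α))))) = α
    rw [← hε', ← LinearMap.comp_apply, ← LinearMap.comp_apply, ← homMap_comp, ← homMap_comp,
      LinearMap.comp_assoc, hει, hρι, homMap_id]
    rfl

/-- A module in `Add(M)` is the sum of the images of all homomorphisms from `M`. If finitely many of
these generate `Hom(M, X)`, their images, which are finitely generated, already cover `X`. -/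
theorem finite_homRight_iff [Module.Finite A M] {Λ : Type w'} {X : Type w} [AddCommGroup X]
    [Module A X] (h : IsSummand A X (Λ →₀ M)) :
    Module.Finite (Module.End A M)ᵐᵒᵖ (HomRight A M X) ↔ Module.Finite A X := by
  constructor
  · intro hfin
    obtain ⟨k, α, hα⟩ := Module.Finite.exists_fin (R := (Module.End A M)ᵐᵒᵖ) (M := HomRight A M X)
    obtain ⟨i, p, hip⟩ := h
    have hle : ∀ β : HomRight A M X, LinearMap.range β.hom ≤ ⨆ j, LinearMap.range (α j).hom := by
      intro β
      have hβ : β ∈ Submodule.span (Module.End A M)ᵐᵒᵖ (Set.range α) := hα ▸ Submodule.mem_top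
      obtain ⟨c, rfl⟩ := (Submodule.mem_span_range_iff_exists_fun _).1 hβ
      rintro _ ⟨m, rfl⟩
      rw [HomRight.hom_sum]
      exact Submodule.sum_mem _ fun j _ => Submodule.mem_iSup_of_mem j ⟨_, rfl⟩
    have htop : (⨆ j, LinearMap.range (α j).hom) = ⊤ := by
      rw [eq_top_iff]
      rintro x -
      have h1 : p (i x) = x := LinearMap.congr_fun hip x
      rw [← h1, ← Finsupp.sum_single (i x), map_finsuppSum]
      exact Submodule.sum_mem _ fun l _ =>
        hle (HomRight.of (p ∘ₗ Finsupp.lsingle l)) ⟨i x l, rfl⟩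
    refine ⟨?_⟩
    rw [← htop]
    refine Submodule.fg_iSup _ fun j => ?_
    rw [← Submodule.map_top]
    exact Submodule.FG.map _ Module.Finite.fg_top
  · intro hfin
    obtain ⟨n, hn⟩ := inAddFin_of_finite h
    exact hn.homRight.finite

end Hom

/-! ### A criterion for a commutative monoid to be free of finite rank -/

section Monoid

variable {V : Type u} [AddCommMonoid V]

/-- `x` is nonzero and in every decomposition `x = a + b` one of the summands is zero. -/
def IsAtomic (x : V) : Prop := x ≠ 0 ∧ ∀ a b, x = a + b → a = 0 ∨ b = 0

/-- The atomic element `x` can be split off any decomposition of a multiple of it. -/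
def IsExchange (x : V) : Prop := ∀ a b c, x + a = b + c →
  (∃ b', b = x + b' ∧ a = b' + c) ∨ ∃ c', c = x + c' ∧ a = b + c'

theorem exists_multiset_sum_eq (ℓ : V → ℕ) (hadd : ∀ x y, ℓ (x + y) = ℓ x + ℓ y)
    (hzero : ∀ x, ℓ x = 0 → x = 0) (x : V) :
    ∃ s : Multiset {x : V // IsAtomic x}, (s.map Subtype.val).sum = x := by
  induction hn : ℓ x using Nat.strong_induction_on generalizing x with
  | _ n ih =>
  by_cases hx : x = 0
  · exact ⟨0, by simp [hx]⟩
  by_cases hat : IsAtomic x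
  · exact ⟨{⟨x, hat⟩}, by simp⟩
  · obtain ⟨a, b, rfl, ha, hb⟩ : ∃ a b, x = a + b ∧ a ≠ 0 ∧ b ≠ 0 := by
      by_contra! hcon
      refine hat ⟨hx, fun a b hab => ?_⟩
      by_contra! h
      exact h.2 (hcon a b hab h.1)
    have ha' : ℓ a ≠ 0 := mt (hzero a) ha
    have hb' : ℓ b ≠ 0 := mt (hzero b) hb
    have h := hadd a b
    obtain ⟨s, hs⟩ := ih (ℓ a) (by omega) a rfl
    obtain ⟨t, ht⟩ := ih (ℓ b) (by omega) b rfl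
    exact ⟨s + t, by simp [hs, ht]⟩

/-- Atomic elements are prime: exchange moves `a` either into the first summand, which then equals
`a` by atomicity, or into the sum of the others, where induction applies. -/
theorem exists_cons_of_add_eq_sum (hunit : ∀ x y : V, x + y = 0 → x = 0)
    (hex : ∀ x : V, IsAtomic x → IsExchange x) (a : {x : V // IsAtomic x})
    (t : Multiset {x : V // IsAtomic x}) (y : V) (h : (a : V) + y = (t.map Subtype.val).sum) :
    ∃ t', t = a ::ₘ t' ∧ y = (t'.map Subtype.val).sum := by
  induction t using Multiset.induction_on generalizing y with
  | empty => exact absurd (hunit _ _ h) a.2.1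
  | cons b t ih =>
    rw [Multiset.map_cons, Multiset.sum_cons] at h
    rcases hex a a.2 _ _ _ h with ⟨b', hb, hy⟩ | ⟨c', hc, hy⟩
    · have hb' : b' = 0 := (b.2.2 _ _ hb).resolve_left a.2.1
      rw [hb', add_zero] at hb
      rw [hb', zero_add] at hy
      exact ⟨t, by rw [Subtype.ext hb], hy⟩
    · obtain ⟨t', rfl, ht'⟩ := ih c' hc.symm
      exact ⟨b ::ₘ t', Multiset.cons_swap b a t', by simp [hy, ht']⟩

/-- A commutative monoid with a length function, in which atomic elements can be exchanged and whose
elements divide the multiples of one element, is finitely generated and free. -/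
theorem exists_addEquiv_finsupp (ℓ : V → ℕ) (hadd : ∀ x y, ℓ (x + y) = ℓ x + ℓ y)
    (hzero : ∀ x, ℓ x = 0 → x = 0) (hex : ∀ x : V, IsAtomic x → IsExchange x) (g : V)
    (hg : ∀ x, ∃ (n : ℕ) (y : V), n • g = x + y) : ∃ n, Nonempty (V ≃+ (Fin n →₀ ℕ)) := by
  classical
  have hunit : ∀ x y : V, x + y = 0 → x = 0 := by
    intro x y hxy
    have h0 : ℓ (0 : V) = 0 := by
      have := hadd 0 0
      rw [add_zero] at this
      omega
    have := hadd x y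
    rw [hxy, h0] at this
    exact hzero x (by omega)
  have hrem := exists_cons_of_add_eq_sum hunit hex
  let φ : Multiset {x : V // IsAtomic x} →+ V :=
    { toFun := fun s => (s.map Subtype.val).sum
      map_zero' := by simp
      map_add' := fun s t => by simp }
  have hcons : ∀ a s, φ (a ::ₘ s) = a + φ s := fun a s => by
    change (Multiset.map Subtype.val (a ::ₘ s)).sum = _
    rw [Multiset.map_cons, Multiset.sum_cons]
    rfl
  have hφ : Function.Bijective φ := by
    refine ⟨fun s t hst => ?_, exists_multiset_sum_eq ℓ hadd hzero⟩
    induction s using Multiset.induction_on generalizing t with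
    | empty =>
      rcases t.empty_or_exists_mem with rfl | ⟨a, ha⟩
      · rfl
      · obtain ⟨t, rfl⟩ := Multiset.exists_cons_of_mem ha
        refine absurd (hunit (a : V) (φ t) ?_) a.2.1
        rw [← hcons, ← hst, map_zero]
    | cons a s ih =>
      obtain ⟨t', rfl, ht'⟩ := hrem a t (φ s) ((hcons a s).symm.trans hst)
      rw [ih t' ht']
  -- Every atomic element divides a multiple of `g`, so it occurs in a fixed factorization of `g`.
  have hfin : Finite {x : V // IsAtomic x} := by
    obtain ⟨s, hs⟩ := exists_multiset_sum_eq ℓ hadd hzero g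
    have hmem : ∀ (a : {x : V // IsAtomic x}) (n : ℕ) (y : V), n • g = a + y → a ∈ s := by
      intro a n y hny
      obtain ⟨t', ht', -⟩ := hrem a (n • s) y (by
        rw [← hny, Multiset.map_nsmul, Multiset.sum_nsmul, hs])
      exact Multiset.mem_of_mem_nsmul (ht' ▸ Multiset.mem_cons_self a t')
    refine Finite.of_injective (β := s.toFinset)
      (fun a => ⟨a, Multiset.mem_toFinset.2 ?_⟩) fun a b hab => by simpa using hab
    obtain ⟨n, y, hny⟩ := hg a
    exact hmem a n y hny
  obtain ⟨n, ⟨e⟩⟩ := Finite.exists_equiv_fin {x : V // IsAtomic x}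
  exact ⟨n, ⟨(AddEquiv.ofBijective φ hφ).symm.trans
    (Multiset.toFinsupp.trans (Finsupp.domCongr e))⟩⟩

end Monoid

/-! ### Krull–Schmidt for modules of finite length -/

section KrullSchmidt

variable {A : Type u} [Ring A]

/-- Fitting's lemma: `X` is the direct sum of kernel and image of a power of `f`, so `f` is either
bijective or nilpotent, and in the second case `g = 1 - f` is a unit. -/
theorem IsIndecomposable.isUnit_or_isUnit_of_add_eq_one {X : Type v} [AddCommGroup X] [Module A X]
    [IsNoetherian A X] [IsArtinian A X] (hX : IsIndecomposable A X) {f g : Module.End A X}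
    (h : f + g = 1) : IsUnit f ∨ IsUnit g := by
  obtain ⟨n, hn1, hn⟩ := ((LinearMap.eventually_isCompl_ker_pow_range_pow f).and
    (Filter.eventually_ge_atTop 1)).exists
  rcases hX.2 _ _ hn1 with h0 | h0
  · left
    have hinj : Function.Injective (f ^ n) := LinearMap.ker_eq_bot.1 h0
    have hu : IsUnit (f ^ n) := (Module.End.isUnit_iff _).2
      (IsArtinian.bijective_of_injective_endomorphism _ hinj)
    exact (isUnit_pow_iff (by omega)).1 hu
  · right
    have hnil : IsNilpotent f := ⟨n, LinearMap.range_eq_bot.1 h0⟩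
    rw [eq_sub_iff_add_eq'.2 h]
    exact hnil.isUnit_one_sub

/-- The kernel of `[r, q] : B × C → X` is `ker r × C` if `r` splits. -/
def kerCoprodEquiv {B C X : Type*} [AddCommGroup B] [Module A B] [AddCommGroup C] [Module A C]
    [AddCommGroup X] [Module A X] (r : B →ₗ[A] X) (q : C →ₗ[A] X) (s : X →ₗ[A] B)
    (hs : ∀ x, r (s x) = x) : LinearMap.ker (r.coprod q) ≃ₗ[A] LinearMap.ker r × C where
  toFun z := (⟨z.1.1 + s (q z.1.2), by
    have h : r z.1.1 + q z.1.2 = 0 := z.2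
    rw [LinearMap.mem_ker, map_add, hs, h]⟩, z.1.2)
  map_add' z z' := by
    ext <;> simp [add_add_add_comm]
  map_smul' c z := by
    ext <;> simp
  invFun y := ⟨(y.1.1 - s (q y.2), y.2), by
    have h : r y.1.1 = 0 := y.1.2
    rw [LinearMap.mem_ker, LinearMap.coprod_apply, map_sub, hs, h]
    abel⟩
  left_inv z := by
    ext <;> simp
  right_inv y := by
    ext <;> simp

/-- The kernel of the first component of an isomorphism onto a product is the second factor. -/
def kerFstEquiv {D X Y : Type*} [AddCommGroup D] [Module A D] [AddCommGroup X] [Module A X]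
    [AddCommGroup Y] [Module A Y] (e : D ≃ₗ[A] X × Y) :
    LinearMap.ker (LinearMap.fst A X Y ∘ₗ e.toLinearMap) ≃ₗ[A] Y where
  toFun z := (e z.1).2
  map_add' z z' := by simp
  map_smul' c z := by simp
  invFun y := ⟨e.symm (0, y), by simp⟩
  left_inv z := by
    have h : (e z.1).1 = 0 := z.2
    refine Subtype.ext (e.injective ?_)
    simp [← h]
  right_inv y := by simp

/-- The invertible composite makes the component `r : B → X` a split epimorphism, and `B'` is its
kernel. The kernel of the projection of `B × C` to `X` is `Y` when computed through `e` and `B' × C`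
when computed through the splitting. -/
theorem exchange_aux {X Y B C : Type v} [AddCommGroup B] [Module A B] [AddCommGroup C] [Module A C]
    [AddCommGroup X] [Module A X] [AddCommGroup Y] [Module A Y] (e : (B × C) ≃ₗ[A] X × Y)
    (h : IsUnit (LinearMap.fst A X Y ∘ₗ e.toLinearMap ∘ₗ LinearMap.inl A B C ∘ₗ
      LinearMap.fst A B C ∘ₗ e.symm.toLinearMap ∘ₗ LinearMap.inl A X Y : Module.End A X)) :
    ∃ B' : Submodule A B, Nonempty (B ≃ₗ[A] X × B') ∧ Nonempty (Y ≃ₗ[A] B' × C) := by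
  obtain ⟨u, hu⟩ := h
  let r : B →ₗ[A] X := LinearMap.fst A X Y ∘ₗ e.toLinearMap ∘ₗ LinearMap.inl A B C
  let q : C →ₗ[A] X := LinearMap.fst A X Y ∘ₗ e.toLinearMap ∘ₗ LinearMap.inr A B C
  let s : X →ₗ[A] B := LinearMap.fst A B C ∘ₗ e.symm.toLinearMap ∘ₗ LinearMap.inl A X Y ∘ₗ
    (↑u⁻¹ : Module.End A X)
  have hs : ∀ x, r (s x) = x := by
    intro x
    have h1 : ((u : Module.End A X) * (↑u⁻¹ : Module.End A X)) x = x := by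
      rw [u.mul_inv]
      rfl
    rw [hu] at h1
    exact h1
  have hq : r.coprod q = LinearMap.fst A X Y ∘ₗ e.toLinearMap := by
    ext z <;> simp [r, q]
  have e1 := kerCoprodEquiv r q s hs
  rw [hq] at e1
  exact ⟨LinearMap.ker r, ⟨(kerProdEquiv r s (LinearMap.ext hs)).trans (LinearEquiv.prodComm ..)⟩,
    ⟨(kerFstEquiv e).symm.trans e1⟩⟩

/-- The identity of `X` is the sum of its two composites through `B` and through `C`, so one of them
is invertible. -/
theorem IsIndecomposable.exchange {X Y B C : Type v} [AddCommGroup B] [Module A B] [AddCommGroup C]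
    [Module A C] [AddCommGroup X] [Module A X] [AddCommGroup Y] [Module A Y] [IsNoetherian A X]
    [IsArtinian A X] (hX : IsIndecomposable A X) (e : (B × C) ≃ₗ[A] X × Y) :
    (∃ B' : Submodule A B, Nonempty (B ≃ₗ[A] X × B') ∧ Nonempty (Y ≃ₗ[A] B' × C)) ∨
    ∃ C' : Submodule A C, Nonempty (C ≃ₗ[A] X × C') ∧ Nonempty (Y ≃ₗ[A] B × C') := by
  let e' := (LinearEquiv.prodComm A C B).trans e
  have h := hX.isUnit_or_isUnit_of_add_eq_one
    (f := LinearMap.fst A X Y ∘ₗ e.toLinearMap ∘ₗ LinearMap.inl A B C ∘ₗ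
      LinearMap.fst A B C ∘ₗ e.symm.toLinearMap ∘ₗ LinearMap.inl A X Y)
    (g := LinearMap.fst A X Y ∘ₗ e'.toLinearMap ∘ₗ LinearMap.inl A C B ∘ₗ
      LinearMap.fst A C B ∘ₗ e'.symm.toLinearMap ∘ₗ LinearMap.inl A X Y) (by
    refine LinearMap.ext fun x => ?_
    have h1 : e ((e.symm (x, 0)).1, 0) + e (0, (e.symm (x, 0)).2) = (x, 0) := by
      rw [← map_add, Prod.mk_add_mk, add_zero, zero_add, Prod.mk.eta, e.apply_symm_apply]
    exact congr_arg Prod.fst h1)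
  rcases h with h | h
  · exact .inl (exchange_aux e h)
  · obtain ⟨C', h1, ⟨h2⟩⟩ := exchange_aux e' h
    exact .inr ⟨C', h1, ⟨h2.trans (LinearEquiv.prodComm ..)⟩⟩

/-- `N^(n+1) ≅ N × N^n`. -/
def finsuppFinSuccEquiv (N : Type v) [AddCommGroup N] [Module A N] (n : ℕ) :
    (Fin (n + 1) →₀ N) ≃ₗ[A] N × (Fin n →₀ N) :=
  (Finsupp.linearEquivFunOnFinite A N (Fin (n + 1))).trans
    ((Fin.consLinearEquiv A (fun _ : Fin (n + 1) => N)).symm.trans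
      (LinearEquiv.prodCongr (LinearEquiv.refl A N)
        (Finsupp.linearEquivFunOnFinite A N (Fin n)).symm))

theorem cls_finsupp_fin (N : Type v) [AddCommGroup N] [Module A N] (n : ℕ) :
    cls (ModuleCat.of A (Fin n →₀ N)) = n • cls (ModuleCat.of A N) := by
  induction n with
  | zero =>
    rw [zero_nsmul, cls_zero]
    exact cls_eq_iff.2 ⟨⟨0, 0, fun _ => Subsingleton.elim _ _, fun _ => rfl⟩⟩
  | succ n ih =>
    rw [succ_nsmul', ← ih, cls_add]
    exact cls_eq_iff.2 ⟨finsuppFinSuccEquiv N n⟩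

theorem cls_eq_zero_iff {X : ModuleCat.{v} A} : cls X = 0 ↔ Subsingleton X := by
  rw [cls_zero, cls_eq_iff]
  constructor
  · rintro ⟨e⟩
    exact e.injective.subsingleton
  · intro h
    exact ⟨⟨0, 0, fun _ => Subsingleton.elim _ _, fun _ => rfl⟩⟩

theorem mem_V_of_isSummand {N : Type v} [AddCommGroup N] [Module A N] {X : ModuleCat.{v} A}
    (h : cls X ∈ V A N) {Y : Type v} [AddCommGroup Y] [Module A Y] (hY : IsSummand A Y X) :
    cls (ModuleCat.of A Y) ∈ V A N := by
  obtain ⟨X', hX', n, hn⟩ := h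
  obtain ⟨e⟩ := cls_eq_iff.1 hX'
  exact ⟨_, rfl, n, hY.trans (hn.of_equiv e)⟩

theorem inAddFin_of_mem_V {N : Type v} [AddCommGroup N] [Module A N] {X : ModuleCat.{v} A}
    (h : cls X ∈ V A N) : InAddFin A N X := by
  obtain ⟨X', hX', n, hn⟩ := h
  obtain ⟨e⟩ := cls_eq_iff.1 hX'
  exact ⟨n, hn.of_equiv e⟩

/-- Krull–Schmidt: for a module `N` of finite length the monoid `V(N)` is finitely generated and
free. -/
theorem exists_V_addEquiv_finsupp (N : Type v) [AddCommGroup N] [Module A N] [IsNoetherian A N]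
    [IsArtinian A N] : ∃ n, Nonempty (V A N ≃+ (Fin n →₀ ℕ)) := by
  have hfl : ∀ X : ModuleCat.{v} A, cls X ∈ V A N → IsNoetherian A X ∧ IsArtinian A X := by
    intro X hX
    obtain ⟨n, i, p, hip⟩ := inAddFin_of_mem_V hX
    have hi : Function.Injective i := Function.LeftInverse.injective (g := p)
      fun x => LinearMap.congr_fun hip x
    let φ := Finsupp.linearEquivFunOnFinite A N (Fin n)
    let j := φ.toLinearMap ∘ₗ i
    have hj : Function.Injective j := φ.injective.comp hi
    exact ⟨isNoetherian_of_injective j hj, isArtinian_of_injective j hj⟩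
  let len : IsoClass.{u, v} A → ℕ∞ := Quotient.lift (fun X : ModuleCat.{v} A => Module.length A X)
    fun _ _ ⟨e⟩ => e.length_eq
  have hlen : ∀ X : ModuleCat.{v} A, len (cls X) = Module.length A X := fun _ => rfl
  have hlentop : ∀ x ∈ V A N, len x ≠ ⊤ := by
    intro x hx
    obtain ⟨X, rfl⟩ := cls_surj x
    obtain ⟨h1, h2⟩ := hfl X hx
    exact Module.length_ne_top
  refine exists_addEquiv_finsupp (fun x : V A N => (len x).toNat) ?_ ?_ ?_
    ⟨cls (ModuleCat.of A N), _, rfl, 1, isSummand_of_equiv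
      (Finsupp.uniqueLinearEquiv A N (0 : Fin 1)).symm⟩ ?_
  · rintro ⟨x, hx⟩ ⟨y, hy⟩
    have h : len (x + y) = len x + len y := by
      obtain ⟨X, rfl⟩ := cls_surj x
      obtain ⟨Y, rfl⟩ := cls_surj y
      exact Module.length_prod A X Y
    change (len (x + y)).toNat = _
    rw [h, ENat.toNat_add (hlentop x hx) (hlentop y hy)]
  · rintro ⟨x, hx⟩ h
    have h0 : len x = 0 := by
      rcases (ENat.toNat_eq_zero.1 h) with h | h
      · exact h
      · exact absurd h (hlentop x hx)
    obtain ⟨X, rfl⟩ := cls_surj x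
    rw [hlen, Module.length_eq_zero_iff] at h0
    exact Subtype.ext (cls_eq_zero_iff.2 h0)
  · rintro ⟨x, hx⟩ hat ⟨a, ha⟩ ⟨b, hb⟩ ⟨c, hc⟩ habc
    obtain ⟨X, rfl⟩ := cls_surj x
    obtain ⟨Y, rfl⟩ := cls_surj a
    obtain ⟨B, rfl⟩ := cls_surj b
    obtain ⟨C, rfl⟩ := cls_surj c
    obtain ⟨h1, h2⟩ := hfl X hx
    -- Both parts of a decomposition of `X` are again in `add(N)`, so being atomic in `V(N)` is the
    -- same as being indecomposable.
    have hX : IsIndecomposable A X := by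
      constructor
      · rw [← not_subsingleton_iff_nontrivial, ← cls_eq_zero_iff]
        exact fun h => hat.1 (Subtype.ext h)
      · intro D D' hD
        let p := Submodule.prodEquivOfIsCompl D D' hD
        have hDm : cls (ModuleCat.of A D) ∈ V A N := mem_V_of_isSummand hx
          ⟨p.toLinearMap ∘ₗ LinearMap.inl A D D', LinearMap.fst A D D' ∘ₗ p.symm.toLinearMap,
            LinearMap.ext fun x => by simp⟩
        have hDm' : cls (ModuleCat.of A D') ∈ V A N := mem_V_of_isSummand hx
          ⟨p.toLinearMap ∘ₗ LinearMap.inr A D D', LinearMap.snd A D D' ∘ₗ p.symm.toLinearMap,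
            LinearMap.ext fun x => by simp⟩
        refine (hat.2 ⟨_, hDm⟩ ⟨_, hDm'⟩ (Subtype.ext (cls_eq_iff.2 ⟨p.symm⟩))).imp ?_ ?_
        · intro h
          exact (Submodule.subsingleton_iff_eq_bot).1 (cls_eq_zero_iff.1 (Subtype.ext_iff.1 h))
        · intro h
          exact (Submodule.subsingleton_iff_eq_bot).1 (cls_eq_zero_iff.1 (Subtype.ext_iff.1 h))
    obtain ⟨e⟩ := cls_eq_iff.1 (Subtype.ext_iff.1 habc)
    rcases hX.exchange e.symm with ⟨B', ⟨e1⟩, ⟨e2⟩⟩ | ⟨C', ⟨e1⟩, ⟨e2⟩⟩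
    · have hB' : cls (ModuleCat.of A B') ∈ V A N := mem_V_of_isSummand hb
        ⟨e1.symm.toLinearMap ∘ₗ LinearMap.inr A X B', LinearMap.snd A X B' ∘ₗ e1.toLinearMap,
          LinearMap.ext fun x => by simp⟩
      exact .inl ⟨⟨_, hB'⟩, Subtype.ext (cls_eq_iff.2 ⟨e1⟩), Subtype.ext (cls_eq_iff.2 ⟨e2⟩)⟩
    · have hC' : cls (ModuleCat.of A C') ∈ V A N := mem_V_of_isSummand hc
        ⟨e1.symm.toLinearMap ∘ₗ LinearMap.inr A X C', LinearMap.snd A X C' ∘ₗ e1.toLinearMap,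
          LinearMap.ext fun x => by simp⟩
      exact .inr ⟨⟨_, hC'⟩, Subtype.ext (cls_eq_iff.2 ⟨e1⟩), Subtype.ext (cls_eq_iff.2 ⟨e2⟩)⟩
  · rintro ⟨x, hx⟩
    obtain ⟨X, rfl⟩ := cls_surj x
    obtain ⟨n, i, p, hip⟩ := inAddFin_of_mem_V hx
    let e := kerProdEquiv p i hip
    have hfin : cls (ModuleCat.of A (Fin n →₀ N)) ∈ V A N :=
      ⟨_, rfl, n, LinearMap.id, LinearMap.id, rfl⟩
    have hker : cls (ModuleCat.of A (LinearMap.ker p)) ∈ V A N := mem_V_of_isSummand hfin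
      ⟨e.symm.toLinearMap ∘ₗ LinearMap.inl A _ X, LinearMap.fst A _ X ∘ₗ e.toLinearMap,
        LinearMap.ext fun x => by simp⟩
    refine ⟨n, ⟨_, hker⟩, Subtype.ext ?_⟩
    change n • cls (ModuleCat.of A N) = _
    rw [← cls_finsupp_fin]
    exact cls_eq_iff.2 ⟨e.trans (LinearEquiv.prodComm ..)⟩

theorem exists_V_op_addEquiv_finsupp (B : Type v) [Ring B] [IsArtinianRing Bᵐᵒᵖ] :
    ∃ n, Nonempty (V Bᵐᵒᵖ B ≃+ (Fin n →₀ ℕ)) := by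
  let e : B ≃ₗ[Bᵐᵒᵖ] Bᵐᵒᵖ := MulOpposite.opLinearEquiv Bᵐᵒᵖ
  have h1 : IsNoetherian Bᵐᵒᵖ B := isNoetherian_of_linearEquiv e.symm
  have h2 : IsArtinian Bᵐᵒᵖ B := isArtinian_of_linearEquiv e.symm
  exact exists_V_addEquiv_finsupp B

end KrullSchmidt

/-! ### Gluing reductions modulo `J` from localizations -/

section Fraction

variable {R : Type*} [CommRing R] {T : Type*} [Ring T] [Algebra R T]
  {P Q L Y : Type*} [AddCommGroup P] [Module T P] [Module R P] [IsScalarTower R T P]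
  [AddCommGroup Q] [Module T Q] [Module R Q] [IsScalarTower R T Q]
  [AddCommGroup L] [Module T L] [Module R L] [IsScalarTower R T L]
  [AddCommGroup Y] [Module T Y] [Module R Y] [IsScalarTower R T Y]

/-- `u` becomes an isomorphism after inverting `Γ`. -/
structure IsFractionMap (Γ : Submonoid R) (u : P →ₗ[T] L) : Prop where
  surj : ∀ l, ∃ r ∈ Γ, ∃ p, r • l = u p
  ker : ∀ p, u p = 0 → ∃ r ∈ Γ, r • p = 0

/-- The graph of the map `P → e Y` induced by `ρ : Q → Y` and a common localization of `P`
and `Q`. -/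
def FractionGraph (Γ : Submonoid R) (e : R) (u : P →ₗ[T] L) (v : Q →ₗ[T] L) (ρ : Q →ₗ[T] Y) (p : P)
    (y : Y) : Prop :=
  e • y = y ∧ ∃ r ∈ Γ, ∃ q, r • u p = v q ∧ r • y = e • ρ q

variable {Γ : Submonoid R} {e : R} {u : P →ₗ[T] L} {v : Q →ₗ[T] L} {ρ : Q →ₗ[T] Y}

-- Two choices of denominators and numerators become equal after multiplication by an element of
-- `Γ`, and such elements act invertibly on `e Y`.
omit [Module R P] [IsScalarTower R T P] in
theorem FractionGraph.unique (hv : IsFractionMap Γ v)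
    (hinv : ∀ r ∈ Γ, ∃ a : R, ∀ y : Y, (a * r * e) • y = e • y) {p : P} {y y' : Y}
    (h : FractionGraph Γ e u v ρ p y) (h' : FractionGraph Γ e u v ρ p y') : y = y' := by
  obtain ⟨hy, r, hr, q, hq, hrq⟩ := h
  obtain ⟨hy', r', hr', q', hq', hrq'⟩ := h'
  obtain ⟨t, ht, htq⟩ := hv.ker (r' • q - r • q') (by
    rw [map_sub, v.map_smul_of_tower, v.map_smul_of_tower, ← hq, ← hq', smul_comm r r', sub_self])
  obtain ⟨a, ha⟩ := hinv (t * (r' * r)) (mul_mem ht (mul_mem hr' hr))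
  have h1 : t • r' • ρ q = t • r • ρ q' := by
    have := congr_arg ρ htq
    rw [ρ.map_smul_of_tower, map_sub, ρ.map_smul_of_tower, ρ.map_smul_of_tower, map_zero, smul_sub,
      sub_eq_zero] at this
    exact this
  have h2 : (t * (r' * r)) • y = (t * (r' * r)) • y' := by
    calc (t * (r' * r)) • y = t • r' • r • y := by rw [mul_smul, mul_smul]
      _ = e • t • r' • ρ q := by rw [hrq, smul_comm r' e, smul_comm t e]
      _ = t • r • r' • y' := by rw [h1, hrq', smul_comm r e, smul_comm t e]
      _ = (t * (r' * r)) • y' := by rw [mul_comm r' r, mul_smul, mul_smul]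
  rw [← hy, ← hy', ← ha y, ← ha y', mul_right_comm, mul_smul (a * e), mul_smul (a * e), h2]

omit [Module R P] [IsScalarTower R T P] in
/-- The map `P → e Y` induced by `ρ : Q → Y` and a common localization of `P` and `Q`. -/
theorem exists_fractionMap (hv : IsFractionMap Γ v)
    (hinv : ∀ r ∈ Γ, ∃ a : R, ∀ y : Y, (a * r * e) • y = e • y)
    (hee : ∀ y : Y, (e * e) • y = e • y) :
    ∃ g : P →ₗ[T] Y, ∀ p, FractionGraph Γ e u v ρ p (g p) := by
  have hex : ∀ p, ∃ y, FractionGraph Γ e u v ρ p y := by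
    intro p
    obtain ⟨r, hr, q, hq⟩ := hv.surj (u p)
    obtain ⟨a, ha⟩ := hinv r hr
    refine ⟨a • e • ρ q, ?_, r, hr, q, hq, ?_⟩
    · rw [smul_comm e a, ← mul_smul e e, hee]
    · conv_rhs => rw [← ha (ρ q)]
      rw [← mul_smul, ← mul_smul, mul_comm r a, mul_right_comm]
  choose g hg using hex
  refine ⟨⟨⟨g, fun p p' => FractionGraph.unique hv hinv (hg _) ?_⟩, fun s p =>
    FractionGraph.unique hv hinv (hg _) ?_⟩, hg⟩
  · obtain ⟨hy, r, hr, q, hq, hrq⟩ := hg p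
    obtain ⟨hy', r', hr', q', hq', hrq'⟩ := hg p'
    refine ⟨by rw [smul_add, hy, hy'], r * r', mul_mem hr hr', r' • q + r • q', ?_, ?_⟩
    · rw [map_add, map_add, v.map_smul_of_tower, v.map_smul_of_tower, ← hq, ← hq', smul_add,
        smul_smul, smul_smul, mul_comm r']
    · rw [map_add, ρ.map_smul_of_tower, ρ.map_smul_of_tower, smul_add, smul_add, smul_comm e r',
        smul_comm e r, ← hrq, ← hrq', smul_smul, smul_smul, mul_comm r']
  · obtain ⟨hy, r, hr, q, hq, hrq⟩ := hg p
    refine ⟨?_, r, hr, s • q, ?_, ?_⟩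
    · change e • s • g p = s • g p
      rw [smul_comm, hy]
    · rw [map_smul, map_smul, ← hq, smul_comm]
    · change r • s • g p = _
      rw [map_smul, smul_comm, hrq, smul_comm]

omit [Module R Q] [IsScalarTower R T Q] in
theorem exists_mem_smul_top_of_isFractionMap (hu : IsFractionMap Γ u) {J : Ideal T} {q : Q}
    (hq : q ∈ J • (⊤ : Submodule T Q)) :
    ∃ r ∈ Γ, ∃ p ∈ J • (⊤ : Submodule T P), r • v q = u p := by
  refine Submodule.smul_induction_on hq (fun j hj q _ => ?_) fun q q' h h' => ?_
  · obtain ⟨r, hr, p, hp⟩ := hu.surj (v q)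
    exact ⟨r, hr, j • p, Submodule.smul_mem_smul hj Submodule.mem_top, by
      rw [map_smul, map_smul, ← hp, smul_comm]⟩
  · obtain ⟨r, hr, p, hpJ, hp⟩ := h
    obtain ⟨r', hr', p', hpJ', hp'⟩ := h'
    refine ⟨r * r', mul_mem hr hr', r' • p + r • p', add_mem ?_ ?_, ?_⟩
    · exact Submodule.smul_of_tower_mem _ r' hpJ
    · exact Submodule.smul_of_tower_mem _ r hpJ'
    · rw [map_add, map_add, u.map_smul_of_tower, u.map_smul_of_tower, ← hp, ← hp', smul_add,
        smul_smul, smul_smul, mul_comm r']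

/-- Modules which become isomorphic after localizations that cover the support of `T / J` have
isomorphic reductions modulo `J`. -/
theorem exists_surjective_of_isFractionMap {J : Ideal T} [J.IsTwoSided] {ι : Type*} [Fintype ι]
    {e : ι → R} {Γ : ι → Submonoid R}
    (hsum : algebraMap R T (1 - ∑ i, e i) ∈ J)
    (horth : ∀ i j, i ≠ j → algebraMap R T (e i * e j) ∈ J)
    (hinv : ∀ i, ∀ r ∈ Γ i, ∃ a, algebraMap R T (a * r * e i - e i) ∈ J)
    {L : ι → Type*} [∀ i, AddCommGroup (L i)] [∀ i, Module T (L i)] [∀ i, Module R (L i)]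
    [∀ i, IsScalarTower R T (L i)] {u : ∀ i, P →ₗ[T] L i} {v : ∀ i, Q →ₗ[T] L i}
    (hu : ∀ i, IsFractionMap (Γ i) (u i)) (hv : ∀ i, IsFractionMap (Γ i) (v i)) (ρ : Q →ₗ[T] Y)
    (hρ : Function.Surjective ρ) (hker : LinearMap.ker ρ = J • (⊤ : Submodule T Q)) :
    ∃ g : P →ₗ[T] Y, Function.Surjective g ∧ LinearMap.ker g = J • (⊤ : Submodule T P) := by
  classical
  have hJ : ∀ j ∈ J, ∀ y : Y, j • y = 0 := by
    intro j hj y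
    obtain ⟨q, rfl⟩ := hρ y
    rw [← map_smul, ← LinearMap.mem_ker, hker]
    exact Submodule.smul_mem_smul hj Submodule.mem_top
  have hR : ∀ r : R, algebraMap R T r ∈ J → ∀ y : Y, r • y = 0 := fun r hr y => by
    rw [← algebraMap_smul T r y, hJ _ hr]
  have hsumY : ∀ y : Y, ∑ i, e i • y = y := fun y => by
    have := hR _ hsum y
    rw [sub_smul, one_smul, Finset.sum_smul, sub_eq_zero] at this
    exact this.symm
  have horthY : ∀ i j, i ≠ j → ∀ y : Y, e i • e j • y = 0 := fun i j hij y => by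
    rw [smul_smul, hR _ (horth i j hij)]
  -- Only the action on `Y` matters: as `J` kills `Y`, the `e i` act there as orthogonal idempotents
  -- with sum one.
  have heeY : ∀ i, ∀ y : Y, (e i * e i) • y = e i • y := fun i y => by
    conv_rhs => rw [← hsumY (e i • y)]
    rw [Finset.sum_eq_single i (fun j _ hj => horthY j i hj y) (by simp), smul_smul]
  have hinvY : ∀ i, ∀ r ∈ Γ i, ∃ a : R, ∀ y : Y, (a * r * e i) • y = e i • y := by
    intro i r hr
    obtain ⟨a, ha⟩ := hinv i r hr
    refine ⟨a, fun y => ?_⟩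
    have := hR _ ha y
    rwa [sub_smul, sub_eq_zero] at this
  -- Each localization produces the component of the desired map in `e i • Y`, and the map is the
  -- sum of these components.
  choose g hg using fun i => exists_fractionMap (u := u i) (ρ := ρ) (hv i) (hinvY i) (heeY i)
  have hgg : ∀ i p, e i • g i p = g i p := fun i p => (hg i p).1
  have hgo : ∀ i j, i ≠ j → ∀ p, e i • g j p = 0 := fun i j hij p => by
    rw [← hgg j p, horthY i j hij]
  have hgsum : ∀ p, (∑ i, g i) p = ∑ i, g i p := fun p => LinearMap.sum_apply _ _ _
  have hproj : ∀ i p, e i • (∑ i, g i) p = g i p := fun i p => by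
    rw [hgsum, Finset.smul_sum, Finset.sum_eq_single i (fun j _ hj => hgo i j hj.symm p) (by simp),
      hgg]
  refine ⟨∑ i, g i, fun y => ?_, le_antisymm (fun p hp => ?_) ?_⟩
  · obtain ⟨q, rfl⟩ := hρ y
    have hloc : ∀ i, ∃ p, (∑ i, g i) p = e i • ρ q := by
      intro i
      obtain ⟨r, hr, p, hp⟩ := (hu i).surj (v i q)
      obtain ⟨a, ha⟩ := hinvY i r hr
      refine ⟨a • e i • p, ?_⟩
      rw [LinearMap.map_smul_of_tower, LinearMap.map_smul_of_tower, hproj]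
      have h1 : g i p = r • e i • ρ q := by
        refine FractionGraph.unique (hv i) (hinvY i) (hg i p) ⟨?_, 1, one_mem _, r • q, ?_, ?_⟩
        · rw [smul_comm, ← mul_smul (e i) (e i), heeY]
        · rw [one_smul, LinearMap.map_smul_of_tower, hp]
        · rw [one_smul, LinearMap.map_smul_of_tower, smul_comm]
      rw [h1, ← mul_smul, ← mul_smul, ha]
    choose p hp using hloc
    refine ⟨∑ i, p i, ?_⟩
    rw [map_sum, Finset.sum_congr rfl fun i _ => hp i, hsumY]
  -- If the `i`-th component of the image of `p` is zero, then clearing denominators puts an element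
  -- of `Γ i` times `e i • p` into `J P`. That element is invertible on `e i` modulo `J`, so it can
  -- be removed.
  · have hei : ∀ i, e i • p ∈ J • (⊤ : Submodule T P) := by
      intro i
      have hg0 : g i p = 0 := by rw [← hproj, LinearMap.mem_ker.1 hp, smul_zero]
      obtain ⟨-, r, hr, q, hq, hrq⟩ := hg i p
      rw [hg0, smul_zero, ← LinearMap.map_smul_of_tower, eq_comm, ← LinearMap.mem_ker, hker] at hrq
      obtain ⟨r', hr', p', hpJ', hp'⟩ := exists_mem_smul_top_of_isFractionMap (v := v i) (hu i) hrq
      obtain ⟨t, ht, htp⟩ := (hu i).ker ((r' * r) • e i • p - p') (by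
        rw [map_sub, LinearMap.map_smul_of_tower, LinearMap.map_smul_of_tower, mul_smul, ← hp',
          LinearMap.map_smul_of_tower, ← hq, smul_comm r, sub_self])
      obtain ⟨a, ha⟩ := hinv i (t * (r' * r)) (mul_mem ht (mul_mem hr' hr))
      have h1 : (t * (r' * r)) • e i • p ∈ J • (⊤ : Submodule T P) := by
        rw [mul_smul, ← sub_add_cancel ((r' * r) • e i • p) p', smul_add, htp, zero_add]
        exact Submodule.smul_of_tower_mem _ t hpJ'
      have h2 : (a * (t * (r' * r)) * e i - e i) • p ∈ J • (⊤ : Submodule T P) := by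
        rw [← algebraMap_smul T]
        exact Submodule.smul_mem_smul ha Submodule.mem_top
      rw [sub_smul, mul_smul, mul_smul] at h2
      exact (Submodule.sub_mem_iff_right _ (Submodule.smul_of_tower_mem _ a h1)).1 h2
    have h1 : (1 - ∑ i, e i) • p ∈ J • (⊤ : Submodule T P) := by
      rw [← algebraMap_smul T]
      exact Submodule.smul_mem_smul hsum Submodule.mem_top
    rw [sub_smul, one_smul, Finset.sum_smul] at h1
    exact (Submodule.sub_mem_iff_left _ (Submodule.sum_mem _ fun i _ => hei i)).1 h1
  · refine Submodule.smul_le.2 fun j hj p _ => ?_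
    rw [LinearMap.mem_ker, map_smul, hJ j hj]

end Fraction

section HomFraction

variable {R : Type u} [CommRing R] {M : Type v} [AddCommGroup M] [Module R M]

instance (X : Type w) [AddCommGroup X] [Module R X] : Module R (HomRight R M X) :=
  Module.compHom _ (algebraMap R (Module.End R M)ᵐᵒᵖ)

instance (X : Type w) [AddCommGroup X] [Module R X] :
    IsScalarTower R (Module.End R M)ᵐᵒᵖ (HomRight R M X) :=
  .of_algebraMap_smul fun _ _ => rfl

theorem HomRight.hom_smul_base {X : Type w} [AddCommGroup X] [Module R X] (r : R)
    (α : HomRight R M X) (m : M) : (r • α).hom m = r • α.hom m :=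
  α.hom.map_smul r m

/-- For finitely presented `M`, homomorphisms into a localization lift after multiplication by a
denominator, and `Hom(M, -)` detects zero up to a denominator. -/
theorem isFractionMap_homMap [Module.FinitePresentation R M] (Γ : Submonoid R) {X : Type w}
    [AddCommGroup X] [Module R X] {Z : Type w'} [AddCommGroup Z] [Module R Z] (f : X →ₗ[R] Z)
    [IsLocalizedModule Γ f] : IsFractionMap Γ (homMap M f) where
  surj l := by
    obtain ⟨h, s, hs⟩ := Module.FinitePresentation.exists_lift_of_isLocalizedModule Γ f l.hom
    refine ⟨s, s.2, .of h, HomRight.ext fun m => ?_⟩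
    rw [HomRight.hom_smul_base]
    exact (LinearMap.congr_fun hs m).symm
  ker p hp := by
    obtain ⟨s, hs⟩ := Module.Finite.exists_smul_of_comp_eq_of_isLocalizedModule Γ f p.hom 0
      (LinearMap.ext fun m => by
        rw [LinearMap.comp_zero]
        exact LinearMap.congr_fun hp m)
    refine ⟨s, s.2, HomRight.ext fun m => ?_⟩
    rw [HomRight.hom_smul_base]
    exact (LinearMap.congr_fun hs m).trans (by simp; rfl)

end HomFraction

/-! ### Trace ideals and the maps `ι_I` -/

section Trace

variable {S : Type v} [Ring S] {z : S}

theorem apply_mem_traceIdeal {P : Type v} [AddCommGroup P] [Module Sᵐᵒᵖ P] (f : P →ₗ[Sᵐᵒᵖ] S)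
    (p : P) : f p ∈ traceIdeal S P :=
  Submodule.subset_span ⟨f, p, rfl⟩

/-- The dual basis gives `f x = ∑ f (p e_l) * x_l`, and both factors are values of homomorphisms
from `P` to `S`. -/
theorem isIdempotentElem_traceIdeal {P : Type v} [AddCommGroup P] [Module Sᵐᵒᵖ P]
    (hPc : CountablyGenerated Sᵐᵒᵖ P) (hPp : Module.Projective Sᵐᵒᵖ P) :
    IsIdempotentElem (traceIdeal S P) := by
  refine le_antisymm Ideal.mul_le_left (Submodule.span_le.2 ?_)
  rintro _ ⟨f, x, rfl⟩
  obtain ⟨i, p, hip⟩ := isSummand_nat_of_projective hPc hPp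
  have h1 : p (i x) = x := LinearMap.congr_fun hip x
  rw [← h1, ← Finsupp.sum_single (i x), map_finsuppSum, map_finsuppSum]
  refine Submodule.sum_mem _ fun l _ => ?_
  dsimp only
  have h2 : f (p (Finsupp.single l (i x l))) = f (p (Finsupp.single l 1)) * unop (i x l) := by
    rw [← Finsupp.smul_single_one, map_smul, map_smul]
    rfl
  rw [h2]
  let e : S ≃ₗ[Sᵐᵒᵖ] Sᵐᵒᵖ := MulOpposite.opLinearEquiv Sᵐᵒᵖ
  exact Ideal.mul_mem_mul (apply_mem_traceIdeal f _)
    (apply_mem_traceIdeal (e.symm.toLinearMap ∘ₗ Finsupp.lapply l ∘ₗ i) x)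

theorem unop_mem_of_mem_smul_top {I : Ideal S} [I.IsTwoSided] {s : S}
    (hs : s ∈ opIdeal I • (⊤ : Submodule Sᵐᵒᵖ S)) : s ∈ I := by
  refine Submodule.smul_induction_on hs (fun t ht s _ => ?_) fun _ _ => add_mem
  exact I.mul_mem_left s (mem_opIdeal.1 ht)

theorem traceIdeal_eq {I : Ideal S} [I.IsTwoSided] {W : Type v} [AddCommGroup W] [Module Sᵐᵒᵖ W]
    (hIW : opIdeal I • (⊤ : Submodule Sᵐᵒᵖ W) = ⊤) (hW : opIdeal I ≤ traceIn Sᵐᵒᵖ W Sᵐᵒᵖ) :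
    traceIdeal S W = I := by
  refine le_antisymm (Submodule.span_le.2 ?_) fun s hs => ?_
  · rintro _ ⟨f, x, rfl⟩
    exact unop_mem_of_mem_smul_top (map_mem_smul_top f (by rw [hIW]; exact Submodule.mem_top))
  · let e : S ≃ₗ[Sᵐᵒᵖ] Sᵐᵒᵖ := MulOpposite.opLinearEquiv Sᵐᵒᵖ
    have h1 : op s ∈ traceIn Sᵐᵒᵖ W Sᵐᵒᵖ := hW (mem_opIdeal.2 hs)
    refine Submodule.iSup_induction (motive := fun t => unop t ∈ traceIdeal S W) _ h1 ?_ ?_ ?_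
    · rintro φ _ ⟨y, rfl⟩
      exact apply_mem_traceIdeal (e.symm.toLinearMap ∘ₗ φ) y
    · exact zero_mem _
    · exact fun _ _ => add_mem

/-- Traces of projectives are idempotent by the dual basis, and Whitehead's construction realizes
every idempotent ideal. -/
theorem IsOrderLike.traceIdeals_eq (hS : IsOrderLike S z) :
    traceIdeals S = {I : Ideal S | I.IsTwoSided ∧ IsIdempotentElem I} := by
  ext I
  constructor
  · rintro ⟨P, hPc, hPp, rfl⟩
    exact ⟨inferInstance, isIdempotentElem_traceIdeal hPc hPp⟩
  · rintro ⟨_, hI⟩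
    obtain ⟨W, hWc, hWp, hIW, hW⟩ := hS.exists_trace I hI
    exact ⟨W, hWc, hWp, traceIdeal_eq hIW hW⟩

theorem NonzeroTraceIdeal.ne_bot (I : NonzeroTraceIdeal S) : I.ideal ≠ ⊥ := I.2.2

theorem NonzeroTraceIdeal.isIdempotentElem (I : NonzeroTraceIdeal S) :
    IsIdempotentElem I.ideal := by
  obtain ⟨_, ⟨P, hPc, hPp, rfl⟩, _⟩ := I
  exact isIdempotentElem_traceIdeal hPc hPp

theorem IsOrderLike.exists_pow_mem (hS : IsOrderLike S z) (I : Ideal S) [I.IsTwoSided]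
    (hI : IsIdempotentElem I) (hne : I ≠ ⊥) : ∃ k, z ^ k ∈ I :=
  hS.pow_mem I I inferInstance inferInstance hne hI.ge

end Trace

section Iota

variable {S : Type v} [Ring S] {z : S}

theorem nonempty_equiv_of_ker_eq {T : Type*} [Ring T] {T' : Type*} [Ring T'] {σ : T →+* T'}
    (hσ : Function.Surjective σ) {P P' P'' : Type*} [AddCommGroup P] [Module T P] [AddCommGroup P']
    [Module T' P'] [AddCommGroup P''] [Module T' P''] (π : P →ₛₗ[σ] P') (π' : P →ₛₗ[σ] P'')
    (hπ : Function.Surjective π) (hπ' : Function.Surjective π')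
    (hker : LinearMap.ker π = LinearMap.ker π') : Nonempty (P' ≃ₗ[T'] P'') := by
  have h1 : ∀ x y, π x = π y ↔ π' x = π' y := fun x y => by
    rw [← sub_eq_zero, ← map_sub, ← LinearMap.mem_ker, hker, LinearMap.mem_ker, map_sub,
      sub_eq_zero]
  choose g hg using hπ
  have h2 : ∀ x, π' (g (π x)) = π' x := fun x => (h1 _ _).1 (hg _)
  let f : P' →ₗ[T'] P'' :=
    { toFun := fun x => π' (g x)
      map_add' := fun x y => by
        rw [← map_add, ← h1, map_add, hg, hg, hg]
      map_smul' := fun c x => by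
        obtain ⟨c, rfl⟩ := hσ c
        rw [RingHom.id_apply, ← map_smulₛₗ, ← h1, map_smulₛₗ, hg, hg] }
  refine ⟨LinearEquiv.ofBijective f ⟨fun x y hxy => ?_, fun y => ?_⟩⟩
  · have := (h1 _ _).2 hxy
    rwa [hg, hg] at this
  · obtain ⟨x, rfl⟩ := hπ' y
    exact ⟨π x, h2 x⟩

theorem smul_top_map_equiv {T : Type*} [Ring T] {P Q : Type*} [AddCommGroup P] [Module T P]
    [AddCommGroup Q] [Module T Q] (J : Ideal T) (e : P ≃ₗ[T] Q) (x : P) :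
    e x ∈ J • (⊤ : Submodule T Q) ↔ x ∈ J • (⊤ : Submodule T P) :=
  ⟨fun h => by simpa using map_mem_smul_top e.symm.toLinearMap h,
    fun h => map_mem_smul_top e.toLinearMap h⟩

theorem IsBigLeft.of_equiv {T : Type v} [Ring T] {J : Ideal T} {P Q : Type v} [AddCommGroup P]
    [Module T P] [AddCommGroup Q] [Module T Q] (e : P ≃ₗ[T] Q) (hP : IsBigLeft J P) :
    IsBigLeft J Q := by
  intro X hX hX' hJX
  obtain ⟨f, hf⟩ := hP X hX hX' hJX
  exact ⟨f ∘ₗ e.symm.toLinearMap, hf.comp e.symm.surjective⟩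

theorem IsBigLeft.prod {T : Type v} [Ring T] {J : Ideal T} {P : Type v} [AddCommGroup P]
    [Module T P] (hP : IsBigLeft J P) (Q : Type v) [AddCommGroup Q] [Module T Q] :
    IsBigLeft J (P × Q) := by
  intro X hX hX' hJX
  obtain ⟨f, hf⟩ := hP X hX hX' hJX
  exact ⟨f ∘ₗ LinearMap.fst T P Q, hf.comp Prod.fst_surjective⟩

theorem mem_smul_top_prod {T : Type*} [Ring T] {J : Ideal T} {P Q : Type*} [AddCommGroup P]
    [Module T P] [AddCommGroup Q] [Module T Q] (x : P × Q) :
    x ∈ J • (⊤ : Submodule T (P × Q)) ↔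
      x.1 ∈ J • (⊤ : Submodule T P) ∧ x.2 ∈ J • (⊤ : Submodule T Q) := by
  refine ⟨fun h => ⟨map_mem_smul_top (LinearMap.fst T P Q) h,
    map_mem_smul_top (LinearMap.snd T P Q) h⟩, fun h => ?_⟩
  have : x = LinearMap.inl T P Q x.1 + LinearMap.inr T P Q x.2 := by simp
  rw [this]
  exact add_mem (map_mem_smul_top _ h.1) (map_mem_smul_top _ h.2)

theorem mem_V_op_iff (B : Type v) [Ring B] (X : ModuleCat.{v} Bᵐᵒᵖ) :
    cls X ∈ V Bᵐᵒᵖ B ↔ ∃ n : ℕ, IsSummand Bᵐᵒᵖ X (Fin n →₀ Bᵐᵒᵖ) := by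
  let e : B ≃ₗ[Bᵐᵒᵖ] Bᵐᵒᵖ := MulOpposite.opLinearEquiv Bᵐᵒᵖ
  constructor
  · intro h
    obtain ⟨n, hn⟩ := inAddFin_of_mem_V h
    exact ⟨n, hn.trans (isSummand_of_equiv (Finsupp.mapRange.linearEquiv e))⟩
  · rintro ⟨n, hn⟩
    exact ⟨X, rfl, n, hn.trans (isSummand_of_equiv (Finsupp.mapRange.linearEquiv e.symm))⟩

theorem mem_VStar_op {P : ModuleCat.{v} Sᵐᵒᵖ} (hPc : CountablyGenerated Sᵐᵒᵖ P)
    (hPp : Module.Projective Sᵐᵒᵖ P) : cls P ∈ VStar Sᵐᵒᵖ S := by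
  let e : Sᵐᵒᵖ ≃ₗ[Sᵐᵒᵖ] S := (MulOpposite.opLinearEquiv Sᵐᵒᵖ).symm
  exact ⟨P, rfl, hPc, ULift.{v} ℕ, (isSummand_nat_of_projective hPc hPp).trans
    (isSummand_of_equiv (Finsupp.lcongr Equiv.ulift.symm e))⟩

/-- The description of `IotaGraph` on representatives. -/
theorem iotaGraph_cls_iff {I : Ideal S} [I.IsTwoSided] {P' : ModuleCat.{v} (S ⧸ I)ᵐᵒᵖ}
    {P : ModuleCat.{v} Sᵐᵒᵖ} : IotaGraph I (cls P') (cls P) ↔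
      (∃ n : ℕ, IsSummand (S ⧸ I)ᵐᵒᵖ P' (Fin n →₀ (S ⧸ I)ᵐᵒᵖ)) ∧
      CountablyGenerated Sᵐᵒᵖ P ∧ Module.Projective Sᵐᵒᵖ P ∧ IsBigLeft (opIdeal I) P ∧
      ∃ π : P →ₛₗ[RingHom.op (Ideal.Quotient.mk I)] P', Function.Surjective π ∧
        LinearMap.ker π = opIdeal I • (⊤ : Submodule Sᵐᵒᵖ P) := by
  rw [IotaGraph, mem_V_op_iff]
  refine and_congr_right fun _ => ⟨?_, ?_⟩
  · rintro ⟨Q', Q, hQ', hQ, hQc, hQp, hQb, π, hπ, hker⟩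
    obtain ⟨e'⟩ := cls_eq_iff.1 hQ'
    obtain ⟨e⟩ := cls_eq_iff.1 hQ
    rw [isBig_iff] at hQb
    rw [mulIdeal_eq] at hker
    refine ⟨hQc.of_surjective e.toLinearMap e.surjective, Module.Projective.of_equiv e,
      hQb.of_equiv e, (e'.toLinearMap.comp π).comp e.symm.toLinearMap, ?_, ?_⟩
    · exact e'.surjective.comp (hπ.comp e.symm.surjective)
    · ext x
      rw [← smul_top_map_equiv _ e.symm, ← hker, LinearMap.mem_ker, LinearMap.mem_ker]
      exact e'.map_eq_zero_iff
  · rintro ⟨hPc, hPp, hPb, π, hπ, hker⟩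
    exact ⟨P', P, rfl, rfl, hPc, hPp, (isBig_iff _ _).2 hPb, π, hπ, by rw [mulIdeal_eq, hker]⟩

theorem IsOrderLike.exists_iotaGraph (hS : IsOrderLike S z) (I : Ideal S) [I.IsTwoSided]
    (hI : IsIdempotentElem I) {y : IsoClass.{v, v} (S ⧸ I)ᵐᵒᵖ}
    (hy : y ∈ V (S ⧸ I)ᵐᵒᵖ (S ⧸ I)) : ∃ x, IotaGraph I y x := by
  obtain ⟨P', rfl⟩ := cls_surj y
  obtain ⟨n, hn⟩ := (mem_V_op_iff _ _).1 hy
  obtain ⟨P, hP⟩ := hS.exists_big I hI (RingHom.op (Ideal.Quotient.mk I)) (op_mk_surjective I)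
    rfl hn
  exact ⟨cls P, iotaGraph_cls_iff.2 ⟨⟨n, hn⟩, hP⟩⟩

theorem IsOrderLike.iotaGraph_unique (hS : IsOrderLike S z) {I : Ideal S} [I.IsTwoSided]
    (hI : IsIdempotentElem I) {y : IsoClass.{v, v} (S ⧸ I)ᵐᵒᵖ} {x x' : IsoClass.{v, v} Sᵐᵒᵖ}
    (h : IotaGraph I y x) (h' : IotaGraph I y x') : x = x' := by
  obtain ⟨P', rfl⟩ := cls_surj y
  obtain ⟨P, rfl⟩ := cls_surj x
  obtain ⟨Q, rfl⟩ := cls_surj x'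
  obtain ⟨-, hPc, hPp, hPb, π, hπ, hker⟩ := iotaGraph_cls_iff.1 h
  obtain ⟨-, hQc, hQp, hQb, π', hπ', hker'⟩ := iotaGraph_cls_iff.1 h'
  exact cls_eq_iff.2 (hS.nonempty_equiv I hI hPb hQb hPc hPp hQc hQp π π' hπ hπ' hker hker')

theorem IotaGraph.injective {I : Ideal S} [I.IsTwoSided]
    {y y' : IsoClass.{v, v} (S ⧸ I)ᵐᵒᵖ} {x : IsoClass.{v, v} Sᵐᵒᵖ}
    (h : IotaGraph I y x) (h' : IotaGraph I y' x) : y = y' := by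
  obtain ⟨P', rfl⟩ := cls_surj y
  obtain ⟨P'', rfl⟩ := cls_surj y'
  obtain ⟨P, rfl⟩ := cls_surj x
  obtain ⟨-, -, -, -, π, hπ, hker⟩ := iotaGraph_cls_iff.1 h
  obtain ⟨-, -, -, -, π', hπ', hker'⟩ := iotaGraph_cls_iff.1 h'
  exact cls_eq_iff.2 (nonempty_equiv_of_ker_eq (op_mk_surjective I) π π' hπ hπ'
    (hker.trans hker'.symm))

theorem IotaGraph.add {I : Ideal S} [I.IsTwoSided]
    {y y' : IsoClass.{v, v} (S ⧸ I)ᵐᵒᵖ} {x x' : IsoClass.{v, v} Sᵐᵒᵖ}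
    (h : IotaGraph I y x) (h' : IotaGraph I y' x') : IotaGraph I (y + y') (x + x') := by
  have hV := add_mem h.1 h'.1
  obtain ⟨P', rfl⟩ := cls_surj y
  obtain ⟨Q', rfl⟩ := cls_surj y'
  obtain ⟨P, rfl⟩ := cls_surj x
  obtain ⟨Q, rfl⟩ := cls_surj x'
  obtain ⟨-, hPc, hPp, hPb, π, hπ, hker⟩ := iotaGraph_cls_iff.1 h
  obtain ⟨-, hQc, hQp, hQb, π', hπ', hker'⟩ := iotaGraph_cls_iff.1 h'
  rw [cls_add] at hV
  rw [cls_add, cls_add]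
  refine iotaGraph_cls_iff.2 ⟨(mem_V_op_iff _ _).1 hV, hPc.prod hQc,
    inferInstanceAs (Module.Projective Sᵐᵒᵖ (P × Q)), hPb.prod Q,
    ⟨⟨Prod.map π π', fun x y => ?_⟩, fun c x => ?_⟩, ?_, ?_⟩
  · exact Prod.ext (map_add π x.1 y.1) (map_add π' x.2 y.2)
  · exact Prod.ext (map_smulₛₗ π c x.1) (map_smulₛₗ π' c x.2)
  · exact hπ.prodMap hπ'
  · ext x
    refine Iff.trans ?_ (mem_smul_top_prod x).symm
    rw [← hker, ← hker']
    exact Prod.ext_iff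

theorem IsOrderLike.le_of_surjective (hS : IsOrderLike S z) {I I' : Ideal S} [I.IsTwoSided]
    [I'.IsTwoSided] (hI : IsIdempotentElem I) {P : Type v} [AddCommGroup P] [Module Sᵐᵒᵖ P]
    (hP : IsBigLeft (opIdeal I) P) {T' : Type w} [Ring T'] {σ : Sᵐᵒᵖ →+* T'}
    (hσ : Function.Surjective σ) {P' : Type w'} [AddCommGroup P'] [Module T' P']
    [hfin : Module.Finite T' P'] (π : P →ₛₗ[σ] P') (hπ : Function.Surjective π)
    (hker : LinearMap.ker π = opIdeal I' • (⊤ : Submodule Sᵐᵒᵖ P)) : I ≤ I' := by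
  obtain ⟨N, hN, hN'⟩ := exists_fg_sup_eq_top hσ π hπ hfin
  exact hS.le_of_isBigLeft I I' hI hP hN (hker ▸ hN')

/-- The same module is `I`-big and finitely generated modulo `I'`. Used in both directions, this
makes the images of different `ι_I` disjoint. -/
theorem IsOrderLike.iotaGraph_le (hS : IsOrderLike S z) {I I' : Ideal S} [I.IsTwoSided]
    [I'.IsTwoSided] (hI : IsIdempotentElem I) {y : IsoClass.{v, v} (S ⧸ I)ᵐᵒᵖ}
    {y' : IsoClass.{v, v} (S ⧸ I')ᵐᵒᵖ} {x : IsoClass.{v, v} Sᵐᵒᵖ}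
    (h : IotaGraph I y x) (h' : IotaGraph I' y' x) : I ≤ I' := by
  obtain ⟨P', rfl⟩ := cls_surj y
  obtain ⟨P'', rfl⟩ := cls_surj y'
  obtain ⟨P, rfl⟩ := cls_surj x
  obtain ⟨-, -, -, hPb, -⟩ := iotaGraph_cls_iff.1 h
  obtain ⟨⟨n, hn⟩, -, -, -, π', hπ', hker'⟩ := iotaGraph_cls_iff.1 h'
  have := hn.finite
  exact hS.le_of_surjective hI hPb (op_mk_surjective I') π' hπ' hker'

/-- The maps `ι_I : V(S / I) → V*(S)`. -/
theorem IsOrderLike.exists_iota (hS : IsOrderLike S z) (I : NonzeroTraceIdeal S) :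
    ∃ ι : V (S ⧸ I.ideal)ᵐᵒᵖ (S ⧸ I.ideal) →ₙ+ IsoClass.{v, v} Sᵐᵒᵖ,
      Function.Injective ι ∧ (∀ y x, ι y = x ↔ IotaGraph I.ideal y x) ∧
      Set.range ι ⊆ VStar Sᵐᵒᵖ S := by
  have hI := I.isIdempotentElem
  choose ι hι using fun y : V (S ⧸ I.ideal)ᵐᵒᵖ (S ⧸ I.ideal) =>
    hS.exists_iotaGraph I.ideal hI y.2
  refine ⟨⟨ι, fun y y' => hS.iotaGraph_unique hI (hι _) ((hι y).add (hι y'))⟩,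
    fun y y' hyy => Subtype.ext ((hι y).injective ?_), fun y x => ⟨?_, fun h => ?_⟩, ?_⟩
  · have h : ι y = ι y' := hyy
    rw [h]
    exact hι y'
  · rintro rfl
    exact hι y
  · exact hS.iotaGraph_unique hI (hι y) h
  · rintro _ ⟨y, rfl⟩
    obtain ⟨-, P', P, -, hx, hPc, hPp, -⟩ := hι y
    change ι y ∈ _
    rw [← hx]
    exact mem_VStar_op hPc hPp

/-- Classes of countably generated projective modules that are not finitely generated are in
`B(S)`. -/
theorem IsOrderLike.mem_BRing_iff (hS : IsOrderLike S z) {P : ModuleCat.{v} Sᵐᵒᵖ} :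
    cls P ∈ BRing S ↔ CountablyGenerated Sᵐᵒᵖ P ∧ Module.Projective Sᵐᵒᵖ P ∧
      ¬ Module.Finite Sᵐᵒᵖ P := by
  constructor
  · rintro ⟨I, y, h⟩
    obtain ⟨P', rfl⟩ := cls_surj y
    obtain ⟨-, hPc, hPp, hPb, -⟩ := iotaGraph_cls_iff.1 h
    exact ⟨hPc, hPp, hS.not_finite_of_isBigLeft I.ideal I.isIdempotentElem I.ne_bot hPb⟩
  · rintro ⟨hPc, hPp, hfin⟩
    obtain ⟨I, _, hI, hne, hPb, P', π, n, hπ, hker, hn⟩ := hS.exists_isBigLeft hPc hPp hfin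
    have hI' : I ∈ traceIdeals S := by
      rw [hS.traceIdeals_eq]
      exact ⟨inferInstance, hI⟩
    have h : IotaGraph I (cls P') (cls P) :=
      iotaGraph_cls_iff.2 ⟨⟨n, hn⟩, hPc, hPp, hPb, π, hπ, hker⟩
    let J : NonzeroTraceIdeal S := ⟨I, hI', hne⟩
    exact ⟨J, (cls P' : IsoClass.{v, v} (S ⧸ I)ᵐᵒᵖ), h⟩

end Iota

/-! ### Transfer of the classification to `Add(M)` -/

section AddM

variable {A : Type u} [Ring A] {M : Type v} [AddCommGroup M] [Module A M]

theorem IsSummand.inAddInf {X : Type w} [AddCommGroup X] [Module A X]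
    (h : IsSummand A X (ℕ →₀ M)) : InAddInf.{u, v, w, w'} A M X :=
  ⟨ULift.{w'} ℕ, h.trans (isSummand_of_equiv (Finsupp.domLCongr Equiv.ulift.symm))⟩

variable [Module.Finite A M]

theorem IsSummand.countablyGenerated {X : Type w} [AddCommGroup X] [Module A X]
    (h : IsSummand A X (ℕ →₀ M)) : CountablyGenerated A X :=
  .of_isSummand h (countablyGenerated_finsupp countablyGenerated_of_finite)

theorem mem_VStar_iff {X : ModuleCat.{v} A} : cls X ∈ VStar A M ↔ IsSummand A X (ℕ →₀ M) := by
  constructor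
  · rintro ⟨X', hX', hc, h⟩
    obtain ⟨e⟩ := cls_eq_iff.1 hX'
    exact (isSummand_nat_of_countablyGenerated h hc).of_equiv e
  · intro h
    exact ⟨X, rfl, h.countablyGenerated, h.inAddInf⟩

theorem mem_V_iff {X : ModuleCat.{v} A} :
    cls X ∈ V A M ↔ IsSummand A X (ℕ →₀ M) ∧ Module.Finite A X := by
  constructor
  · intro h
    obtain ⟨n, hn⟩ := inAddFin_of_mem_V h
    exact ⟨hn.trans (isSummand_finsupp_of_injective Fin.val Fin.val_injective), hn.finite⟩
  · rintro ⟨h, _⟩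
    exact ⟨X, rfl, inAddFin_of_finite h⟩

/-- `Hom(M, X)` is countably generated and projective for `X` a countably generated module in
`Add(M)`. -/
theorem IsSummand.homRight_projective {X : Type w} [AddCommGroup X] [Module A X]
    (h : IsSummand A X (ℕ →₀ M)) : CountablyGenerated (Module.End A M)ᵐᵒᵖ (HomRight A M X) ∧
      Module.Projective (Module.End A M)ᵐᵒᵖ (HomRight A M X) :=
  isSummand_nat_iff.1 h.homRight

variable {z : Module.End A M}

theorem mem_BModule_iff (hS : IsOrderLike (Module.End A M) z) {X : ModuleCat.{v} A} :
    cls X ∈ BModule A M ↔ IsSummand A X (ℕ →₀ M) ∧ ¬ Module.Finite A X := by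
  have h1 : cls X ∈ BModule A M ↔ cls X ∈ VStar A M ∧
      cls (ModuleCat.of (Module.End A M)ᵐᵒᵖ (HomRight A M X)) ∈ BRing (Module.End A M) := Iff.rfl
  rw [h1, mem_VStar_iff, hS.mem_BRing_iff]
  refine and_congr_right fun h => ?_
  rw [← finite_homRight_iff h]
  exact ⟨fun h' => h'.2.2, fun h' => ⟨h.homRight_projective.1, h.homRight_projective.2, h'⟩⟩

theorem BModule_eq (hS : IsOrderLike (Module.End A M) z) :
    BModule A M = (VStar A M : Set (IsoClass.{u, v} A)) \ V A M := by
  ext x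
  obtain ⟨X, rfl⟩ := cls_surj x
  rw [mem_BModule_iff hS, Set.mem_sdiff, SetLike.mem_coe, SetLike.mem_coe, mem_VStar_iff, mem_V_iff]
  tauto

theorem add_mem_BModule (hS : IsOrderLike (Module.End A M) z) {x y : IsoClass.{u, v} A}
    (hx : x ∈ BModule A M) (hy : y ∈ BModule A M) : x + y ∈ BModule A M := by
  have h := add_mem hx.1 hy.1
  obtain ⟨X, rfl⟩ := cls_surj x
  obtain ⟨Y, rfl⟩ := cls_surj y
  rw [cls_add] at h ⊢
  rw [mem_BModule_iff hS] at hx ⊢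
  exact ⟨mem_VStar_iff.1 h, fun hfin => hx.2 (.of_surjective (LinearMap.fst A X Y)
    LinearMap.fst_surjective)⟩

/-- Injectivity is full faithfulness of `Hom(M, -)` on `Add(M)`; surjectivity comes from splitting
idempotents of `M^(ℕ)`. -/
theorem bijOn_homClass (hS : IsOrderLike (Module.End A M) z) :
    Set.BijOn (homClass A M) (BModule A M) (BRing (Module.End A M)) := by
  refine ⟨fun x hx => hx.2, fun x hx y hy hxy => ?_, fun b hb => ?_⟩
  · obtain ⟨X, rfl⟩ := cls_surj x
    obtain ⟨Y, rfl⟩ := cls_surj y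
    obtain ⟨e⟩ := cls_eq_iff.1 hxy
    exact cls_eq_iff.2 (nonempty_equiv_of_homRight ((mem_BModule_iff hS).1 hx).1
      ((mem_BModule_iff hS).1 hy).1 e)
  · obtain ⟨P, rfl⟩ := cls_surj b
    obtain ⟨hPc, hPp, -⟩ := hS.mem_BRing_iff.1 hb
    obtain ⟨X, hX, he⟩ := exists_homRight_equiv (isSummand_nat_of_projective hPc hPp)
    have h : homClass A M (cls (ModuleCat.of A X)) = cls P := cls_eq_iff.2 he
    refine ⟨cls (ModuleCat.of A X), ⟨mem_VStar_iff.2 hX, ?_⟩, h⟩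
    rw [h]
    exact hb

/-- `B(S)` is a finite union of images of free monoids of finite rank. The classes `ι_I(0)` belong
to the generators along with the images of the basis elements, since they are not neutral in
`V*(S)`. -/
theorem exists_finite_closure_eq_BModule (hS : IsOrderLike (Module.End A M) z)
    [Finite (NonzeroTraceIdeal (Module.End A M))]
    (hfree : ∀ I : NonzeroTraceIdeal (Module.End A M), ∃ n : ℕ,
        Nonempty (V (Module.End A M ⧸ I.ideal)ᵐᵒᵖ (Module.End A M ⧸ I.ideal) ≃+
          (Fin n →₀ ℕ))) :
    ∃ G : Set (IsoClass.{u, v} A), G.Finite ∧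
        (AddSubsemigroup.closure G : Set (IsoClass.{u, v} A)) = BModule A M := by
  choose n φ using hfree
  choose ι hι using hS.exists_iota
  let ψ := fun I => (φ I).some
  let G₀ : Set (IsoClass.{v, v} (Module.End A M)ᵐᵒᵖ) :=
    ⋃ I, insert (ι I 0) (Set.range fun j => ι I ((ψ I).symm (Finsupp.single j 1)))
  have hG₀ : G₀.Finite := Set.finite_iUnion fun I => (Set.finite_range _).insert _
  let G := BModule A M ∩ homClass A M ⁻¹' G₀
  have hG : G.Finite := Set.Finite.of_finite_image (f := homClass A M)
    (hG₀.subset (by rintro _ ⟨x, hx, rfl⟩; exact hx.2))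
    ((bijOn_homClass hS).injOn.mono Set.inter_subset_left)
  refine ⟨G, hG, Set.Subset.antisymm ?_ fun x hx => ?_⟩
  · let B : AddSubsemigroup (IsoClass.{u, v} A) := ⟨BModule A M, add_mem_BModule hS⟩
    exact (AddSubsemigroup.closure_le (S := B)).2 Set.inter_subset_left
  · have hmem : ∀ I y, ι I y ∈ BRing (Module.End A M) := fun I y =>
      ⟨I, y, ((hι I).2.1 y _).1 rfl⟩
    have key : ∀ I (c : Fin (n I) →₀ ℕ), ∀ x ∈ BModule A M,
        homClass A M x = ι I ((ψ I).symm c) → x ∈ AddSubsemigroup.closure G := by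
      intro I c
      induction c using Finsupp.induction_linear with
      | zero =>
        intro x hx hxc
        refine AddSubsemigroup.subset_closure ⟨hx, Set.mem_iUnion.2 ⟨I, .inl ?_⟩⟩
        rw [hxc, map_zero]
      | add c d hc hd =>
        intro x hx hxc
        obtain ⟨x₁, hx₁, h₁⟩ := (bijOn_homClass hS).surjOn (hmem I ((ψ I).symm c))
        obtain ⟨x₂, hx₂, h₂⟩ := (bijOn_homClass hS).surjOn (hmem I ((ψ I).symm d))
        have : x = x₁ + x₂ := (bijOn_homClass hS).injOn hx (add_mem_BModule hS hx₁ hx₂) (by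
          rw [hxc, map_add, map_add, map_add, h₁, h₂])
        rw [this]
        exact add_mem (hc x₁ hx₁ h₁) (hd x₂ hx₂ h₂)
      | single j m =>
        have hind : ∀ m : ℕ, ∀ x ∈ BModule A M,
            homClass A M x = ι I ((ψ I).symm (Finsupp.single j m)) →
              x ∈ AddSubsemigroup.closure G := by
          intro m
          induction m with
          | zero =>
            intro x hx hxc
            refine AddSubsemigroup.subset_closure ⟨hx, Set.mem_iUnion.2 ⟨I, .inl ?_⟩⟩
            rw [hxc, Finsupp.single_zero, map_zero]
          | succ m ih =>
            intro x hx hxc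
            obtain ⟨x₁, hx₁, h₁⟩ := (bijOn_homClass hS).surjOn
              (hmem I ((ψ I).symm (Finsupp.single j m)))
            obtain ⟨x₂, hx₂, h₂⟩ := (bijOn_homClass hS).surjOn
              (hmem I ((ψ I).symm (Finsupp.single j 1)))
            have : x = x₁ + x₂ := (bijOn_homClass hS).injOn hx (add_mem_BModule hS hx₁ hx₂) (by
              rw [hxc, Finsupp.single_add, map_add, map_add, map_add, h₁, h₂])
            rw [this]
            exact add_mem (ih x₁ hx₁ h₁) (AddSubsemigroup.subset_closure
              ⟨hx₂, Set.mem_iUnion.2 ⟨I, .inr ⟨j, h₂.symm⟩⟩⟩)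
        exact hind m
    obtain ⟨I, y, hy⟩ := hx.2
    have h := ((hι I).2.1 ⟨y, hy.1⟩ _).2 hy
    exact key I (ψ I ⟨y, hy.1⟩) x hx (by rw [AddEquiv.symm_apply_apply, h])

theorem IsIndecomposable.subsingleton_or_subsingleton {X : Type w} [AddCommGroup X] [Module A X]
    (hX : IsIndecomposable A X) {Y Z : Type*} [AddCommGroup Y] [Module A Y] [AddCommGroup Z]
    [Module A Z] (e : X ≃ₗ[A] Y × Z) : Subsingleton Y ∨ Subsingleton Z := by
  have hc : IsCompl (LinearMap.ker (LinearMap.fst A Y Z ∘ₗ e.toLinearMap))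
      (LinearMap.ker (LinearMap.snd A Y Z ∘ₗ e.toLinearMap)) := by
    refine IsCompl.of_eq (le_bot_iff.1 fun x hx => ?_) (eq_top_iff.2 fun x _ => ?_)
    · exact (Submodule.mem_bot A).2 (e.map_eq_zero_iff.1 (Prod.ext hx.1 hx.2))
    · rw [Submodule.mem_sup]
      refine ⟨e.symm (0, (e x).2), by simp, e.symm ((e x).1, 0), by simp, ?_⟩
      rw [← map_add, Prod.mk_add_mk, zero_add, add_zero, Prod.mk.eta, e.symm_apply_apply]
  rcases hX.2 _ _ hc with h | h
  · right
    refine subsingleton_of_forall_eq 0 fun z => ?_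
    have : e.symm (0, z) ∈ (⊥ : Submodule A X) := h ▸ (by simp)
    simpa using this
  · left
    refine subsingleton_of_forall_eq 0 fun y => ?_
    have : e.symm (y, 0) ∈ (⊥ : Submodule A X) := h ▸ (by simp)
    simpa using this

/-- An indecomposable `X` would be countably generated by Kaplansky's theorem. Then `Hom(M, X)` is
`I`-big for some `I ≠ 0` and absorbs a projective `W` of trace `I`, so `X` splits off a nonzero
module `Y` with `Hom(M, Y) ≅ W`; the complement is isomorphic to `X` and nonzero as well. -/
theorem not_isIndecomposable (hS : IsOrderLike (Module.End A M) z) {X : Type w} [AddCommGroup X]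
    [Module A X] (h : InAddInf.{u, v, w, w'} A M X) (hfin : ¬ Module.Finite A X) :
    ¬ IsIndecomposable A X := by
  intro hX
  have hX₁ := isSummand_nat_of_countablyGenerated h (hX.countablyGenerated h)
  obtain ⟨X', ⟨e⟩⟩ := exists_submodule_equiv hX₁
  have hX' : IsSummand A X' (ℕ →₀ M) := (isSummand_of_equiv e.symm).trans hX₁
  have hfin' : ¬ Module.Finite A X' := fun h => hfin (.equiv e.symm)
  rw [← finite_homRight_iff hX'] at hfin'
  obtain ⟨hPc, hPp⟩ := hX'.homRight_projective
  obtain ⟨I, _, hI, hne, hPb, -⟩ := hS.exists_isBigLeft hPc hPp hfin'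
  obtain ⟨W, hWc, hWp, hIW, hW⟩ := hS.exists_trace I hI
  obtain ⟨g⟩ := hPb.absorb hWc hWp hIW
  obtain ⟨Y, hY, ⟨g'⟩⟩ := exists_homRight_equiv (isSummand_nat_of_projective hWc hWp)
  have hXY : IsSummand A (X' × Y) (ℕ →₀ M) := hX'.prod
    ((Finsupp.sumFinsuppLEquivProdFinsupp A).symm.trans
      (Finsupp.domLCongr Equiv.natSumNatEquivNat)) hY
  obtain ⟨e'⟩ := nonempty_equiv_of_homRight hX' hXY (g.trans
    (((LinearEquiv.refl _ _).prodCongr g'.symm).trans (HomRight.prodEquiv A M X' Y).symm))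
  rcases hX.subsingleton_or_subsingleton (e.trans e') with h1 | h1
  · have := e.injective.subsingleton
    exact hfin inferInstance
  · have h2 : Subsingleton (HomRight A M Y) := inferInstanceAs (Subsingleton (M →ₗ[A] Y))
    have h3 : Subsingleton W := g'.symm.injective.subsingleton
    apply hne
    rw [← traceIdeal_eq hIW hW, eq_bot_iff]
    refine Submodule.span_le.2 ?_
    rintro _ ⟨f, p, rfl⟩
    rw [Subsingleton.elim p 0, map_zero]
    exact zero_mem _

end AddM

/-! ### Localizations that determine modules killed by a power of `f` -/

section Cover

variable {R : Type u} [CommRing R]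

/-- The localizations at the `Γ i` determine a module annihilated by `d`. -/
structure IsLocalCover (d : R) {ι : Type w} [Fintype ι] (e : ι → R) (Γ : ι → Submonoid R) :
    Prop where
  sum : d ∣ 1 - ∑ i, e i
  orthogonal : ∀ i j, i ≠ j → d ∣ e i * e j
  invertible : ∀ i, ∀ r ∈ Γ i, ∃ a, d ∣ a * r * e i - e i

/-- An artinian ring is the product of its localizations at its primes; the `e p` are the unit
vectors, and an element outside `p` is invertible in the factor at `p`. -/
theorem exists_orthogonal_of_isArtinianRing (B : Type u) [CommRing B] [IsArtinianRing B]
    [Fintype (PrimeSpectrum B)] :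
    ∃ e : PrimeSpectrum B → B, ∑ p, e p = 1 ∧ (∀ p q, p ≠ q → e p * e q = 0) ∧
      ∀ p, ∀ r ∉ p.asIdeal, ∃ a, a * r * e p = e p := by
  classical
  have hbij : Function.Bijective (PrimeSpectrum.toPiLocalization B) :=
    PrimeSpectrum.toPiLocalization_bijective
  choose g hg using hbij.surjective
  refine ⟨fun p => g (Pi.single p 1), hbij.injective ?_, fun p q hpq => hbij.injective ?_,
    fun p r hr => ?_⟩
  · rw [map_sum, map_one]
    simp only [hg]
    exact Finset.univ_sum_single (1 : PrimeSpectrum.PiLocalization B)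
  · rw [map_mul, map_zero, hg, hg]
    funext i
    by_cases hi : i = p
    · subst hi
      rw [Pi.mul_apply, Pi.zero_apply]
      exact mul_eq_zero_of_right _ (Pi.single_eq_of_ne hpq 1)
    · rw [Pi.mul_apply, Pi.single_eq_of_ne hi 1, zero_mul, Pi.zero_apply]
  · let r' : p.asIdeal.primeCompl := ⟨r, hr⟩
    refine ⟨g (Pi.single p (IsLocalization.mk' (Localization p.asIdeal.primeCompl) 1 r')),
      hbij.injective ?_⟩
    rw [map_mul, map_mul, hg, hg]
    funext q
    by_cases hq : q = p
    · subst hq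
      rw [Pi.mul_apply, Pi.mul_apply, Pi.single_eq_same, Pi.single_eq_same, mul_one]
      exact (IsLocalization.mk'_spec (Localization q.asIdeal.primeCompl) 1 r').trans (map_one _)
    · rw [Pi.mul_apply, Pi.mul_apply, Pi.single_eq_of_ne hq, Pi.single_eq_of_ne hq, mul_zero]

theorem exists_isLocalCover (d : R) [IsArtinianRing (R ⧸ Ideal.span {d})] :
    ∃ (ι : Type u) (_ : Fintype ι) (e : ι → R) (m : ι → MaximalSpectrum R),
      IsLocalCover d e fun i => (m i).asIdeal.primeCompl := by
  let B := R ⧸ Ideal.span {d}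
  let q : R →+* B := Ideal.Quotient.mk _
  have hq : Function.Surjective q := Ideal.Quotient.mk_surjective
  have hd : ∀ r, q r = 0 → d ∣ r := fun r hr =>
    Ideal.mem_span_singleton.1 (Ideal.Quotient.eq_zero_iff_mem.1 hr)
  have : Fintype (PrimeSpectrum B) := Fintype.ofFinite _
  obtain ⟨e, he, horth, hinv⟩ := exists_orthogonal_of_isArtinianRing B
  choose g hg using hq
  refine ⟨PrimeSpectrum B, inferInstance, fun p => g (e p), fun p => ⟨p.asIdeal.comap q, ?_⟩, ?_⟩
  · have : p.asIdeal.IsMaximal := inferInstance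
    exact Ideal.comap_isMaximal_of_surjective q Ideal.Quotient.mk_surjective
  · refine ⟨hd _ ?_, fun i j hij => hd _ ?_, fun i r hr => ?_⟩
    · rw [map_sub, map_one, map_sum]
      simp only [hg]
      rw [he, sub_self]
    · rw [map_mul, hg, hg, horth i j hij]
    · obtain ⟨a, ha⟩ := hinv i (q r) hr
      refine ⟨g a, hd _ ?_⟩
      rw [map_sub, map_mul, map_mul, hg, hg, ha, sub_self]

/-- No maximal ideal contains both `r` and `f`, so they are coprime, and so are `r` and `f ^ k`. -/
theorem exists_mul_add_mul_eq_one {f : R} {r : R}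
    (hr : r ∈ complUnion {m : MaximalSpectrum R | f ∈ m.asIdeal}) (k : ℕ) :
    ∃ a b, a * r + b * f ^ k = 1 := by
  suffices h : IsCoprime r f by
    obtain ⟨a, b, hab⟩ := h.pow_right (n := k)
    exact ⟨a, b, hab⟩
  rw [← Ideal.isCoprime_span_singleton_iff, Ideal.isCoprime_iff_sup_eq]
  by_contra hne
  obtain ⟨m, hm, hle⟩ := Ideal.exists_le_maximal _ hne
  exact hr ⟨m, hm⟩ (hle (Ideal.mem_sup_right (Ideal.mem_span_singleton_self f)))
    (hle (Ideal.mem_sup_left (Ideal.mem_span_singleton_self r)))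

theorem isLocalCover_complUnion (f : R) (k : ℕ) :
    IsLocalCover (f ^ k) (fun _ : PUnit.{w + 1} => (1 : R))
      fun _ => complUnion {m : MaximalSpectrum R | f ∈ m.asIdeal} where
  sum := by simp
  orthogonal i j hij := absurd (Subsingleton.elim i j) hij
  invertible i r hr := by
    obtain ⟨a, b, hab⟩ := exists_mul_add_mul_eq_one hr k
    refine ⟨a, -b, ?_⟩
    linear_combination hab

end Cover

section LocalGlobal

variable {R : Type u} [CommRing R] [IsNoetherianRing R] {M : Type v} [AddCommGroup M] [Module R M]
  [Module.Finite R M]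

/-- Through `φ i`, both `Hom(M, X)` and `Hom(M, Y)` have fraction maps to `Hom(M, Y_Γ)` for each `Γ
= Γ i`. Since `d` lies in `J`, the cover satisfies the hypotheses of the gluing result and the
reduction of `Hom(M, Y)` is carried over to `Hom(M, X)`. -/
theorem IsLocalCover.exists_surjective {d : R} {ι : Type w} [Fintype ι] {e : ι → R}
    {Γ : ι → Submonoid R} (hc : IsLocalCover d e Γ) {X Y : Type v} [AddCommGroup X] [Module R X]
    [AddCommGroup Y] [Module R Y]
    (φ : ∀ i, LocalizedModule (Γ i) X ≃ₗ[R] LocalizedModule (Γ i) Y)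
    {J : Ideal (Module.End R M)ᵐᵒᵖ} [J.IsTwoSided] (hd : algebraMap R _ d ∈ J) {T' : Type*}
    [Ring T'] {σ : (Module.End R M)ᵐᵒᵖ →+* T'} {Q' : Type*} [AddCommGroup Q'] [Module T' Q']
    (π : HomRight R M Y →ₛₗ[σ] Q') (hπ : Function.Surjective π)
    (hker : LinearMap.ker π = J • (⊤ : Submodule (Module.End R M)ᵐᵒᵖ (HomRight R M Y))) :
    ∃ g : HomRight R M X →ₛₗ[σ] Q', Function.Surjective g ∧
      LinearMap.ker g = J • (⊤ : Submodule (Module.End R M)ᵐᵒᵖ (HomRight R M X)) := by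
  have : Module.FinitePresentation R M := Module.finitePresentation_of_finite R M
  let _ : Module (Module.End R M)ᵐᵒᵖ Q' := Module.compHom Q' σ
  let _ : Module R Q' := Module.compHom Q' (algebraMap R (Module.End R M)ᵐᵒᵖ)
  have : IsScalarTower R (Module.End R M)ᵐᵒᵖ Q' := .of_algebraMap_smul fun _ _ => rfl
  let ρ : HomRight R M Y →ₗ[(Module.End R M)ᵐᵒᵖ] Q' := ⟨⟨π, π.map_add⟩, π.map_smulₛₗ⟩
  have hdvd : ∀ r, d ∣ r → algebraMap R (Module.End R M)ᵐᵒᵖ r ∈ J := by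
    rintro _ ⟨c, rfl⟩
    rw [map_mul]
    exact J.mul_mem_right _ hd
  obtain ⟨g, hg, hg'⟩ := exists_surjective_of_isFractionMap (J := J) (hdvd _ hc.sum)
    (fun i j hij => hdvd _ (hc.orthogonal i j hij))
    (fun i r hr => (hc.invertible i r hr).imp fun _ h => hdvd _ h)
    (fun i => isFractionMap_homMap (M := M) (Γ i)
      ((φ i).toLinearMap ∘ₗ LocalizedModule.mkLinearMap (Γ i) X))
    (fun i => isFractionMap_homMap (M := M) (Γ i) (LocalizedModule.mkLinearMap (Γ i) Y)) ρ hπ hker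
  exact ⟨⟨⟨g, g.map_add⟩, g.map_smul⟩, hg, hg'⟩

omit [IsNoetherianRing R] [Module.Finite R M] in
theorem algebraMap_pow_mem_opIdeal {f : R} {I : Ideal (Module.End R M)} [I.IsTwoSided] {k l : ℕ}
    (h : algebraMap R (Module.End R M) f ^ k ∈ I) (hkl : k ≤ l) :
    algebraMap R (Module.End R M)ᵐᵒᵖ (f ^ l) ∈ opIdeal I := by
  rw [mem_opIdeal, MulOpposite.algebraMap_apply, unop_op, map_pow, ← Nat.sub_add_cancel hkl,
    pow_add]
  exact I.mul_mem_left _ h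

/-- Countably generated modules in `Add(M)` which are not finitely generated are determined by their
localizations. -/
theorem nonempty_equiv_of_localization {f : R}
    (hS : IsOrderLike (Module.End R M) (algebraMap R _ f)) {X Y : Type v} [AddCommGroup X]
    [Module R X] [AddCommGroup Y] [Module R Y] (hX : IsSummand R X (ℕ →₀ M))
    (hXf : ¬ Module.Finite R X) (hY : IsSummand R Y (ℕ →₀ M)) (hYf : ¬ Module.Finite R Y)
    (hloc : ∀ k : ℕ, ∃ (ι : Type w) (_ : Fintype ι) (e : ι → R) (Γ : ι → Submonoid R),
      IsLocalCover (f ^ k) e Γ ∧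
        ∀ i, Nonempty (LocalizedModule (Γ i) X ≃ₗ[R] LocalizedModule (Γ i) Y)) :
    Nonempty (X ≃ₗ[R] Y) := by
  obtain ⟨hPc, hPp⟩ := hX.homRight_projective
  obtain ⟨hQc, hQp⟩ := hY.homRight_projective
  rw [← finite_homRight_iff hX] at hXf
  rw [← finite_homRight_iff hY] at hYf
  obtain ⟨I, _, hI, hne, hPb, P', π, n, hπ, hker, hP'⟩ := hS.exists_isBigLeft hPc hPp hXf
  obtain ⟨I', _, hI', hne', hQb, Q', π', n', hπ', hker', hQ'⟩ := hS.exists_isBigLeft hQc hQp hYf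
  have := hP'.finite
  have := hQ'.finite
  obtain ⟨k, hk⟩ := hS.exists_pow_mem I hI hne
  obtain ⟨k', hk'⟩ := hS.exists_pow_mem I' hI' hne'
  -- The exponent `k + k'` makes one cover serve both `I` and `I'`.
  obtain ⟨ι, _, e, Γ, hc, hφ⟩ := hloc (k + k')
  let φ := fun i => (hφ i).some
  obtain ⟨g, hg, hgker⟩ := hc.exists_surjective (fun i => φ i)
    (algebraMap_pow_mem_opIdeal hk' (Nat.le_add_left k' k)) π' hπ' hker'
  obtain ⟨g', hg', hgker'⟩ := hc.exists_surjective (fun i => (φ i).symm)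
    (algebraMap_pow_mem_opIdeal hk (Nat.le_add_right k k')) π hπ hker
  -- `Hom(M, X)` is `I`-big and, through `g`, finitely generated modulo `I'`; the other inclusion is
  -- symmetric. After that both modules have the same reduction.
  obtain rfl : I = I' := le_antisymm
    (hS.le_of_surjective hI hPb (op_mk_surjective I') g hg hgker)
    (hS.le_of_surjective hI' hQb (op_mk_surjective I) g' hg' hgker')
  obtain ⟨E⟩ := hS.nonempty_equiv I hI hPb hQb hPc hPp hQc hQp g π' hg hπ' hgker hker'
  exact nonempty_equiv_of_homRight hX hY E

theorem nonempty_equiv_iff_localization [IsDomain R] [Ring.DimensionLEOne R] {f : R} (hf : f ≠ 0)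
    (hS : IsOrderLike (Module.End R M) (algebraMap R _ f)) {X Y : Type w} [AddCommGroup X]
    [Module R X] [AddCommGroup Y] [Module R Y] (hX : IsSummand R X (ℕ →₀ M))
    (hXf : ¬ Module.Finite R X) (hY : IsSummand R Y (ℕ →₀ M)) (hYf : ¬ Module.Finite R Y) :
    Nonempty (X ≃ₗ[R] Y) ↔ ∀ (m : Ideal R) [m.IsMaximal],
      Nonempty (LocalizedModule m.primeCompl X ≃ₗ[Localization m.primeCompl]
        LocalizedModule m.primeCompl Y) := by
  refine ⟨fun ⟨e⟩ m _ => ⟨locCongr m.primeCompl e⟩, fun h => ?_⟩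
  obtain ⟨X', ⟨a⟩⟩ := exists_submodule_equiv hX
  obtain ⟨Y', ⟨b⟩⟩ := exists_submodule_equiv hY
  obtain ⟨E⟩ := nonempty_equiv_of_localization.{u, v, u} hS ((isSummand_of_equiv a.symm).trans hX)
    (fun _ => hXf (.equiv a.symm)) ((isSummand_of_equiv b.symm).trans hY)
    (fun _ => hYf (.equiv b.symm)) fun k => by
      have := isArtinianRing_quotient_span (pow_ne_zero k hf)
      obtain ⟨ι, hι, e, m, hc⟩ := exists_isLocalCover (f ^ k)
      refine ⟨ι, hι, e, _, hc, fun i => ?_⟩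
      obtain ⟨φ⟩ := h (m i).asIdeal
      exact ⟨((locCongr _ a.symm).trans (φ.trans (locCongr _ b))).restrictScalars R⟩
  exact ⟨a.trans (E.trans b.symm)⟩

end LocalGlobal

/-! ### Ideals and reductions under localization of the ring -/

section LocalizingHom

variable {R : Type*} [CommRing R] {S : Type*} [Ring S] [Algebra R S] {S' : Type*} [Ring S']

/-- The ring homomorphism `φ` is injective and `S'` is obtained from `S` by inverting the central
elements coming from `Γ`. -/
structure IsLocalizingHom (Γ : Submonoid R) (φ : S →+* S') : Prop where
  surj : ∀ x, ∃ r ∈ Γ, ∃ s, φ (algebraMap R S r) * x = φ s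
  comm : ∀ r x, Commute (φ (algebraMap R S r)) x
  injective : Function.Injective φ
  torsion : ∀ r ∈ Γ, ∀ x, φ (algebraMap R S r) * x = 0 → x = 0

variable {Γ : Submonoid R} {φ : S →+* S'} {d : R}

theorem IsLocalizingHom.op (h : IsLocalizingHom Γ φ) : IsLocalizingHom Γ (RingHom.op φ) where
  surj x := by
    obtain ⟨r, hr, s, hs⟩ := h.surj (unop x)
    refine ⟨r, hr, MulOpposite.op s, unop_injective ?_⟩
    exact (h.comm r (unop x)).symm.trans hs
  comm r x := unop_injective (h.comm r (unop x)).symm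
  injective _ _ hxy := unop_injective (h.injective (op_injective hxy))
  torsion r hr x hx := by
    refine unop_injective (h.torsion r hr _ ((h.comm r (unop x)).trans ?_))
    exact congr_arg unop hx

/-- This is how denominators coprime to `d` are removed: in `x = a (r x) + b (d x)` the first term
has its denominator cleared and the second lies in every two-sided ideal containing `d`. -/
theorem IsLocalizingHom.eq_add (hΓ : ∀ r ∈ Γ, ∃ a b, a * r + b * d = 1) (φ : S →+* S') {r : R}
    (hr : r ∈ Γ) : ∃ a b, ∀ x : S', x = φ (algebraMap R S a) * (φ (algebraMap R S r) * x) +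
      φ (algebraMap R S b) * (φ (algebraMap R S d) * x) := by
  obtain ⟨a, b, hab⟩ := hΓ r hr
  refine ⟨a, b, fun x => ?_⟩
  rw [← mul_assoc, ← mul_assoc, ← map_mul, ← map_mul, ← map_mul, ← map_mul, ← add_mul, ← map_add,
    ← map_add, hab, map_one, map_one, one_mul]

theorem IsLocalizingHom.exists_sub_mem (h : IsLocalizingHom Γ φ)
    (hΓ : ∀ r ∈ Γ, ∃ a b, a * r + b * d = 1) (J : Ideal S') [J.IsTwoSided]
    (hd : φ (algebraMap R S d) ∈ J) (x : S') : ∃ s, x - φ s ∈ J := by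
  obtain ⟨r, hr, s, hs⟩ := h.surj x
  obtain ⟨a, b, hab⟩ := eq_add hΓ φ hr
  refine ⟨algebraMap R S a * s, ?_⟩
  rw [hab x, hs, map_mul, add_sub_cancel_left]
  exact J.mul_mem_left _ (J.mul_mem_right _ hd)

theorem IsLocalizingHom.le_of_comap_le (h : IsLocalizingHom Γ φ)
    (hΓ : ∀ r ∈ Γ, ∃ a b, a * r + b * d = 1) {I I' : Ideal S'} [I'.IsTwoSided]
    (hd : φ (algebraMap R S d) ∈ I') (hII' : I.comap φ ≤ I'.comap φ) : I ≤ I' := by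
  intro x hx
  obtain ⟨r, hr, s, hs⟩ := h.surj x
  obtain ⟨a, b, hab⟩ := eq_add hΓ φ hr
  rw [hab x, hs]
  have h1 : s ∈ I.comap φ := by
    rw [Ideal.mem_comap, ← hs]
    exact I.mul_mem_left _ hx
  exact add_mem (I'.mul_mem_left _ (hII' h1)) (I'.mul_mem_left _ (I'.mul_mem_right _ hd))

theorem IsLocalizingHom.comap_ne_bot (h : IsLocalizingHom Γ φ) {I : Ideal S'} (hI : I ≠ ⊥) :
    I.comap φ ≠ ⊥ := by
  intro hbot
  refine hI (eq_bot_iff.2 fun x hx => ?_)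
  obtain ⟨r, hr, s, hs⟩ := h.surj x
  have h1 : s ∈ I.comap φ := by
    rw [Ideal.mem_comap, ← hs]
    exact I.mul_mem_left _ hx
  rw [hbot, Ideal.mem_bot] at h1
  rw [h1, map_zero] at hs
  exact h.torsion r hr x hs

/-- For `x` in the contraction, clearing denominators in `φ x ∈ I * I` puts `r x` into the square of
the contraction for some `r ∈ Γ`. Also `d x` is in that square because `d` is in the contraction,
and `r` and `d` are comaximal. -/
theorem IsLocalizingHom.isIdempotentElem_comap (h : IsLocalizingHom Γ φ)
    (hΓ : ∀ r ∈ Γ, ∃ a b, a * r + b * d = 1) {I : Ideal S'} [I.IsTwoSided]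
    (hd : φ (algebraMap R S d) ∈ I) (hI : IsIdempotentElem I) :
    IsIdempotentElem (I.comap φ) := by
  have hmul : ∀ y ∈ I * I, ∃ r ∈ Γ, ∃ w ∈ I.comap φ * I.comap φ,
      φ (algebraMap R S r) * y = φ w := by
    intro y hy
    refine Submodule.smul_induction_on hy (fun a ha b hb => ?_) ?_
    · obtain ⟨r, hr, s, hs⟩ := h.surj a
      obtain ⟨r', hr', s', hs'⟩ := h.surj b
      refine ⟨r * r', mul_mem hr hr', s * s', Ideal.mul_mem_mul ?_ ?_, ?_⟩
      · rw [Ideal.mem_comap, ← hs]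
        exact I.mul_mem_left _ ha
      · rw [Ideal.mem_comap, ← hs']
        exact I.mul_mem_left _ hb
      · rw [map_mul, map_mul, map_mul, ← hs, ← hs', smul_eq_mul]
        exact (h.comm r' a).mul_mul_mul_comm _ _
    · rintro a b ⟨r, hr, s, hs, hrs⟩ ⟨r', hr', s', hs', hrs'⟩
      refine ⟨r * r', mul_mem hr hr', algebraMap R S r' * s + algebraMap R S r * s',
        add_mem (Ideal.mul_mem_left _ _ hs) (Ideal.mul_mem_left _ _ hs'), ?_⟩
      rw [map_add, map_mul φ, map_mul φ, ← hrs, ← hrs', mul_add, map_mul, map_mul, mul_assoc,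
        ← mul_assoc (φ (algebraMap R S r')), (h.comm r' (φ (algebraMap R S r))).eq, mul_assoc, mul_assoc]
  refine le_antisymm Ideal.mul_le_left fun x hx => ?_
  have hx' : φ x ∈ I * I := by
    rw [hI]
    exact hx
  obtain ⟨r, hr, w, hw, hrw⟩ := hmul _ hx'
  rw [← map_mul] at hrw
  obtain ⟨a, b, hab⟩ := hΓ r hr
  have h1 : x = algebraMap R S a * (algebraMap R S r * x) +
      algebraMap R S b * (algebraMap R S d * x) := by
    rw [← mul_assoc, ← mul_assoc, ← map_mul, ← map_mul, ← add_mul, ← map_add, hab, map_one, one_mul]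
  rw [h1, h.injective hrw]
  exact add_mem (Ideal.mul_mem_left _ _ hw) (Ideal.mul_mem_left _ _ (Ideal.mul_mem_mul hd hx))

end LocalizingHom

section Transfer

variable {R : Type*} [CommRing R] {T : Type*} [Ring T] [Algebra R T] {T₁ : Type*} [Ring T₁]
  {Γ : Submonoid R} {φ : T →+* T₁} {d : R} {L : Type*} [AddCommGroup L] [Module T L]
  {L₁ : Type*} [AddCommGroup L₁] [Module T₁ L₁] {Θ : L →ₛₗ[φ] L₁}

/-- Write `l = a (r l) + b (d l)`: a suitable `r` clears the denominator of the coefficient in `J₁`,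
and `d` is in `J`. -/
theorem IsLocalizingHom.mem_smul_top_iff (h : IsLocalizingHom Γ φ)
    (hΓ : ∀ r ∈ Γ, ∃ a b, a * r + b * d = 1) (hΘ : Function.Bijective Θ) {J : Ideal T}
    [J.IsTwoSided] {J₁ : Ideal T₁} (hJ : ∀ t, t ∈ J ↔ φ t ∈ J₁) (hd : algebraMap R T d ∈ J)
    (l : L) : Θ l ∈ J₁ • (⊤ : Submodule T₁ L₁) ↔ l ∈ J • (⊤ : Submodule T L) := by
  constructor
  · suffices hs : ∀ y ∈ J₁ • (⊤ : Submodule T₁ L₁), ∀ l, Θ l = y → l ∈ J • (⊤ : Submodule T L) from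
      fun h => hs _ h l rfl
    intro y hy
    refine Submodule.smul_induction_on hy (fun x hx p _ l hl => ?_) fun y y' hy hy' l hl => ?_
    · obtain ⟨l', rfl⟩ := hΘ.2 p
      obtain ⟨r, hr, t, ht⟩ := h.surj x
      obtain ⟨a, b, hab⟩ := hΓ r hr
      have h1 : algebraMap R T r • l = t • l' := hΘ.1 (by
        rw [map_smulₛₗ, map_smulₛₗ, hl, ← ht, mul_smul])
      have h2 : t ∈ J := (hJ t).2 (by
        rw [← ht]
        exact J₁.mul_mem_left _ hx)
      have h3 : l = algebraMap R T a • algebraMap R T r • l +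
          algebraMap R T b • algebraMap R T d • l := by
        rw [← mul_smul, ← mul_smul, ← map_mul, ← map_mul, ← add_smul, ← map_add, hab, map_one,
          one_smul]
      rw [h3, h1]
      exact add_mem (Submodule.smul_mem _ _ (Submodule.smul_mem_smul h2 Submodule.mem_top))
        (Submodule.smul_mem _ _ (Submodule.smul_mem_smul hd Submodule.mem_top))
    · obtain ⟨k, rfl⟩ := hΘ.2 y
      obtain ⟨k', rfl⟩ := hΘ.2 y'
      rw [← map_add] at hl
      rw [hΘ.1 hl]
      exact add_mem (hy k rfl) (hy' k' rfl)
  · intro hl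
    refine Submodule.smul_induction_on hl (fun t ht p _ => ?_) fun p q hp hq => ?_
    · rw [map_smulₛₗ]
      exact Submodule.smul_mem_smul ((hJ t).1 ht) Submodule.mem_top
    · rw [map_add]
      exact add_mem hp hq

variable [Module R L] [IsScalarTower R T L] {P : Type*} [AddCommGroup P] [Module T P] [Module R P]
  [IsScalarTower R T P] {T' : Type*} [Ring T'] {σ : T₁ →+* T'} {Y : Type*} [AddCommGroup Y]
  [Module T' Y] {u : P →ₗ[T] L}

omit [Algebra R T] [IsScalarTower R T L] in
theorem isFractionMap_id : IsFractionMap Γ (LinearMap.id : L →ₗ[T] L) where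
  surj l := ⟨1, one_mem _, l, one_smul R l⟩
  ker _ hp := ⟨1, one_mem _, (one_smul R _).trans hp⟩

/-- Gluing with the single idempotent `1` applies because elements of `Γ` are invertible modulo `d`.
It carries the reduction of `P` to its localization `L`, and `Θ` carries it on to `L₁`. -/
theorem IsLocalizingHom.exists_extension (h : IsLocalizingHom Γ φ)
    (hΓ : ∀ r ∈ Γ, ∃ a b, a * r + b * d = 1) (hΘ : Function.Bijective Θ) {J : Ideal T}
    [J.IsTwoSided] {J₁ : Ideal T₁} [J₁.IsTwoSided] (hJ : ∀ t, t ∈ J ↔ φ t ∈ J₁)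
    (hd : algebraMap R T d ∈ J) (hu : IsFractionMap Γ u) (π : P →ₛₗ[σ.comp φ] Y)
    (hπ : Function.Surjective π) (hker : LinearMap.ker π = J • (⊤ : Submodule T P))
    (hσ : J₁ ≤ RingHom.ker σ) :
    ∃ g : L₁ →ₛₗ[σ] Y, Function.Surjective g ∧
      LinearMap.ker g = J₁ • (⊤ : Submodule T₁ L₁) := by
  let _ : Module T Y := Module.compHom Y (σ.comp φ)
  let _ : Module R Y := Module.compHom Y (algebraMap R T)
  have : IsScalarTower R T Y := .of_algebraMap_smul fun _ _ => rfl
  let ρ : P →ₗ[T] Y := ⟨⟨π, π.map_add⟩, π.map_smulₛₗ⟩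
  obtain ⟨g₀, hg₀, hker₀⟩ := exists_surjective_of_isFractionMap (J := J) (ι := PUnit.{1})
    (e := fun _ => (1 : R)) (Γ := fun _ => Γ)
    (by simp) (fun i j hij => absurd (Subsingleton.elim i j) hij)
    (fun _ r hr => by
      obtain ⟨a, b, hab⟩ := hΓ r hr
      refine ⟨a, ?_⟩
      rw [show a * r * 1 - 1 = -b * d by linear_combination hab, map_mul]
      exact J.mul_mem_left _ hd)
    (fun _ => isFractionMap_id (L := L)) (fun _ => hu) ρ hπ hker
  have hmem := h.mem_smul_top_iff hΓ hΘ hJ hd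
  choose Ψ hΨ using hΘ.2
  have hΨ' : ∀ l, Ψ (Θ l) = l := fun l => hΘ.1 (hΨ _)
  have hadd : ∀ x y, Ψ (x + y) = Ψ x + Ψ y := fun x y => hΘ.1 (by rw [map_add, hΨ, hΨ, hΨ])
  have hsmul : ∀ t x, Ψ (φ t • x) = t • Ψ x := fun t x => hΘ.1 (by rw [map_smulₛₗ, hΨ, hΨ])
  have hzero : ∀ y ∈ J₁ • (⊤ : Submodule T₁ L₁), g₀ (Ψ y) = 0 := fun y hy => by
    rw [← LinearMap.mem_ker, hker₀, ← hmem, hΨ]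
    exact hy
  refine ⟨⟨⟨fun y => g₀ (Ψ y), fun x y => by rw [hadd, map_add]⟩, fun c y => ?_⟩, fun y => ?_, ?_⟩
  -- Semilinearity over all of `T₁` follows from that over `T`: modulo `J₁` every scalar comes from
  -- `T`, and `J₁` contributes nothing on either side.
  · obtain ⟨t, ht⟩ := h.exists_sub_mem hΓ J₁ ((hJ _).1 hd) c
    change g₀ (Ψ (c • y)) = σ c • g₀ (Ψ y)
    have h1 : σ c = σ (φ t) := by
      rw [← sub_eq_zero, ← map_sub]
      exact hσ ht
    have h2 : c • y = (c - φ t) • y + φ t • y := by rw [← add_smul, sub_add_cancel]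
    rw [h1, h2, hadd, map_add, hzero _ (Submodule.smul_mem_smul ht Submodule.mem_top), zero_add,
      hsmul, map_smul]
    rfl
  · obtain ⟨l, rfl⟩ := hg₀ y
    exact ⟨Θ l, congr_arg g₀ (hΨ' l)⟩
  · ext y
    change g₀ (Ψ y) = 0 ↔ _
    rw [← LinearMap.mem_ker, hker₀, ← hmem, hΨ]

theorem IsLocalizingHom.exists_restriction (h : IsLocalizingHom Γ φ)
    (hΓ : ∀ r ∈ Γ, ∃ a b, a * r + b * d = 1) (hΘ : Function.Bijective Θ) {J : Ideal T}
    [J.IsTwoSided] {J₁ : Ideal T₁} (hJ : ∀ t, t ∈ J ↔ φ t ∈ J₁)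
    (hd : algebraMap R T d ∈ J) (hu : IsFractionMap Γ u) (π : L₁ →ₛₗ[σ] Y)
    (hπ : Function.Surjective π) (hker : LinearMap.ker π = J₁ • (⊤ : Submodule T₁ L₁)) :
    ∃ g : P →ₛₗ[σ.comp φ] Y, Function.Surjective g ∧
      LinearMap.ker g = J • (⊤ : Submodule T P) := by
  let _ : Module T Y := Module.compHom Y (σ.comp φ)
  let _ : Module R Y := Module.compHom Y (algebraMap R T)
  have : IsScalarTower R T Y := .of_algebraMap_smul fun _ _ => rfl
  let ρ : L →ₗ[T] Y := ⟨⟨fun l => π (Θ l), fun x y => by rw [map_add, map_add]⟩, fun t x => by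
    change π (Θ (t • x)) = σ (φ t) • π (Θ x)
    rw [map_smulₛₗ, map_smulₛₗ]⟩
  obtain ⟨g, hg, hg'⟩ := exists_surjective_of_isFractionMap (J := J) (ι := PUnit.{1})
    (e := fun _ => (1 : R)) (Γ := fun _ => Γ)
    (by simp) (fun i j hij => absurd (Subsingleton.elim i j) hij)
    (fun _ r hr => by
      obtain ⟨a, b, hab⟩ := hΓ r hr
      refine ⟨a, ?_⟩
      rw [show a * r * 1 - 1 = -b * d by linear_combination hab, map_mul]
      exact J.mul_mem_left _ hd)
    (fun _ => hu) (fun _ => isFractionMap_id (L := L)) ρ (hπ.comp hΘ.2) (by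
      ext l
      rw [← h.mem_smul_top_iff hΓ hΘ hJ hd, ← hker]
      rfl)
  exact ⟨⟨⟨g, g.map_add⟩, g.map_smul⟩, hg, hg'⟩

end Transfer

/-! ### Localizing modules in `Add(M)` and their endomorphism rings -/

section LocMap

variable {R : Type u} [CommRing R] (Γ : Submonoid R)

theorem locExt {X : Type*} [AddCommGroup X] [Module R X] {Z : Type*} [AddCommGroup Z]
    [Module (Localization Γ) Z] {g h : LocalizedModule Γ X →ₗ[Localization Γ] Z}
    (hgh : ∀ x, g (LocalizedModule.mkLinearMap Γ X x) = h (LocalizedModule.mkLinearMap Γ X x)) :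
    g = h := by
  refine LinearMap.ext fun y => ?_
  obtain ⟨⟨x, s⟩, hx⟩ := IsLocalizedModule.surj Γ (LocalizedModule.mkLinearMap Γ X) y
  have hs : IsUnit (algebraMap R (Localization Γ) s) := IsLocalization.map_units _ s
  have hx' : algebraMap R (Localization Γ) s • y = LocalizedModule.mkLinearMap Γ X x := by
    rw [algebraMap_smul]
    exact hx
  refine hs.smul_left_cancel.1 ?_
  rw [← map_smul, ← map_smul, hx', hgh]

variable {X : Type*} [AddCommGroup X] [Module R X] {Y : Type*} [AddCommGroup Y] [Module R Y]
  {Z : Type*} [AddCommGroup Z] [Module R Z] [Module (Localization Γ) Z]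
  [IsScalarTower R (Localization Γ) Z]

/-- The extension to `X_Γ` of a linear map from `X` to a localized module. -/
def locLift (f : Y →ₗ[R] Z) [IsLocalizedModule Γ f] (β : X →ₗ[R] Z) :
    LocalizedModule Γ X →ₗ[Localization Γ] Z :=
  (IsLocalizedModule.lift Γ (LocalizedModule.mkLinearMap Γ X) β
    (IsLocalizedModule.map_units f)).extendScalarsOfIsLocalization Γ (Localization Γ)

theorem locLift_apply (f : Y →ₗ[R] Z) [IsLocalizedModule Γ f] (β : X →ₗ[R] Z) (x : X) :
    locLift Γ f β (LocalizedModule.mkLinearMap Γ X x) = β x :=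
  IsLocalizedModule.lift_apply Γ (LocalizedModule.mkLinearMap Γ X) β
    (IsLocalizedModule.map_units f) x

/-- The extension to `X_Γ` of a linear map `X → Y_Γ`. -/
def locExtend (β : X →ₗ[R] LocalizedModule Γ Y) :
    LocalizedModule Γ X →ₗ[Localization Γ] LocalizedModule Γ Y :=
  locLift Γ (LocalizedModule.mkLinearMap Γ Y) β

theorem locExtend_apply (β : X →ₗ[R] LocalizedModule Γ Y) (x : X) :
    locExtend Γ β (LocalizedModule.mkLinearMap Γ X x) = β x :=
  locLift_apply Γ _ β x

theorem mkLinearMap_injective [IsDomain R] [Module.IsTorsionFree R X]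
    (hΓ : Γ ≤ nonZeroDivisors R) : Function.Injective (LocalizedModule.mkLinearMap Γ X) := by
  intro x y hxy
  obtain ⟨s, hs⟩ := IsLocalizedModule.exists_of_eq (S := Γ) hxy
  exact smul_right_injective X (nonZeroDivisors.ne_zero (hΓ s.2)) hs

/-- A summand of `M^(Λ)` localizes to a summand of `M_Γ^(Λ)`. -/
theorem exists_localized_summand {M : Type v} [AddCommGroup M] [Module R M] {Λ : Type w}
    {i : X →ₗ[R] (Λ →₀ M)} {p : (Λ →₀ M) →ₗ[R] X} (hip : p ∘ₗ i = LinearMap.id) :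
    ∃ (j : LocalizedModule Γ X →ₗ[Localization Γ] (Λ →₀ LocalizedModule Γ M))
      (q : (Λ →₀ LocalizedModule Γ M) →ₗ[Localization Γ] LocalizedModule Γ X),
      q ∘ₗ j = LinearMap.id ∧ ∀ x, j (LocalizedModule.mkLinearMap Γ X x) =
        Finsupp.mapRange.linearMap (LocalizedModule.mkLinearMap Γ M) (i x) := by
  let m := Finsupp.mapRange.linearMap (α := Λ) (LocalizedModule.mkLinearMap Γ M)
  let mX := LocalizedModule.mkLinearMap Γ X
  let E := LocalizedModule.mkLinearMap Γ (Λ →₀ M)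
  let j := locLift Γ m (m ∘ₗ i)
  let k := locLift Γ m m
  let k' : (Λ →₀ LocalizedModule Γ M) →ₗ[Localization Γ] LocalizedModule Γ X :=
    (IsLocalizedModule.lift Γ m (mX ∘ₗ p)
      (IsLocalizedModule.map_units mX)).extendScalarsOfIsLocalization Γ (Localization Γ)
  refine ⟨j, k', locExt Γ fun x => ?_, fun x => locLift_apply Γ m (m ∘ₗ i) x⟩
  rw [LinearMap.comp_apply, locLift_apply]
  refine (IsLocalizedModule.lift_apply Γ m (mX ∘ₗ p) (IsLocalizedModule.map_units mX) (i x)).trans ?_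
  exact congr_arg mX (LinearMap.congr_fun hip x)

theorem IsSummand.localized {M : Type v} [AddCommGroup M] [Module R M] {Λ : Type w}
    (h : IsSummand R X (Λ →₀ M)) :
    IsSummand (Localization Γ) (LocalizedModule Γ X) (Λ →₀ LocalizedModule Γ M) := by
  obtain ⟨i, p, hip⟩ := h
  obtain ⟨j, q, hqj, -⟩ := exists_localized_summand Γ hip
  exact ⟨j, q, hqj⟩

/-- As `M` embeds in `M_Γ`, an element of `X` has the same support as its image in the localization.
A finite support bound for `X_Γ` therefore holds for `X`, which becomes a summand of a finite power
of `M`. -/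
theorem finite_of_finite_localized [IsDomain R] {M : Type v} [AddCommGroup M]
    [Module R M] [Module.Finite R M] [Module.IsTorsionFree R M] (hΓ : Γ ≤ nonZeroDivisors R)
    {Λ : Type w} (h : IsSummand R X (Λ →₀ M))
    (hfin : Module.Finite (Localization Γ) (LocalizedModule Γ X)) : Module.Finite R X := by
  obtain ⟨i, p, hip⟩ := h
  obtain ⟨j, q, hqj, hj⟩ := exists_localized_summand Γ hip
  obtain ⟨t, ht⟩ := hfin.fg_top
  have hs : (⋃ y ∈ (t : Set (LocalizedModule Γ X)), ((j y).support : Set Λ)).Finite :=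
    t.finite_toSet.biUnion fun y _ => (j y).support.finite_toSet
  have := hs.to_subtype
  have h : IsSummand R X ((⋃ y ∈ (t : Set (LocalizedModule Γ X)), ((j y).support : Set Λ) : Set Λ) →₀
      M) := isSummand_finsupp_subtype hip _ fun x l hl => ?_
  · exact h.finite
  refine support_subset_of_span j ht (LocalizedModule.mkLinearMap Γ X x) ?_
  rw [hj, Finset.mem_coe, Finsupp.mem_support_iff]
  intro h0
  refine Finsupp.mem_support_iff.1 hl (mkLinearMap_injective Γ hΓ ?_)
  rw [map_zero]
  exact h0

end LocMap

section LocEnd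

variable {R : Type u} [CommRing R] (Γ : Submonoid R) (M : Type v) [AddCommGroup M] [Module R M]

/-- Localization of endomorphisms. -/
def endLoc : Module.End R M →+* Module.End (Localization Γ) (LocalizedModule Γ M) where
  toFun s := locExtend Γ (LocalizedModule.mkLinearMap Γ M ∘ₗ s)
  map_one' := locExt Γ fun x => locExtend_apply Γ _ x
  map_zero' := locExt Γ fun x => by
    rw [locExtend_apply]
    exact map_zero (LocalizedModule.mkLinearMap Γ M)
  map_add' s t := locExt Γ fun x => by
    rw [locExtend_apply, LinearMap.add_apply, locExtend_apply, locExtend_apply]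
    exact map_add (LocalizedModule.mkLinearMap Γ M) (s x) (t x)
  map_mul' s t := locExt Γ fun x => by
    rw [locExtend_apply, Module.End.mul_apply, locExtend_apply]
    exact (locExtend_apply Γ (LocalizedModule.mkLinearMap Γ M ∘ₗ s) (t x)).symm

variable {M}

theorem endLoc_mk (s : Module.End R M) (x : M) :
    endLoc Γ M s (LocalizedModule.mkLinearMap Γ M x) = LocalizedModule.mkLinearMap Γ M (s x) :=
  locExtend_apply Γ (LocalizedModule.mkLinearMap Γ M ∘ₗ s) x

theorem endLoc_algebraMap (r : R) : endLoc Γ M (algebraMap R _ r) =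
    algebraMap (Localization Γ) _ (algebraMap R (Localization Γ) r) :=
  locExt Γ fun x => by
    rw [endLoc_mk, Module.algebraMap_end_apply, Module.algebraMap_end_apply, map_smul,
      algebraMap_smul]

theorem isLocalizingHom_endLoc [IsDomain R] [Module.FinitePresentation R M]
    [Module.IsTorsionFree R M] (hΓ : Γ ≤ nonZeroDivisors R) :
    IsLocalizingHom Γ (endLoc Γ M) where
  surj x := by
    obtain ⟨h, s, hs⟩ := Module.FinitePresentation.exists_lift_of_isLocalizedModule Γ
      (LocalizedModule.mkLinearMap Γ M) (x.restrictScalars R ∘ₗ LocalizedModule.mkLinearMap Γ M)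
    refine ⟨s, s.2, h, locExt Γ fun m => ?_⟩
    rw [Module.End.mul_apply, endLoc_mk, endLoc_algebraMap, Module.algebraMap_end_apply,
      algebraMap_smul]
    exact (LinearMap.congr_fun hs m).symm
  comm r x := by
    rw [endLoc_algebraMap]
    exact Algebra.commutes _ x
  injective s t hst := LinearMap.ext fun x => mkLinearMap_injective Γ hΓ (by
    rw [← endLoc_mk, ← endLoc_mk, hst])
  torsion r hr x hx := by
    have hr' : IsUnit (algebraMap R (Localization Γ) r) := IsLocalization.map_units _ (⟨r, hr⟩ : Γ)
    rw [endLoc_algebraMap] at hx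
    exact ((hr'.map (algebraMap (Localization Γ) (Module.End (Localization Γ)
      (LocalizedModule Γ M)))).mul_right_eq_zero).1 hx

/-- `Hom_R(M, X_Γ) ≅ Hom(M_Γ, X_Γ)`. -/
def homRightLoc (M : Type v) [AddCommGroup M] [Module R M] (X : Type w) [AddCommGroup X]
    [Module R X] : HomRight R M (LocalizedModule Γ X) →ₛₗ[RingHom.op (endLoc Γ M)]
      HomRight (Localization Γ) (LocalizedModule Γ M) (LocalizedModule Γ X) where
  toFun α := .of (locExtend Γ α.hom)
  map_add' α β := locExt Γ fun x => by
    refine (locExtend_apply Γ (α + β).hom x).trans ?_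
    exact (congr_arg₂ (· + ·) (locExtend_apply Γ α.hom x) (locExtend_apply Γ β.hom x)).symm
  map_smul' s α := locExt Γ fun x => by
    refine (locExtend_apply Γ (s • α).hom x).trans ?_
    refine (locExtend_apply Γ α.hom ((unop s : Module.End R M) x)).symm.trans ?_
    rw [← endLoc_mk]
    rfl

theorem homRightLoc_bijective (M : Type v) [AddCommGroup M] [Module R M] (X : Type w)
    [AddCommGroup X] [Module R X] : Function.Bijective (homRightLoc Γ M X) := by
  constructor
  · intro α β h
    refine HomRight.ext fun m => ?_
    rw [← locExtend_apply Γ α.hom m, ← locExtend_apply Γ β.hom m]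
    exact LinearMap.congr_fun h _
  · intro β
    exact ⟨.of (β.hom.restrictScalars R ∘ₗ LocalizedModule.mkLinearMap Γ M),
      locExt Γ fun x => locExtend_apply Γ
        (β.hom.restrictScalars R ∘ₗ LocalizedModule.mkLinearMap Γ M) x⟩

/-- The localization of an almost dual basis. -/
def AlmostDualBasis.localized {f : R} {n : ℕ} (b : AlmostDualBasis M f n) :
    AlmostDualBasis (LocalizedModule Γ M) (algebraMap R (Localization Γ) f) n where
  vec i := LocalizedModule.mkLinearMap Γ M (b.vec i)
  coord i := locLift Γ (Algebra.linearMap R (Localization Γ))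
    (Algebra.linearMap R (Localization Γ) ∘ₗ b.coord i)
  sum_smul x := by
    have h : (∑ i, (locLift Γ (Algebra.linearMap R (Localization Γ))
        (Algebra.linearMap R (Localization Γ) ∘ₗ b.coord i)).smulRight
          (LocalizedModule.mkLinearMap Γ M (b.vec i))) =
        algebraMap (Localization Γ) (Module.End (Localization Γ) (LocalizedModule Γ M))
          (algebraMap R (Localization Γ) f) := by
      refine locExt Γ fun m => ?_
      rw [LinearMap.sum_apply, Module.algebraMap_end_apply, algebraMap_smul, ← map_smul,
        ← b.sum_smul, map_sum]
      refine Finset.sum_congr rfl fun i _ => ?_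
      rw [LinearMap.smulRight_apply, locLift_apply, map_smul]
      exact algebraMap_smul (Localization Γ) (b.coord i m) _
    have := LinearMap.congr_fun h x
    rwa [LinearMap.sum_apply] at this

theorem isOrderLike_localized [IsDomain R] [IsNoetherianRing R] [Ring.DimensionLEOne R]
    [Module.Finite R M] [Module.IsTorsionFree R M] (hΓ : Γ ≤ nonZeroDivisors R) {f : R}
    (hf : f ≠ 0) {n : ℕ} (b : AlmostDualBasis M f n) :
    IsOrderLike (Module.End (Localization Γ) (LocalizedModule Γ M))
      (algebraMap (Localization Γ) _ (algebraMap R (Localization Γ) f)) := by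
  have := IsLocalization.isDomain_localization hΓ
  have : IsNoetherianRing (Localization Γ) := IsLocalization.isNoetherianRing Γ _ inferInstance
  have := Ring.DimensionLEOne.localization (Localization Γ) hΓ
  have : Module.Finite (Localization Γ) (LocalizedModule Γ M) :=
    Module.Finite.of_isLocalizedModule Γ (LocalizedModule.mkLinearMap Γ M)
  refine isOrderLike_end (fun h => hf ?_) (b.localized Γ)
  exact IsLocalization.injective (Localization Γ) hΓ (h.trans (map_zero _).symm)

end LocEnd

/-! ### Localization at the maximal ideals containing `f` -/

section Semilocal

variable {R : Type u} [CommRing R] [IsDomain R] [IsNoetherianRing R] [Ring.DimensionLEOne R]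
  {M : Type v} [AddCommGroup M] [Module R M] [Module.Finite R M] [Module.IsTorsionFree R M]

/-- Every countably generated module in `Add(M_Γ)` that is not finitely generated is the localization
of a countably generated module in `Add(M)`. -/
theorem exists_localization_equiv {f : R} (hf : f ≠ 0) {n : ℕ} (b : AlmostDualBasis M f n)
    {Γ : Submonoid R} (hΓ : Γ ≤ nonZeroDivisors R)
    (hcop : ∀ r ∈ Γ, ∀ k, ∃ a b, a * r + b * f ^ k = 1)
    {Z : Type (max u v)} [AddCommGroup Z] [Module (Localization Γ) Z]
    (hZ : IsSummand (Localization Γ) Z (ℕ →₀ LocalizedModule Γ M))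
    (hZf : ¬ Module.Finite (Localization Γ) Z) :
    ∃ X : Submodule R (ℕ →₀ M), IsSummand R X (ℕ →₀ M) ∧ ¬ Module.Finite R X ∧
      Nonempty (LocalizedModule Γ X ≃ₗ[Localization Γ] Z) := by
  have hS := isOrderLike_end hf b
  have hS₁ := isOrderLike_localized Γ hΓ hf b
  have : Module.FinitePresentation R M := Module.finitePresentation_of_finite R M
  have : Module.Finite (Localization Γ) (LocalizedModule Γ M) :=
    Module.Finite.of_isLocalizedModule Γ (LocalizedModule.mkLinearMap Γ M)
  have hφ := isLocalizingHom_endLoc (M := M) Γ hΓ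
  have hpow : ∀ {I : Ideal (Module.End (Localization Γ) (LocalizedModule Γ M))} {k : ℕ},
      (algebraMap (Localization Γ) _ (algebraMap R (Localization Γ) f)) ^ k ∈ I →
        endLoc Γ M (algebraMap R _ (f ^ k)) ∈ I := fun {I k} h => by
    rw [endLoc_algebraMap, map_pow, map_pow]
    exact h
  have hop : ∀ (I : Ideal (Module.End (Localization Γ) (LocalizedModule Γ M))) [I.IsTwoSided]
      (t : (Module.End R M)ᵐᵒᵖ), t ∈ opIdeal (I.comap (endLoc Γ M)) ↔
        RingHom.op (endLoc Γ M) t ∈ opIdeal I := fun I _ t => by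
    rw [mem_opIdeal, mem_opIdeal]
    rfl
  obtain ⟨hQc, hQp⟩ := hZ.homRight_projective
  obtain ⟨I, _, hI, hne, hQb, P', π', m, hπ', hker', hP'⟩ := hS₁.exists_isBigLeft hQc hQp
    (by rwa [finite_homRight_iff hZ])
  have := hP'.finite
  obtain ⟨k, hk⟩ := hS₁.exists_pow_mem I hI hne
  have hcopk : ∀ r ∈ Γ, ∃ a b, a * r + b * f ^ k = 1 := fun r hr => hcop r hr k
  -- The ideal belonging to `Z` contracts to a nonzero idempotent ideal of `End(M)`, and `σ` below
  -- identifies the two quotient rings.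
  have hI₀ := hφ.isIdempotentElem_comap hcopk (hpow hk) hI
  have hne₀ := hφ.comap_ne_bot hne
  let σ := (RingHom.op (Ideal.Quotient.mk I)).comp (RingHom.op (endLoc Γ M))
  have hσ : Function.Surjective σ := fun x => by
    obtain ⟨y, rfl⟩ := op_mk_surjective I x
    obtain ⟨s, hs⟩ := hφ.exists_sub_mem hcopk I (hpow hk) (unop y)
    refine ⟨op s, congr_arg op ?_⟩
    exact (Ideal.Quotient.eq.2 hs).symm
  have hσker : RingHom.ker σ = opIdeal (I.comap (endLoc Γ M)) := by
    ext t
    rw [hop]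
    rfl
  -- The reduction `P'` of `Hom(M_Γ, Z)` is realized again over `End(M)`, by a module big with
  -- respect to the contracted ideal.
  obtain ⟨P, hPc, hPp, hPb, π, hπ, hker⟩ := hS.exists_big (I.comap (endLoc Γ M)) hI₀ σ hσ hσker hP'
  obtain ⟨X, hX, ⟨E⟩⟩ := exists_homRight_equiv (isSummand_nat_of_projective hPc hPp)
  have hXb : IsBigLeft (opIdeal (I.comap (endLoc Γ M))) (HomRight R M X) := hPb.of_equiv E.symm
  have hXf : ¬ Module.Finite R X := by
    rw [← finite_homRight_iff hX]
    exact hS.not_finite_of_isBigLeft _ hI₀ hne₀ hXb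
  refine ⟨X, hX, hXf, ?_⟩
  have hX₁ := hX.localized Γ
  have hX₁f : ¬ Module.Finite (Localization Γ) (LocalizedModule Γ X) := fun h =>
    hXf (finite_of_finite_localized Γ hΓ hX h)
  have hu := isFractionMap_homMap (M := M) Γ (X := X) (Z := LocalizedModule Γ X)
    (LocalizedModule.mkLinearMap Γ X)
  have hΘ := homRightLoc_bijective Γ M X
  obtain ⟨g, hg, hgker⟩ := hφ.op.exists_extension hcopk hΘ (hop I)
    (mem_opIdeal.2 (hpow hk)) hu (π.comp E.toLinearMap) (hπ.comp E.surjective) (by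
      ext α
      rw [← smul_top_map_equiv _ E, ← hker]
      rfl) le_rfl
  obtain ⟨hGc, hGp⟩ := hX₁.homRight_projective
  -- Bigness is not transported along the localization; instead the ideal `I'` belonging to `X_Γ` is
  -- compared with `I`. Restricting the reduction modulo `I'` to `X` gives an inclusion of
  -- contractions, hence `I ≤ I'`, and the extended reduction `g` gives `I' ≤ I`.
  obtain ⟨I', _, hI', hne', hGb, P'', π'', m', hπ'', hker'', hP''⟩ := hS₁.exists_isBigLeft hGc hGp
    (by rwa [finite_homRight_iff hX₁])
  have := hP''.finite
  obtain ⟨k', hk'⟩ := hS₁.exists_pow_mem I' hI' hne'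
  have hcopk' : ∀ r ∈ Γ, ∃ a b, a * r + b * f ^ k' = 1 := fun r hr => hcop r hr k'
  obtain ⟨g', hg', hgker'⟩ := hφ.op.exists_restriction hcopk' hΘ (hop I')
    (mem_opIdeal.2 (hpow hk')) hu π'' hπ'' hker''
  have hσ' : Function.Surjective
      ((RingHom.op (Ideal.Quotient.mk I')).comp (RingHom.op (endLoc Γ M))) := fun x => by
    obtain ⟨y, rfl⟩ := op_mk_surjective I' x
    obtain ⟨s, hs⟩ := hφ.exists_sub_mem hcopk' I' (hpow hk') (unop y)
    refine ⟨op s, congr_arg op ?_⟩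
    exact (Ideal.Quotient.eq.2 hs).symm
  obtain rfl : I = I' := le_antisymm
    (hφ.le_of_comap_le hcopk' (hpow hk') (hS.le_of_surjective hI₀ hXb hσ' g' hg' hgker'))
    (hS₁.le_of_surjective hI' hGb (op_mk_surjective I) g hg hgker)
  obtain ⟨e⟩ := hS₁.nonempty_equiv I hI hGb hQb hGc hGp hQc hQp g π' hg hπ' hgker hker'
  exact nonempty_equiv_of_homRight hX₁ hZ e

/-- Elements of `Γ` are invertible modulo all powers of `f`, so the localization at `Γ` alone is a
local cover; this gives injectivity, and surjectivity is the lifting of modules from `Add(M_Γ)`. -/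
theorem bijOn_locClass {f : R} (hf : f ≠ 0) (hfu : ¬ IsUnit f) {n : ℕ}
    (b : AlmostDualBasis M f n) :
    Set.BijOn (locClass.{u, v} (complUnion {m : MaximalSpectrum R | f ∈ m.asIdeal})) (BModule R M)
        (BModule (Localization (complUnion {m : MaximalSpectrum R | f ∈ m.asIdeal}))
          (LocalizedModule (complUnion {m : MaximalSpectrum R | f ∈ m.asIdeal}) M)) := by
  set Γ := complUnion {m : MaximalSpectrum R | f ∈ m.asIdeal} with hΓdef
  have hcop : ∀ r ∈ Γ, ∀ k, ∃ a b, a * r + b * f ^ k = 1 := fun r hr k =>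
    exists_mul_add_mul_eq_one hr k
  -- That `f` is not a unit enters here: some maximal ideal contains it, so `0` is not in `Γ`.
  have hΓ : Γ ≤ nonZeroDivisors R := by
    intro r hr
    rw [mem_nonZeroDivisors_iff_ne_zero]
    rintro rfl
    obtain ⟨m, hm, hfm⟩ := exists_max_ideal_of_mem_nonunits hfu
    exact hr ⟨m, hm⟩ hfm (zero_mem m)
  have hS := isOrderLike_end hf b
  have hS₁ := isOrderLike_localized Γ hΓ hf b
  have : Module.Finite (Localization Γ) (LocalizedModule Γ M) :=
    Module.Finite.of_isLocalizedModule Γ (LocalizedModule.mkLinearMap Γ M)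
  refine ⟨fun x hx => ?_, fun x hx y hy hxy => ?_, fun z hz => ?_⟩
  · obtain ⟨X, rfl⟩ := cls_surj x
    obtain ⟨hX, hXf⟩ := (mem_BModule_iff hS).1 hx
    exact (mem_BModule_iff hS₁ (X := ModuleCat.of (Localization Γ) (LocalizedModule Γ X))).2
      ⟨hX.localized Γ, fun h => hXf (finite_of_finite_localized Γ hΓ hX h)⟩
  · obtain ⟨X, rfl⟩ := cls_surj x
    obtain ⟨Y, rfl⟩ := cls_surj y
    obtain ⟨hX, hXf⟩ := (mem_BModule_iff hS).1 hx
    obtain ⟨hY, hYf⟩ := (mem_BModule_iff hS).1 hy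
    obtain ⟨e⟩ := cls_eq_iff.1 hxy
    exact cls_eq_iff.2 (nonempty_equiv_of_localization.{u, v, 0} hS hX hXf hY hYf fun k =>
      ⟨PUnit, inferInstance, _, _, isLocalCover_complUnion f k, fun _ => ⟨e.restrictScalars R⟩⟩)
  · obtain ⟨Z, rfl⟩ := cls_surj z
    obtain ⟨hZ, hZf⟩ := (mem_BModule_iff hS₁).1 hz
    obtain ⟨X, hX, hXf, he⟩ := exists_localization_equiv hf b hΓ hcop hZ hZf
    exact ⟨cls (ModuleCat.of R X), (mem_BModule_iff hS).2 ⟨hX, hXf⟩, cls_eq_iff.2 he⟩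

omit [IsDomain R] [IsNoetherianRing R] [Ring.DimensionLEOne R] [Module.Finite R M] [Module.IsTorsionFree R M] in
theorem AlmostDualBasis.mul {f : R} {n : ℕ} (b : AlmostDualBasis M f n) (c : R) :
    Nonempty (AlmostDualBasis M (c * f) n) :=
  ⟨⟨b.vec, fun i => c • b.coord i, fun x => by
    simp only [LinearMap.smul_apply, smul_assoc, ← Finset.smul_sum, b.sum_smul, mul_smul]⟩⟩

-- These maximal ideals are minimal primes over `(f)`, since a prime containing `f ≠ 0` is already
-- maximal, and a noetherian ring has finitely many such primes.
omit [IsDomain R] in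
theorem finite_maximalSpectrum_mem {f : R} (hf : f ≠ 0) :
    {m : MaximalSpectrum R | f ∈ m.asIdeal}.Finite := by
  have h := (Ideal.span {f}).finite_minimalPrimes_of_isNoetherianRing R
  refine Set.Finite.of_finite_image (f := MaximalSpectrum.asIdeal) (h.subset ?_)
    fun m _ m' _ h => MaximalSpectrum.ext h
  rintro _ ⟨m, hm, rfl⟩
  refine ⟨⟨m.isMaximal.isPrime, (Ideal.span_singleton_le_iff_mem _).2 hm⟩, fun p hp hpm => ?_⟩
  have hfp : f ∈ p := (Ideal.span_singleton_le_iff_mem _).1 hp.2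
  have hpne : p ≠ ⊥ := by
    rintro rfl
    exact hf hfp
  have := hp.1
  have hpmax := Ring.DimensionLEOne.maximalOfPrime hpne hp.1
  exact (hpmax.eq_of_le m.isMaximal.ne_top hpm).ge

end Semilocal

theorem dimensionLEOne_of_ringKrullDim {R : Type u} [CommRing R] [IsDomain R]
    (hR : ringKrullDim R = 1) : Ring.DimensionLEOne R := by
  have : Ring.KrullDimLE 1 R := (Order.krullDimLE_iff 1 (PrimeSpectrum R)).2 hR.le
  refine ⟨fun {p} hp hp' => ?_⟩
  exact Ideal.isMaximal_of_isPrime_of_ne_bot p hp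

theorem exists_ne_zero_not_isUnit_of_ringKrullDim {R : Type u} [CommRing R] [IsDomain R]
    (hR : ringKrullDim R = 1) : ∃ f : R, f ≠ 0 ∧ ¬ IsUnit f := by
  by_contra! h
  have hfield : IsField R := ⟨⟨0, 1, zero_ne_one⟩, mul_comm, fun {a} ha => (h a ha).exists_right_inv⟩
  have := ringKrullDim_eq_zero_of_isField hfield
  rw [hR] at this
  exact one_ne_zero this

end DirectSumDecomp

end

/-! ### Assembly of the theorem -/

open DirectSumDecomp in
theorem mainTheorem10
    (R : Type u) [CommRing R] [IsDomain R] [IsNoetherianRing R] (hR : ringKrullDim R = 1)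
    (M : Type v) [AddCommGroup M] [Module R M] [Module.Finite R M] [Module.IsTorsionFree R M] :
    -- (i)
    (BModule R M = (VStar R M : Set (IsoClass.{u, v} R)) \ V R M ∧
      ∀ (X : Type w) [AddCommGroup X] [Module R X], InAddInf.{u, v, w, w'} R M X →
        ¬ Module.Finite R X → ¬ IsIndecomposable R X) ∧
    -- (ii)
    (∀ (X Y : Type w) [AddCommGroup X] [Module R X] [AddCommGroup Y] [Module R Y],
      InAddInf.{u, v, w, w'} R M X → CountablyGenerated R X → ¬ Module.Finite R X →
      InAddInf.{u, v, w, w'} R M Y → CountablyGenerated R Y → ¬ Module.Finite R Y →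
      (Nonempty (X ≃ₗ[R] Y) ↔
        ∀ (m : Ideal R) [m.IsMaximal],
          Nonempty (LocalizedModule m.primeCompl X ≃ₗ[Localization m.primeCompl]
            LocalizedModule m.primeCompl Y))) ∧
    -- (iii)
    (traceIdeals (Module.End R M) =
        {I : Ideal (Module.End R M) | I.IsTwoSided ∧ IsIdempotentElem I} ∧
      (traceIdeals (Module.End R M)).Finite ∧
      ∀ I : NonzeroTraceIdeal (Module.End R M),
        IsArtinianRing (Module.End R M ⧸ I.ideal) ∧
        IsArtinianRing (Module.End R M ⧸ I.ideal)ᵐᵒᵖ) ∧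
    -- (iv)
    (∃ F : Set (MaximalSpectrum R), F.Finite ∧ F.Nonempty ∧
      Set.BijOn (locClass.{u, v} (complUnion F)) (BModule R M)
        (BModule (Localization (complUnion F)) (LocalizedModule (complUnion F) M))) ∧
    -- (v)
    (Set.BijOn (homClass R M) (BModule R M) (BRing (Module.End R M)) ∧
      (∃ ι : ∀ I : NonzeroTraceIdeal (Module.End R M),
          V (Module.End R M ⧸ I.ideal)ᵐᵒᵖ (Module.End R M ⧸ I.ideal) →ₙ+
            IsoClass.{v, v} (Module.End R M)ᵐᵒᵖ,
        (∀ I, Function.Injective (ι I)) ∧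
        (∀ I y x, ι I y = x ↔ IotaGraph I.ideal y x) ∧
        (∀ I, Set.range (ι I) ⊆ VStar (Module.End R M)ᵐᵒᵖ (Module.End R M)) ∧
        Pairwise (fun I J => Disjoint (Set.range (ι I)) (Set.range (ι J))) ∧
        BRing (Module.End R M) = ⋃ I, Set.range (ι I)) ∧
      (∀ I : NonzeroTraceIdeal (Module.End R M), ∃ n : ℕ,
        Nonempty (V (Module.End R M ⧸ I.ideal)ᵐᵒᵖ (Module.End R M ⧸ I.ideal) ≃+
          (Fin n →₀ ℕ))) ∧
      ∃ G : Set (IsoClass.{u, v} R), G.Finite ∧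
        (AddSubsemigroup.closure G : Set (IsoClass.{u, v} R)) = BModule R M) := by
  have := dimensionLEOne_of_ringKrullDim hR
  obtain ⟨g, hg, hgu⟩ := exists_ne_zero_not_isUnit_of_ringKrullDim hR
  obtain ⟨f₀, hf₀, n, ⟨b₀⟩⟩ := exists_almostDualBasis (R := R) (M := M)
  -- The denominator `f₀` may be a unit, for instance when `M` is free. The nonunit factor `g`
  -- ensures that some maximal ideal contains `g * f₀`, so that `ℱ` is nonempty.
  obtain ⟨b⟩ := b₀.mul g
  have hf : g * f₀ ≠ 0 := mul_ne_zero hg hf₀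
  have hfu : ¬ IsUnit (g * f₀) := fun h => hgu (isUnit_of_mul_isUnit_left h)
  have hS := isOrderLike_end hf b
  have hfin : (traceIdeals (Module.End R M)).Finite := by
    rw [hS.traceIdeals_eq]
    exact hS.finite_idempotent
  have hart : ∀ I : NonzeroTraceIdeal (Module.End R M),
      IsArtinianRing (Module.End R M ⧸ I.ideal) ∧ IsArtinianRing (Module.End R M ⧸ I.ideal)ᵐᵒᵖ :=
    fun I => hS.artinian I.ideal (hS.exists_pow_mem I.ideal I.isIdempotentElem I.ne_bot)
  have hfree : ∀ I : NonzeroTraceIdeal (Module.End R M), ∃ n : ℕ,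
      Nonempty (V (Module.End R M ⧸ I.ideal)ᵐᵒᵖ (Module.End R M ⧸ I.ideal) ≃+ (Fin n →₀ ℕ)) :=
    fun I => by
      have := (hart I).2
      exact exists_V_op_addEquiv_finsupp _
  have : Finite (NonzeroTraceIdeal (Module.End R M)) :=
    (hfin.subset fun _ h => h.1 :
      {I : Ideal (Module.End R M) | I ∈ traceIdeals (Module.End R M) ∧ I ≠ ⊥}.Finite).to_subtype
  choose ι hinj hgraph hrange using hS.exists_iota
  refine ⟨⟨BModule_eq hS, fun X _ _ hX hXf => not_isIndecomposable hS hX hXf⟩,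
    fun X Y _ _ _ _ hX hXc hXf hY hYc hYf =>
      nonempty_equiv_iff_localization hf hS (isSummand_nat_of_countablyGenerated hX hXc) hXf
        (isSummand_nat_of_countablyGenerated hY hYc) hYf,
    ⟨hS.traceIdeals_eq, hfin, hart⟩,
    ⟨{m | g * f₀ ∈ m.asIdeal}, finite_maximalSpectrum_mem hf, ?_, bijOn_locClass hf hfu b⟩,
    bijOn_homClass hS, ⟨ι, hinj, hgraph, hrange, fun I J hIJ => ?_, ?_⟩, hfree,
    exists_finite_closure_eq_BModule hS hfree⟩
  · obtain ⟨m, hm, hfm⟩ := exists_max_ideal_of_mem_nonunits hfu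
    exact ⟨⟨m, hm⟩, hfm⟩
  · refine Set.disjoint_left.2 ?_
    rintro _ ⟨y, rfl⟩ ⟨y', hy'⟩
    have h := (hgraph I y _).1 rfl
    have h' := (hgraph J y' _).1 hy'
    have hle : I.ideal = J.ideal := le_antisymm (hS.iotaGraph_le I.isIdempotentElem h h')
      (hS.iotaGraph_le J.isIdempotentElem h' h)
    exact hIJ (Subtype.ext hle)
  · ext x
    rw [Set.mem_iUnion]
    constructor
    · rintro ⟨I, y, h⟩
      exact ⟨I, ⟨y, h.1⟩, (hgraph I _ _).2 h⟩
    · rintro ⟨I, y, h⟩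
      exact ⟨I, y, (hgraph I _ _).1 h⟩
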